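/- **Setting.** $\Omega$ is a finite state space, $X:\Omega\to\mathbb R$ a security, $[\underline y,\overline y]=[\min X,\max X]$, and $\Pi=(\Pi_1,\dots,\Pi_n)$ are the traders' partitions of $\Omega$, with $\bigcap_i\Pi_i(\omega)=\{\omega\}$ for all $\omega$. A *scoring rule* is a function $s(y,x)$, continuous in $y\in[\underline y,\overline y]$ and strictly proper: for every distribution on $\Omega$ and every random variable with values in $[\underline y,\overline y]$, the expected score is maximized over $y\in[\underline y,\overline y]$ exactly at the expected value. A *signal* $\mathcal R$ is a family $(\mathcal R(\cdot|\omega))_{\omega}$ of Borel probability measures on a Polish metric space $T$; $\mathcal E$ is a compact set of available signals (for the product of the weak topologies). A *cost structure* is $\kappa=(K,c)$ with $c>0$ and $K:\mathcal E\to[0,\infty]$ continuous, such that some $\mathcal R_0\in\mathcal E$ is uninformative ($\mathcal R_0(\cdot|\omega)$ does not depend on $\omega$) with $K(\mathcal R_0)=0$ and $K(\mathcal R)=O(D(\mathcal R,\mathcal R_0)^2)$ as $\mathcal R\to\mathcal R_0$ ($D$ = maximum over $\omega$ of the Lévy–Prokhorov distances), and $K(\mathcal R')\le K(\mathcal R)$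 whenever $\mathcal R'$ is a garbling of $\mathcal R$. For $\nu\in\Delta(\Omega)$, $\mathcal R_\nu$ is the law of the Bayesian posterior obtained from the prior $\nu$ by observing $\mathcal R$. **Game.** A state $\omega$ is drawn from a common prior $\mu\in\Delta(\Omega)$ and the market maker announces $y_0\in[\underline y,\overline y]$. At times $k=1,2,\dots$ the traders move cyclically, starting with trader 1. The mover, knowing his cell $\Pi_i(\omega)$, his own past signals and realizations, all past announcements, and a fresh independent uniform draw from $[0,1]$, chooses a signal $\mathcal R_k\in\mathcal E$ and an announcement in $[\underline y,\overline y]$ for each realization (measurably); a realization is drawn from $\mathcal R_k(\cdot|\omega)$, independently of the past given $\omega$ and $\mathcal R_k$, and the resulting announcement $y_k$ becomes public, while $\mathcal R_k$ and its realization stay private. The mover's payoff at time $k$ is $\beta^k\big(s(y_k,X(\omega))-s(y_{k-1},X(\omega))-cK(\mathcal R_k)\big)$, where $0<\beta\le1$. A trader's total payoff is the limit in $[-\infty,\infty]$, as $m\to\infty$, of the expected sum of his payoffs up to time $m$ (for $\beta<1$ it always exists and is the expected discounted sum). A strategy profile is a *Nash equilibrium* if every trader's total payoff is well defined and no unilateral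 deviation with a well-defined total payoff gives him more. *Information aggregates* if $y_k\to X$ in probability. **Separability.** $X$ is *non-separable at* $\mu\in\Delta(\Omega)$ if there is $v\in\mathbb R$ with $X(\omega)\ne v$ for some $\omega\in\mathrm{Supp}(\mu)$ and $E_\mu[X|\Pi_i(\omega)]=v$ for all $i$ and all $\omega\in\mathrm{Supp}(\mu)$. There is *no information acquisition at $\mu$ under $s$* if, for all $\omega\in\mathrm{Supp}(\mu)$, all $i$ and all $\mathcal R\in\mathcal E$, with $\nu=\mu(\cdot|\Pi_i(\omega))$, $$\int\sum_{\omega'}\gamma(\omega')\big[s(E_\gamma[X],X(\omega'))-s(E_\nu[X],X(\omega'))\big]\,d\mathcal R_\nu(\gamma)-cK(\mathcal R)\le0 .$$ For a set $S$ of scoring rules, $X$ is *$\kappa$ non-separable for $S$* if there is $\mu\in\Delta(\Omega)$ such that $X$ is non-separable at $\mu$ and there is no information acquisition at $\mu$ under every $s\in S$. $X$ is *$\kappa$ separable for $s$* if it is not $\kappa$ non-separable for $\{s\}$. **Assumption 1.** For every $\mu\in\Delta(\Omega)$, every $\mathcal R\in\mathcal E$ and every measurable family $(\mathcal R^\tau)_{\tau\in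 T}$ in $\mathcal E$ there is $\mathcal R'\in\mathcal E$ such that $\mathcal R'_\mu$ equals the law of the posterior obtained from $\mu$ by observing the realization $\tau$ of $\mathcal R$ and then the realization of $\mathcal R^\tau$, and $K(\mathcal R')\le K(\mathcal R)+E_\mu[K(\mathcal R^\tau)]$. **Theorem.** Fix $\Omega$, $X$, $\Pi$, $\mathcal E$ and $\kappa=(K,c)$. 1. If $s$ is a scoring rule and $X$ is $\kappa$ separable for $s$, then for every prior $\mu\in\Delta(\Omega)$, every $y_0\in[\underline y,\overline y]$ and every $\beta\in(0,1]$, information aggregates in every Nash equilibrium of the game. 2. Suppose Assumption 1 holds. If $S$ is a set of scoring rules (for example $S=\{s\}$) and $X$ is $\kappa$ non-separable for $S$, then there is a prior $\mu\in\Delta(\Omega)$ such that for every $s\in S$, every $y_0\in[\underline y,\overline y]$ and every $\beta\in(0,1]$ the game has a Nash equilibrium in which information does not aggregate. -/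

import Mathlib

open MeasureTheory ProbabilityTheory Filter Topology
open scoped ENNReal

noncomputable section

namespace InfoMarket

/-! ### Beliefs and information structures -/

/-- The information structure of `n` traders on the state space `Ω`: the partition of each trader
(as an equivalence relation), such that the pooled information reveals the state. -/
structure InfoStructure (Ω : Type*) (n : ℕ) where
  part : Fin n → Setoid Ω
  join_eq_singletons : ∀ ω ω' : Ω, (∀ i, part i ω ω') → ω = ω'

section Beliefs

variable {Ω : Type*} [Fintype Ω]

/-- The expectation of `Z` under the belief (probability vector) `γ`. -/
def expect (γ : Ω → ℝ) (Z : Ω → ℝ) : ℝ := ∑ ω, γ ω * Z ω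

/-- The Bayesian update `μ_{Π(ω)}` of `μ` on the cell of `ω` in the partition `r`
(meaningful when `μ ω > 0`). -/
def condCell (μ : Ω → ℝ) (r : Setoid Ω) (ω : Ω) : Ω → ℝ := fun ω' =>
  {ω'' | r ω ω''}.indicator μ ω' / ∑ ω'', {ω''' | r ω ω'''}.indicator μ ω''

/-- The admissible predictions `[min X, max X]`. -/
def predictions {Ω : Type*} (X : Ω → ℝ) : Set ℝ := Set.Icc (⨅ ω, X ω) (⨆ ω, X ω)

/-- `s y x` is a strictly proper scoring rule, continuous in the prediction `y`, on the interval of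
admissible predictions: for every belief and every random variable with values in that interval, the
expected score is maximized exactly by the expected value. -/
structure IsScoringRule (X : Ω → ℝ) (s : ℝ → ℝ → ℝ) : Prop where
  continuousOn : ∀ x ∈ predictions X, ContinuousOn (fun y => s y x) (predictions X)
  strictlyProper : ∀ ν ∈ stdSimplex ℝ Ω, ∀ Z : Ω → ℝ, (∀ ω, Z ω ∈ predictions X) →
    ∀ y ∈ predictions X, y ≠ expect ν Z →
      expect ν (fun ω => s y (Z ω)) < expect ν (fun ω => s (expect ν Z) (Z ω))

/-- The security `X` is non-separable at `μ`: all traders agree on its expected value `v` at every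
state in the support, and yet `X` differs from `v` at some state of the support. -/
def NonSeparableAt {n : ℕ} (P : InfoStructure Ω n) (X : Ω → ℝ) (μ : Ω → ℝ) : Prop :=
  ∃ v : ℝ, (∃ ω, 0 < μ ω ∧ X ω ≠ v) ∧
    ∀ i ω, 0 < μ ω → expect (condCell μ (P.part i) ω) X = v

/-! ### Signals, posteriors and costs -/

/-- The law of the realization of an experiment `R` when the state has law `μ`. -/
def marginal {S : Type*} [MeasurableSpace S] (μ : Ω → ℝ) (R : Ω → Measure S) : Measure S :=
  ∑ ω, ENNReal.ofReal (μ ω) • R ω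

/-- Bayes' rule: the posterior probability of each state after the realization `τ`, where the
likelihoods are densities with respect to the law of the realization. -/
def posterior {S : Type*} [MeasurableSpace S] (μ : Ω → ℝ) (R : Ω → Measure S) (τ : S) : Ω → ℝ :=
  fun ω => μ ω * ((R ω).rnDeriv (marginal μ R) τ).toReal

/-- The random posterior `R_μ`: the law of the posterior. -/
def randomPosterior {S : Type*} [MeasurableSpace S] (μ : Ω → ℝ) (R : Ω → Measure S) :
    Measure (Ω → ℝ) :=
  (marginal μ R).map (posterior μ R)

end Beliefs

section Signals

variable {Ω T : Type*} [MeasurableSpace T]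

/-- The distributions `R(· | ω)` of a signal `R` of the collection `E`, as measures. -/
def law (E : Set (Ω → ProbabilityMeasure T)) (R : E) : Ω → Measure T :=
  fun ω => (R.1 ω : Measure T)

/-- The kernel sending a signal to the law of its realization in state `ω`. -/
def realize (E : Set (Ω → ProbabilityMeasure T)) (ω : Ω) : Kernel E T where
  toFun R := law E R ω
  measurable' := by
    unfold law
    exact measurable_subtype_coe.comp ((measurable_pi_apply ω).comp measurable_subtype_coe)

instance (E : Set (Ω → ProbabilityMeasure T)) (ω : Ω) :
    IsMarkovKernel (realize E ω) :=
  ⟨fun R => (R.1 ω).2⟩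

/-- The two-stage experiment: conduct `R`, and after the realization `τ` conduct `F τ`;
both realizations are observed. -/
def sequential {E : Set (Ω → ProbabilityMeasure T)} (R : E) (F : T → E)
    (hF : Measurable F) : Ω → Measure (T × T) :=
  fun ω => law E R ω ⊗ₘ (realize E ω).comap F hF

variable [MetricSpace T] [BorelSpace T]

/-- A cost structure `κ = (K, c)` on the collection `E` of available signals. `E` has the topology
of (statewise) weak convergence. -/
structure CostStructure (E : Set (Ω → ProbabilityMeasure T)) where
  K : E → ℝ≥0∞
  c : ℝ
  c_pos : 0 < c
  continuous_K : Continuous K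
  /-- There is a free uninformative signal `R₀`, and `K(R) = O(D(R, R₀)²)` as `R → R₀`, where `D` is
  the maximum over the states of the Lévy-Prokhorov distances. -/
  exists_free : ∃ R₀ : E, (∀ ω ω', R₀.1 ω = R₀.1 ω') ∧ K R₀ = 0 ∧
    ∃ C : ℝ≥0∞, C ≠ ∞ ∧ ∀ᶠ R in 𝓝 R₀,
      K R ≤ C * (⨆ ω, levyProkhorovEDist (law E R ω) (law E R₀ ω)) ^ 2
  /-- A garbling of a signal is not costlier than the signal. -/
  garbling : ∀ (R R' : E) (g : Kernel T T), IsMarkovKernel g →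
    (∀ ω, law E R' ω = (law E R ω).bind g) → K R' ≤ K R

/-- One signal is enough: whatever random posterior is generated from a prior by a two-stage
experiment is generated by a single available signal which is not costlier in expectation. -/
def OneSignalSuffices [Fintype Ω] {E : Set (Ω → ProbabilityMeasure T)} (κ : CostStructure E) :
    Prop :=
  ∀ μ ∈ stdSimplex ℝ Ω, ∀ (R : E) (F : T → E) (hF : Measurable F),
    ∃ R' : E, randomPosterior μ (sequential R F hF) = randomPosterior μ (law E R') ∧
      κ.K R' ≤ κ.K R + ∫⁻ τ, κ.K (F τ) ∂(marginal μ (law E R))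

/-- No trader is (myopically) willing to acquire any signal at the prior `μ`, under the scoring
rule `s`. -/
def NoInfoAcquisition [Fintype Ω] {E : Set (Ω → ProbabilityMeasure T)} (κ : CostStructure E)
    {n : ℕ} (P : InfoStructure Ω n) (X : Ω → ℝ) (s : ℝ → ℝ → ℝ) (μ : Ω → ℝ) : Prop :=
  ∀ ω, 0 < μ ω → ∀ (i : Fin n) (R : E),
    ((∫ γ, ∑ ω', γ ω' * (s (expect γ X) (X ω') - s (expect (condCell μ (P.part i) ω) X) (X ω'))
        ∂(randomPosterior (condCell μ (P.part i) ω) (law E R)) : ℝ) : EReal)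
      - ((ENNReal.ofReal κ.c * κ.K R : ℝ≥0∞) : EReal) ≤ 0

/-- `X` is `κ` non-separable for the scoring rules in `S`: at some prior `μ`, `X` is non-separable
and there is no information acquisition under any rule in `S`. -/
def KappaNonSeparable [Fintype Ω] {E : Set (Ω → ProbabilityMeasure T)} (κ : CostStructure E)
    {n : ℕ} (P : InfoStructure Ω n) (X : Ω → ℝ) (S : Set (ℝ → ℝ → ℝ)) : Prop :=
  ∃ μ ∈ stdSimplex ℝ Ω, NonSeparableAt P X μ ∧ ∀ s ∈ S, NoInfoAcquisition κ P X s μ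

/-- `X` is `κ` separable for the scoring rule `s`. -/
def KappaSeparable [Fintype Ω] {E : Set (Ω → ProbabilityMeasure T)} (κ : CostStructure E)
    {n : ℕ} (P : InfoStructure Ω n) (X : Ω → ℝ) (s : ℝ → ℝ → ℝ) : Prop :=
  ¬ KappaNonSeparable κ P X {s}

end Signals

/-! ### The game

Index `k : ℕ` stands for the time `t_{k+1}`, and `Fin n` numbers the traders from `0`. -/

/-- The trader who moves at index `k`. -/
def turn (n : ℕ) [NeZero n] (k : ℕ) : Fin n := Fin.ofNat n k

section Game

variable {Ω T : Type*} [MeasurableSpace T]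

/-- What happens at one date: the signal chosen, its realization, and the announcement. -/
abbrev Move (E : Set (Ω → ProbabilityMeasure T)) (X : Ω → ℝ) : Type _ :=
  (E × T) × predictions X

/-- What trader `i` has observed before index `k`: all announcements, and the signals chosen and the
realizations obtained by `i`. -/
abbrev View (E : Set (Ω → ProbabilityMeasure T)) (X : Ω → ℝ) (n : ℕ) [NeZero n] (i : Fin n)
    (k : ℕ) : Type _ :=
  (Fin k → predictions X) × ({j : Fin k // turn n j = i} → E × T)

/-- The part of the history `h` that trader `i` observes. -/
def view {E : Set (Ω → ProbabilityMeasure T)} {X : Ω → ℝ} {n : ℕ} [NeZero n] (i : Fin n) {k : ℕ}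
    (h : Fin k → Move E X) : View E X n i k :=
  (fun j => (h j).2, fun j => (h j.1).1)

/-- A mixed strategy of trader `i`: at each date, given the cell of the true state, the observed
history and a uniform draw, a signal and an announcement for each of its realizations.
(The values at dates when `i` does not move are irrelevant.) -/
structure Strategy (E : Set (Ω → ProbabilityMeasure T)) (X : Ω → ℝ) {n : ℕ} [NeZero n]
    (P : InfoStructure Ω n) (i : Fin n) where
  signal : (k : ℕ) → Quotient (P.part i) → View E X n i k × unitInterval → E
  announce : (k : ℕ) → Quotient (P.part i) → (View E X n i k × unitInterval) × T → predictions X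
  measurable_signal : ∀ k q, Measurable (signal k q)
  measurable_announce : ∀ k q, Measurable (announce k q)

variable {E : Set (Ω → ProbabilityMeasure T)} {X : Ω → ℝ} {n : ℕ} [NeZero n] {P : InfoStructure Ω n}

lemma measurable_view (i : Fin n) (k : ℕ) :
    Measurable (view i : (Fin k → Move E X) → View E X n i k) := by
  unfold view
  fun_prop

/-- The signal bought at index `k`, in state `ω`, after the history and the draw `p`. -/
def chosenSignal (σ : ∀ i, Strategy E X P i) (ω : Ω) (k : ℕ)
    (p : (Fin k → Move E X) × unitInterval) : E :=
  (σ (turn n k)).signal k (Quotient.mk _ ω) (view (turn n k) p.1, p.2)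

lemma measurable_chosenSignal (σ : ∀ i, Strategy E X P i) (ω : Ω) (k : ℕ) :
    Measurable (chosenSignal σ ω k) :=
  ((σ (turn n k)).measurable_signal k _).comp
    (((measurable_view _ k).comp measurable_fst).prodMk measurable_snd)

/-- The move resulting from a history, a draw and a signal realization. -/
def resultingMove (σ : ∀ i, Strategy E X P i) (ω : Ω) (k : ℕ)
    (p : (Fin k → Move E X) × (unitInterval × T)) : Move E X :=
  ((chosenSignal σ ω k (p.1, p.2.1), p.2.2),
    (σ (turn n k)).announce k (Quotient.mk _ ω) ((view (turn n k) p.1, p.2.1), p.2.2))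

lemma measurable_resultingMove (σ : ∀ i, Strategy E X P i) (ω : Ω) (k : ℕ) :
    Measurable (resultingMove σ ω k) := by
  have h1 : Measurable fun p : (Fin k → Move E X) × (unitInterval × T) =>
      view (turn n k) p.1 := (measurable_view _ k).comp measurable_fst
  exact (((measurable_chosenSignal σ ω k).comp (by fun_prop)).prodMk (by fun_prop)).prodMk
    (((σ (turn n k)).measurable_announce k _).comp ((h1.prodMk (by fun_prop)).prodMk (by fun_prop)))

/-- The law of the move at index `k` in state `ω` given the history: a uniform draw is made, the
mover's strategy picks a signal, nature draws its realization in state `ω`, and the announcement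
follows. -/
def stepKernel (σ : ∀ i, Strategy E X P i) (ω : Ω) (k : ℕ) :
    Kernel (Fin k → Move E X) (Move E X) :=
  ((Kernel.id : Kernel (Fin k → Move E X) (Fin k → Move E X)) ×ₖ
    ((Kernel.const _ (volume : Measure unitInterval)) ⊗ₖ
      (realize E ω).comap (chosenSignal σ ω k) (measurable_chosenSignal σ ω k))).map
    (resultingMove σ ω k)

instance (σ : ∀ i, Strategy E X P i) (ω : Ω) (k : ℕ) : IsMarkovKernel (stepKernel σ ω k) :=
  Kernel.IsMarkovKernel.map _ (measurable_resultingMove σ ω k)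

/-- `stepKernel` at index `k + 1`, with histories indexed by `{0, …, k}`. -/
def nextKernel (σ : ∀ i, Strategy E X P i) (ω : Ω) (k : ℕ) :
    Kernel ((_ : Finset.Iic k) → Move E X) (Move E X) :=
  (stepKernel σ ω (k + 1)).comap
    (fun h (j : Fin (k + 1)) => h ⟨j, Finset.mem_Iic.2 (Nat.lt_succ_iff.1 j.2)⟩)
    (by fun_prop)

instance (σ : ∀ i, Strategy E X P i) (ω : Ω) (k : ℕ) : IsMarkovKernel (nextKernel σ ω k) := by
  unfold nextKernel
  infer_instance

/-- The law of the infinite sequence of moves in state `ω`. -/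
def playLaw (σ : ∀ i, Strategy E X P i) (ω : Ω) : Measure (ℕ → Move E X) :=
  Kernel.trajMeasure (X := fun _ => Move E X) (stepKernel σ ω 0 Fin.elim0) (nextKernel σ ω)

/-- The joint law of the state, drawn from the prior `μ`, and of the play. -/
def gameLaw [Fintype Ω] [MeasurableSpace Ω] (μ : Ω → ℝ) (σ : ∀ i, Strategy E X P i) :
    Measure (Ω × (ℕ → Move E X)) :=
  ∑ ω, ENNReal.ofReal (μ ω) • (Measure.dirac ω).prod (playLaw σ ω)

/-- The announcement `y_k` at time `t_k`; `y_0` is the market maker's. -/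
def price (y₀ : ℝ) : ℕ → (ℕ → Move E X) → ℝ
  | 0, _ => y₀
  | k + 1, h => (h k).2

end Game

section Equilibrium

variable {Ω T : Type*} [Fintype Ω] [MeasurableSpace Ω] [MetricSpace T] [MeasurableSpace T]
  [BorelSpace T] {E : Set (Ω → ProbabilityMeasure T)} {X : Ω → ℝ} {n : ℕ} [NeZero n]
  {P : InfoStructure Ω n}

/-- Trader `i`'s expected discounted payoff up to time `t_m`: expected score improvements minus
expected signal costs (possibly infinite). -/
def payoffUpTo (κ : CostStructure E) (s : ℝ → ℝ → ℝ) (y₀ β : ℝ) (μ : Ω → ℝ)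
    (σ : ∀ i, Strategy E X P i) (i : Fin n) (m : ℕ) : EReal :=
  ((∫ p, ∑ k ∈ Finset.range m with turn n k = i,
      β ^ (k + 1) * (s (price y₀ (k + 1) p.2) (X p.1) - s (price y₀ k p.2) (X p.1))
      ∂(gameLaw μ σ) : ℝ) : EReal)
    - ((∫⁻ p, ∑ k ∈ Finset.range m with turn n k = i,
      ENNReal.ofReal (β ^ (k + 1) * κ.c) * κ.K (p.2 k).1.1 ∂(gameLaw μ σ) : ℝ≥0∞) : EReal)

/-- `u` is trader `i`'s total expected payoff. For `β < 1` it always exists in `[-∞, ∞)`. -/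
def HasPayoff (κ : CostStructure E) (s : ℝ → ℝ → ℝ) (y₀ β : ℝ) (μ : Ω → ℝ)
    (σ : ∀ i, Strategy E X P i) (i : Fin n) (u : EReal) : Prop :=
  Tendsto (payoffUpTo κ s y₀ β μ σ i) atTop (𝓝 u)

/-- Nash equilibrium: everybody's payoff is well defined, and no unilateral deviation yields more. -/
def IsNash (κ : CostStructure E) (s : ℝ → ℝ → ℝ) (y₀ β : ℝ) (μ : Ω → ℝ)
    (σ : ∀ i, Strategy E X P i) : Prop :=
  ∀ i, ∃ u, HasPayoff κ s y₀ β μ σ i u ∧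
    ∀ (d : Strategy E X P i) (u' : EReal),
      HasPayoff κ s y₀ β μ (Function.update σ i d) i u' → u' ≤ u

/-- Information aggregates: the announcements converge in probability to the security's value. -/
def Aggregates (y₀ : ℝ) (μ : Ω → ℝ) (σ : ∀ i, Strategy E X P i) : Prop :=
  TendstoInMeasure (gameLaw μ σ) (fun k p => price y₀ k p.2) atTop (fun p => X p.1)

end Equilibrium

end InfoMarket

end

/-
Part 1. In a Nash equilibrium no trader gains by following the equilibrium up to a date, deviating
once on an event that is publicly observed before that date, and then only repeating the price.
Since the discounted expected scores telescope and scores are bounded, the gains available from such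
deviations tend to `0` along the play. The public belief about the state is a bounded martingale and
converges. If information failed to aggregate, a possible limit belief would leave the value
undetermined; by `κ`-separability some trader has there a plan, based on his cell and possibly one
signal, which beats every standing price by a positive amount, and this persists for nearby beliefs,
a contradiction.

Part 2. At a belief witnessing non-separability let everybody announce the common conditional
expectation and then repeat the price, buying no signals. A deviating trader faces opponents who
reveal nothing, so his deviation is a sequential acquisition plan. The assumption on sequential
signals reduces any such plan, by backward induction, to a single signal, and a single signal is not
worth its cost at that belief.
-/

noncomputable section

open scoped NNReal

namespace InfoMarket

section WeakTopology

variable {T : Type*} [TopologicalSpace T] [MeasurableSpace T]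

lemma isOpen_setOf_lt_measure [OpensMeasurableSpace T] [HasOuterApproxClosed T]
    {G : Set T} (hG : IsOpen G) (q : ℝ≥0) :
    IsOpen {ν : ProbabilityMeasure T | q < ν G} := by
  have hlsc : LowerSemicontinuous fun ν : ProbabilityMeasure T => (ν : Measure T) G := fun ν =>
    lowerSemicontinuousAt_iff_le_liminf.2 <|
      ProbabilityMeasure.le_liminf_measure_open_of_tendsto tendsto_id hG
  convert! hlsc.isOpen_preimage q using 1
  ext ν
  simp [← ProbabilityMeasure.ennreal_coeFn_eq_coeFn_toMeasure]

variable [SecondCountableTopology T]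

/-- The sets `{ν | q < ν U}` with `q` rational and `U` a finite union of members of a countable
basis. They form a countable subbasis of the topology of weak convergence, which shows that this
topology is second countable and that its open sets are measurable. -/
def weakSubbasis (T : Type*) [TopologicalSpace T] [SecondCountableTopology T]
    [MeasurableSpace T] : Set (Set (ProbabilityMeasure T)) :=
  Set.range fun p : Finset (TopologicalSpace.countableBasis T) × ℚ =>
    {ν | Real.toNNReal p.2 < ν (⋃ U ∈ p.1, (U : Set T))}

lemma countable_weakSubbasis : (weakSubbasis T).Countable := Set.countable_range _

lemma exists_mem_weakSubbasis {ν : ProbabilityMeasure T} {G : Set T} (hG : IsOpen G) {r : ℝ≥0}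
    (hr : r < ν G) : ∃ S ∈ weakSubbasis T, ν ∈ S ∧ ∀ ν' ∈ S, r < ν' G := by
  have hbasis := TopologicalSpace.isBasis_countableBasis T
  obtain ⟨F, hF, hrF, hFG⟩ := ν.exists_lt_measure_biUnion_of_isOpen
    (S := TopologicalSpace.countableBasis T) (fun u hu x hx => by
      obtain ⟨s, hs, hxs, hsu⟩ := hbasis.exists_subset_of_mem_open hx hu
      exact ⟨s, hs, (hbasis.isOpen hs).mem_nhds hxs, hsu⟩) hG hr
  obtain ⟨q, -, hrq, hqF⟩ := (NNReal.lt_iff_exists_rat_btwn _ _).1 hrF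
  lift F to Finset (TopologicalSpace.countableBasis T) using hF
  rw [Finset.set_biUnion_finset_image] at hqF hFG
  exact ⟨_, ⟨(F, q), rfl⟩, hqF,
    fun ν' hν' => hrq.trans (hν'.trans_le (ProbabilityMeasure.apply_mono _ hFG))⟩

variable [OpensMeasurableSpace T]

lemma measurableSet_of_mem_weakSubbasis {S : Set (ProbabilityMeasure T)}
    (hS : S ∈ weakSubbasis T) : MeasurableSet S := by
  obtain ⟨⟨F, q⟩, rfl⟩ := hS
  have hU : MeasurableSet (⋃ U ∈ F, (U : Set T)) := (isOpen_biUnion fun U _ =>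
    TopologicalSpace.isOpen_of_mem_countableBasis U.2).measurableSet
  exact measurableSet_lt measurable_const
    ((Measure.measurable_coe hU).comp measurable_subtype_coe).ennreal_toNNReal

variable [HasOuterApproxClosed T]

lemma topology_probabilityMeasure_eq_generateFrom :
    (inferInstance : TopologicalSpace (ProbabilityMeasure T)) =
      TopologicalSpace.generateFrom (weakSubbasis T) := by
  refine le_antisymm (le_generateFrom ?_) ?_
  · rintro _ ⟨⟨F, q⟩, rfl⟩
    exact isOpen_setOf_lt_measure (isOpen_biUnion fun U _ =>
      TopologicalSpace.isOpen_of_mem_countableBasis U.2) _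
  · let t := TopologicalSpace.generateFrom (weakSubbasis T)
    have : @SecondCountableTopology _ t := @SecondCountableTopology.mk _ t
      ⟨_, countable_weakSubbasis, rfl⟩
    refine le_of_nhds_le_nhds fun ν => ?_
    have := @FirstCountableTopology.nhds_generated_countable _ t inferInstance ν
    refine tendsto_of_forall_isOpen_le_liminf' fun G hG => (le_liminf_iff).2 fun y hy => ?_
    lift y to ℝ≥0 using hy.ne_top
    rw [← ProbabilityMeasure.ennreal_coeFn_eq_coeFn_toMeasure, ENNReal.coe_lt_coe] at hy
    obtain ⟨S, hS, hνS, hSG⟩ := exists_mem_weakSubbasis hG hy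
    filter_upwards [(TopologicalSpace.isOpen_generateFrom_of_mem hS).mem_nhds hνS] with ν' hν'
    rw [← ProbabilityMeasure.ennreal_coeFn_eq_coeFn_toMeasure]
    exact ENNReal.coe_lt_coe.2 (hSG ν' hν')

instance : SecondCountableTopology (ProbabilityMeasure T) :=
  ⟨_, countable_weakSubbasis, topology_probabilityMeasure_eq_generateFrom⟩

instance : OpensMeasurableSpace (ProbabilityMeasure T) where
  borel_le := by
    rw [borel_eq_generateFrom_of_subbasis topology_probabilityMeasure_eq_generateFrom]
    exact MeasurableSpace.generateFrom_le fun _ => measurableSet_of_mem_weakSubbasis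

end WeakTopology

@[fun_prop]
lemma CostStructure.measurable_K {Ω T : Type*} [Countable Ω] [MetricSpace T]
    [SecondCountableTopology T] [MeasurableSpace T] [BorelSpace T]
    {E : Set (Ω → ProbabilityMeasure T)} (κ : CostStructure E) : Measurable κ.K :=
  κ.continuous_K.measurable

section Play

variable {Ω T : Type*} [MeasurableSpace T] {E : Set (Ω → ProbabilityMeasure T)} {X : Ω → ℝ}
  {n : ℕ} [NeZero n] {P : InfoStructure Ω n}

/-- The first `k` terms of a sequence. -/
def hist {α : Type*} (k : ℕ) (h : ℕ → α) : Fin k → α := fun j => h j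

@[fun_prop]
lemma measurable_hist {α : Type*} [MeasurableSpace α] (k : ℕ) :
    Measurable (hist k : (ℕ → α) → Fin k → α) := by
  unfold hist
  fun_prop

lemma hist_succ {α : Type*} (k : ℕ) (h : ℕ → α) :
    hist (k + 1) h = Fin.snoc (α := fun _ => α) (hist k h) (h k) := by
  ext j
  refine Fin.lastCases ?_ (fun j => ?_) j <;> simp [hist]

@[fun_prop]
lemma measurable_snoc {α : Type*} [MeasurableSpace α] (k : ℕ) :
    Measurable fun p : (Fin k → α) × α =>
      (Fin.snoc (α := fun _ => α) p.1 p.2 : Fin (k + 1) → α) := by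
  refine measurable_pi_iff.2 fun j => ?_
  refine Fin.lastCases ?_ (fun j => ?_) j
  · simpa using measurable_snd
  · simp only [Fin.snoc_castSucc]
    fun_prop

instance (σ : ∀ i, Strategy E X P i) (ω : Ω) : IsProbabilityMeasure (playLaw σ ω) := by
  unfold playLaw
  infer_instance

lemma map_eval_zero_playLaw (σ : ∀ i, Strategy E X P i) (ω : Ω) :
    (playLaw σ ω).map (fun h => h 0) = stepKernel σ ω 0 Fin.elim0 := by
  have heval : (fun h : ℕ → Move E X => h 0) =
      (fun x : ((_ : Finset.Iic 0) → Move E X) => x ⟨0, by simp⟩) ∘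
        Preorder.frestrictLe (π := fun _ => Move E X) 0 := rfl
  rw [heval, ← Measure.map_map (by fun_prop) (by fun_prop), playLaw, Kernel.trajMeasure,
    Measure.map_comp _ _ (by fun_prop), Kernel.traj_map_frestrictLe, Kernel.partialTraj_self,
    Measure.id_comp, Measure.map_map (by fun_prop) (by fun_prop)]
  convert Measure.map_id
  rfl

lemma lintegral_playLaw_step (σ : ∀ i, Strategy E X P i) (ω : Ω) (k : ℕ)
    {F : (Fin k → Move E X) × Move E X → ℝ≥0∞} (hF : Measurable F) :
    ∫⁻ h, F (hist k h, h k) ∂(playLaw σ ω) =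
      ∫⁻ h, ∫⁻ x, F (hist k h, x) ∂(stepKernel σ ω k (hist k h)) ∂(playLaw σ ω) := by
  rcases k with _ | k
  · have hnil : ∀ h : ℕ → Move E X, hist 0 h = Fin.elim0 := fun h => Subsingleton.elim _ _
    simp only [hnil, lintegral_const, measure_univ, mul_one]
    rw [← map_eval_zero_playLaw, lintegral_map (by fun_prop) (by fun_prop)]
  · let e : ((_ : Finset.Iic k) → Move E X) → (Fin (k + 1) → Move E X) :=
      fun h j => h ⟨j, Finset.mem_Iic.2 (Nat.lt_succ_iff.1 j.2)⟩
    have he : Measurable e := by fun_prop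
    have htraj := Kernel.map_frestrictLe_trajMeasure_compProd_eq_map_trajMeasure
      (X := fun _ => Move E X) (μ₀ := stepKernel σ ω 0 Fin.elim0) (κ := nextKernel σ ω) (a := k)
    have hlint := congrArg (fun ν => ∫⁻ p, F (e p.1, p.2) ∂ν) htraj
    beta_reduce at hlint
    rw [Measure.lintegral_compProd (by fun_prop),
      lintegral_map (Measurable.lintegral_kernel_prod_right (f := fun a b => F (e a, b))
        (by fun_prop)) (by fun_prop), lintegral_map (by fun_prop) (by fun_prop)] at hlint
    exact hlint.symm

lemma map_hist_step (σ : ∀ i, Strategy E X P i) (ω : Ω) (k : ℕ) :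
    (playLaw σ ω).map (fun h => (hist k h, h k)) =
      ((playLaw σ ω).map (hist k)) ⊗ₘ stepKernel σ ω k := by
  refine Measure.ext_of_lintegral _ fun F hF => ?_
  rw [lintegral_map hF (by fun_prop), Measure.lintegral_compProd hF,
    lintegral_map (Measurable.lintegral_kernel_prod_right (f := fun a b => F (a, b)) hF)
      (by fun_prop)]
  exact lintegral_playLaw_step σ ω k hF

lemma integral_playLaw_step (σ : ∀ i, Strategy E X P i) (ω : Ω) (k : ℕ)
    {F : (Fin k → Move E X) × Move E X → ℝ} (hF : Measurable F) {B : ℝ} (hB : ∀ p, |F p| ≤ B) :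
    ∫ h, F (hist k h, h k) ∂(playLaw σ ω) =
      ∫ h, ∫ x, F (hist k h, x) ∂(stepKernel σ ω k (hist k h)) ∂(playLaw σ ω) := by
  have hi : ∀ ν : Measure ((Fin k → Move E X) × Move E X), IsFiniteMeasure ν → Integrable F ν :=
    fun ν _ => Integrable.of_bound hF.aestronglyMeasurable B (.of_forall hB)
  rw [← integral_map (φ := fun h => (hist k h, h k)) (f := F) (by fun_prop)
    hF.aestronglyMeasurable, map_hist_step, Measure.integral_compProd (hi _ inferInstance),
    integral_map (by fun_prop)]
  exact (StronglyMeasurable.integral_kernel_prod_right (f := fun a b => F (a, b))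
    hF.stronglyMeasurable).aestronglyMeasurable

lemma stepKernel_apply (σ : ∀ i, Strategy E X P i) (ω : Ω) (k : ℕ) (h : Fin k → Move E X) :
    stepKernel σ ω k h =
      ((volume : Measure unitInterval) ⊗ₘ (realize E ω).comap (fun u => chosenSignal σ ω k (h, u))
        ((measurable_chosenSignal σ ω k).comp measurable_prodMk_left)).map
        (fun p => resultingMove σ ω k (h, p)) := by
  have hm := measurable_resultingMove σ ω k
  refine Measure.ext_of_lintegral _ fun F hF => ?_
  rw [stepKernel, Kernel.lintegral_map _ hm _ hF, lintegral_map hF (by fun_prop),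
    Kernel.prod_apply, Kernel.id_apply, lintegral_prod _ (by fun_prop),
    lintegral_dirac' _ (by fun_prop)]
  rw [Kernel.lintegral_compProd _ _ _ (by fun_prop), Measure.lintegral_compProd (by fun_prop)]
  rfl

lemma integral_stepKernel (σ : ∀ i, Strategy E X P i) (ω : Ω) (k : ℕ) (h : Fin k → Move E X)
    {F : Move E X → ℝ} (hF : Measurable F) {B : ℝ} (hB : ∀ p, |F p| ≤ B) :
    ∫ x, F x ∂(stepKernel σ ω k h) =
      ∫ u : unitInterval, ∫ τ, F (resultingMove σ ω k (h, (u, τ)))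
        ∂(law E (chosenSignal σ ω k (h, u)) ω) := by
  have hm := measurable_resultingMove σ ω k
  rw [stepKernel_apply, integral_map (by fun_prop) hF.aestronglyMeasurable,
    Measure.integral_compProd (Integrable.of_bound
      (Measurable.aestronglyMeasurable (by fun_prop)) B (.of_forall fun _ => hB _))]
  rfl

lemma lintegral_stepKernel (σ : ∀ i, Strategy E X P i) (ω : Ω) (k : ℕ) (h : Fin k → Move E X)
    {F : Move E X → ℝ≥0∞} (hF : Measurable F) :
    ∫⁻ x, F x ∂(stepKernel σ ω k h) =
      ∫⁻ u : unitInterval, ∫⁻ τ, F (resultingMove σ ω k (h, (u, τ)))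
        ∂(law E (chosenSignal σ ω k (h, u)) ω) := by
  have hm := measurable_resultingMove σ ω k
  rw [stepKernel_apply, lintegral_map hF (by fun_prop), Measure.lintegral_compProd (by fun_prop)]
  rfl

lemma stepKernel_congr {σ σ' : ∀ i, Strategy E X P i} {ω : Ω} {k : ℕ}
    (hsignal : ∀ p, chosenSignal σ ω k p = chosenSignal σ' ω k p)
    (hmove : ∀ p, resultingMove σ ω k p = resultingMove σ' ω k p) :
    stepKernel σ ω k = stepKernel σ' ω k := by
  ext1 g
  refine Measure.ext_of_lintegral _ fun F hF => ?_
  simp only [lintegral_stepKernel _ _ _ _ hF, hsignal, hmove]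

lemma map_hist_congr {σ σ' : ∀ i, Strategy E X P i} {ω : Ω} {m : ℕ}
    (h : ∀ k < m, stepKernel σ ω k = stepKernel σ' ω k) :
    (playLaw σ ω).map (hist m) = (playLaw σ' ω).map (hist m) := by
  induction m with
  | zero =>
    have hnil : (hist 0 : (ℕ → Move E X) → _) = fun _ => Fin.elim0 :=
      funext fun h => Subsingleton.elim _ _
    simp [hnil, Measure.map_const]
  | succ m ih =>
    have hsnoc : (hist (m + 1) : (ℕ → Move E X) → _) =
        (fun p : (Fin m → Move E X) × Move E X => (Fin.snoc p.1 p.2 : Fin (m + 1) → Move E X)) ∘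
          fun h => (hist m h, h m) :=
      funext fun h => hist_succ m h
    have hmeas := measurable_snoc (α := Move E X) m
    rw [hsnoc, ← Measure.map_map hmeas (by fun_prop), ← Measure.map_map hmeas (by fun_prop),
      map_hist_step, map_hist_step, ih fun k hk => h k (by lia), h m (by lia)]

lemma integral_hist_congr {σ σ' : ∀ i, Strategy E X P i} {ω : Ω} {m : ℕ}
    (h : ∀ k < m, stepKernel σ ω k = stepKernel σ' ω k) {f : (Fin m → Move E X) → ℝ}
    (hf : Measurable f) :
    ∫ g, f (hist m g) ∂(playLaw σ ω) = ∫ g, f (hist m g) ∂(playLaw σ' ω) := by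
  rw [← integral_map (by fun_prop) hf.aestronglyMeasurable, map_hist_congr h,
    integral_map (by fun_prop) hf.aestronglyMeasurable]

lemma lintegral_hist_congr {σ σ' : ∀ i, Strategy E X P i} {ω : Ω} {m : ℕ}
    (h : ∀ k < m, stepKernel σ ω k = stepKernel σ' ω k) {f : (Fin m → Move E X) → ℝ≥0∞}
    (hf : Measurable f) :
    ∫⁻ g, f (hist m g) ∂(playLaw σ ω) = ∫⁻ g, f (hist m g) ∂(playLaw σ' ω) := by
  rw [← lintegral_map hf (by fun_prop), map_hist_congr h, lintegral_map hf (by fun_prop)]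

lemma ae_playLaw_of_resultingMove (σ : ∀ i, Strategy E X P i) (ω : Ω) (k : ℕ)
    {S : Set ((Fin k → Move E X) × Move E X)} (hS : MeasurableSet S)
    (h : ∀ g u τ, (g, resultingMove σ ω k (g, (u, τ))) ∈ S) :
    ∀ᵐ x ∂(playLaw σ ω), (hist k x, x k) ∈ S := by
  have hnull : ∫⁻ x, Sᶜ.indicator 1 (hist k x, x k) ∂(playLaw σ ω) = 0 := by
    rw [lintegral_playLaw_step σ ω k (measurable_one.indicator hS.compl)]
    refine lintegral_eq_zero_of_ae_eq_zero (.of_forall fun x => ?_)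
    simp only [Pi.zero_apply]
    rw [lintegral_stepKernel σ ω k _ (F := fun y => Sᶜ.indicator 1 (hist k x, y))
      ((measurable_one.indicator hS.compl).comp measurable_prodMk_left)]
    simp [h]
  rw [lintegral_eq_zero_iff (f := fun x => Sᶜ.indicator 1 (hist k x, x k))
    ((measurable_one.indicator hS.compl).comp (by fun_prop))] at hnull
  filter_upwards [hnull] with x hx
  by_contra hc
  simp [Set.indicator_of_mem, hc] at hx

end Play

section Averages

variable {α Ω : Type*} {A : ℝ}

lemma abs_integral_le_of_forall_abs_le [MeasurableSpace α] {ν : Measure α}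
    [IsProbabilityMeasure ν] {f : α → ℝ} (hf : ∀ x, |f x| ≤ A) : |∫ x, f x ∂ν| ≤ A := by
  simpa using norm_integral_le_of_norm_le_const (μ := ν) (f := f) (C := A) (.of_forall hf)

lemma abs_sum_mul_le [Fintype Ω] {γ : Ω → ℝ} (hγ : γ ∈ stdSimplex ℝ Ω) {f : Ω → ℝ}
    (hf : ∀ ω, |f ω| ≤ A) : |∑ ω, γ ω * f ω| ≤ A :=
  calc |∑ ω, γ ω * f ω| ≤ ∑ ω, γ ω * A := by
        refine (Finset.abs_sum_le_sum_abs _ _).trans (Finset.sum_le_sum fun ω _ => ?_)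
        rw [abs_mul, abs_of_nonneg (hγ.1 ω)]
        exact mul_le_mul_of_nonneg_left (hf ω) (hγ.1 ω)
    _ = A := by rw [← Finset.sum_mul, hγ.2, one_mul]

end Averages

section Scores

variable {Ω : Type*} {X : Ω → ℝ} {s : ℝ → ℝ → ℝ}

lemma mem_predictions [Finite Ω] (X : Ω → ℝ) (ω : Ω) : X ω ∈ predictions X :=
  ⟨ciInf_le (Set.finite_range X).bddBelow ω, le_ciSup (Set.finite_range X).bddAbove ω⟩

instance : CompactSpace (predictions X) := isCompact_iff_compactSpace.1 isCompact_Icc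

variable [Fintype Ω]

lemma expect_mem_predictions {γ : Ω → ℝ} (hγ : γ ∈ stdSimplex ℝ Ω) :
    expect γ X ∈ predictions X := by
  have hmem := (convex_Icc (⨅ ω, X ω) (⨆ ω, X ω)).sum_mem (t := Finset.univ) (w := γ) (z := X)
    (fun ω _ => hγ.1 ω) hγ.2 (fun ω _ => mem_predictions X ω)
  simpa [expect, predictions] using hmem

lemma IsScoringRule.continuous (hs : IsScoringRule X s) (ω : Ω) :
    Continuous fun y : predictions X => s y (X ω) :=
  continuousOn_iff_continuous_domRestrict.1 (hs.continuousOn _ (mem_predictions X ω))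

lemma IsScoringRule.measurable_score (hs : IsScoringRule X s) (ω : Ω) {α : Type*}
    [MeasurableSpace α] {f : α → predictions X} (hf : Measurable f) :
    Measurable fun a => s (f a) (X ω) :=
  (hs.continuous ω).measurable.comp hf

lemma IsScoringRule.exists_bound (hs : IsScoringRule X s) :
    ∃ A : ℝ, 0 ≤ A ∧ ∀ (y : predictions X) (ω : Ω), |s y (X ω)| ≤ A := by
  have hbound : ∀ ω, ∃ A : ℝ, ∀ y : predictions X, |s y (X ω)| ≤ A := fun ω => by
    obtain ⟨A, hA⟩ := isCompact_univ.exists_bound_of_continuousOn (hs.continuous ω).continuousOn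
    exact ⟨A, fun y => hA y trivial⟩
  choose A hA using hbound
  refine ⟨∑ ω, |A ω|, Finset.sum_nonneg fun _ _ => abs_nonneg _, fun y ω => ?_⟩
  exact ((hA ω y).trans (le_abs_self _)).trans
    (Finset.single_le_sum (f := fun ω => |A ω|) (fun _ _ => abs_nonneg _) (Finset.mem_univ ω))

end Scores

section Payoffs

variable {Ω T : Type*} [MeasurableSpace T] {E : Set (Ω → ProbabilityMeasure T)} {X : Ω → ℝ}
  {n : ℕ} [NeZero n] {P : InfoStructure Ω n}

/-- The current price after the announcements `z`, when the market maker started with `y₀`. -/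
def lastPrice (y₀ : predictions X) : (k : ℕ) → (Fin k → predictions X) → predictions X
  | 0, _ => y₀
  | k + 1, z => z (Fin.last k)

@[fun_prop]
lemma measurable_lastPrice (y₀ : predictions X) (k : ℕ) : Measurable (lastPrice y₀ k) := by
  cases k <;> unfold lastPrice <;> fun_prop

/-- The public part of a history. -/
def announcements {k : ℕ} (h : Fin k → Move E X) : Fin k → predictions X := fun j => (h j).2

@[fun_prop]
lemma measurable_announcements (k : ℕ) :
    Measurable (announcements : (Fin k → Move E X) → Fin k → predictions X) := by
  unfold announcements
  fun_prop

lemma price_eq_lastPrice (y₀ : predictions X) (k : ℕ) (h : ℕ → Move E X) :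
    price (y₀ : ℝ) k h = lastPrice y₀ k (announcements (hist k h)) := by
  cases k <;> rfl

lemma ae_price_succ_of_repeat (y₀ : predictions X) {σ : ∀ i, Strategy E X P i} {ω : Ω} {k : ℕ}
    (h : ∀ g u τ, (resultingMove σ ω k (g, (u, τ))).2 = lastPrice y₀ k (announcements g)) :
    ∀ᵐ x ∂(playLaw σ ω), price (y₀ : ℝ) (k + 1) x = price (y₀ : ℝ) k x := by
  have := ae_playLaw_of_resultingMove σ ω k
    (S := {p | p.2.2 = lastPrice y₀ k (announcements p.1)})
    (measurableSet_eq_fun (by fun_prop) (by fun_prop)) h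
  filter_upwards [this] with x hx
  rw [price_eq_lastPrice y₀ k]
  exact congrArg Subtype.val hx

variable [Fintype Ω]

lemma lintegral_gameLaw [MeasurableSpace Ω] [MeasurableSingletonClass Ω] (μ : Ω → ℝ)
    (σ : ∀ i, Strategy E X P i) {f : Ω × (ℕ → Move E X) → ℝ≥0∞} (hf : Measurable f) :
    ∫⁻ p, f p ∂(gameLaw μ σ) = ∑ ω, ENNReal.ofReal (μ ω) * ∫⁻ h, f (ω, h) ∂(playLaw σ ω) := by
  rw [gameLaw, lintegral_finsetSum_measure]
  refine Finset.sum_congr rfl fun ω _ => ?_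
  rw [lintegral_smul_measure, Measure.dirac_prod, lintegral_map hf (by fun_prop), smul_eq_mul]

lemma integral_gameLaw [MeasurableSpace Ω] [MeasurableSingletonClass Ω] {μ : Ω → ℝ}
    (hμ : μ ∈ stdSimplex ℝ Ω) (σ : ∀ i, Strategy E X P i) {f : Ω × (ℕ → Move E X) → ℝ}
    (hf : Measurable f) {B : ℝ} (hB : ∀ p, |f p| ≤ B) :
    ∫ p, f p ∂(gameLaw μ σ) = ∑ ω, μ ω * ∫ h, f (ω, h) ∂(playLaw σ ω) := by
  rw [gameLaw, integral_finsetSum_measure]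
  · refine Finset.sum_congr rfl fun ω _ => ?_
    rw [integral_smul_measure, Measure.dirac_prod,
      integral_map (by fun_prop) hf.aestronglyMeasurable, smul_eq_mul,
      ENNReal.toReal_ofReal (hμ.1 ω)]
  · intro ω _
    exact (Integrable.of_bound hf.aestronglyMeasurable B (.of_forall hB)).smul_measure
      ENNReal.ofReal_ne_top

lemma isProbabilityMeasure_gameLaw [MeasurableSpace Ω] {μ : Ω → ℝ} (hμ : μ ∈ stdSimplex ℝ Ω)
    (σ : ∀ i, Strategy E X P i) : IsProbabilityMeasure (gameLaw μ σ) := by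
  refine ⟨?_⟩
  simp only [gameLaw, Measure.coe_finsetSum, Finset.sum_apply, Measure.smul_apply, measure_univ,
    smul_eq_mul, mul_one]
  rw [← ENNReal.ofReal_sum_of_nonneg fun ω _ => hμ.1 ω, hμ.2, ENNReal.ofReal_one]

/-- The expected score of the price at time `k`. -/
def meanScore (s : ℝ → ℝ → ℝ) (y₀ : ℝ) (μ : Ω → ℝ) (σ : ∀ i, Strategy E X P i) (k : ℕ) : ℝ :=
  ∑ ω, μ ω * ∫ h, s (price y₀ k h) (X ω) ∂(playLaw σ ω)

lemma meanScore_zero (s : ℝ → ℝ → ℝ) (y₀ : ℝ) (μ : Ω → ℝ) (σ : ∀ i, Strategy E X P i) :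
    meanScore s y₀ μ σ 0 = ∑ ω, μ ω * s y₀ (X ω) := by
  simp [meanScore, price]

lemma measurable_score_price {s : ℝ → ℝ → ℝ} (hs : IsScoringRule X s) (y₀ : predictions X) (k : ℕ)
    (ω : Ω) : Measurable fun h : ℕ → Move E X => s (price (y₀ : ℝ) k h) (X ω) := by
  simp only [price_eq_lastPrice]
  exact hs.measurable_score ω (by fun_prop)

lemma measurable_score_price_prod [MeasurableSpace Ω] [MeasurableSingletonClass Ω]
    {s : ℝ → ℝ → ℝ} (hs : IsScoringRule X s) (y₀ : predictions X) (k : ℕ) :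
    Measurable fun p : Ω × (ℕ → Move E X) => s (price (y₀ : ℝ) k p.2) (X p.1) :=
  measurable_from_prod_countable_right fun ω => measurable_score_price hs y₀ k ω

lemma meanScore_congr (y₀ : predictions X) {s : ℝ → ℝ → ℝ} (hs : IsScoringRule X s) (μ : Ω → ℝ)
    {σ σ' : ∀ i, Strategy E X P i} {m : ℕ}
    (h : ∀ ω, ∀ k < m, stepKernel σ ω k = stepKernel σ' ω k) :
    meanScore s y₀ μ σ m = meanScore s y₀ μ σ' m := by
  refine Finset.sum_congr rfl fun ω _ => ?_
  simp only [price_eq_lastPrice]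
  rw [integral_hist_congr (h ω) (f := fun g => s (lastPrice y₀ m (announcements g)) (X ω))
    (hs.measurable_score ω (by fun_prop))]

lemma abs_meanScore_le {s : ℝ → ℝ → ℝ} {A : ℝ}
    (hA : ∀ (y : predictions X) (ω : Ω), |s y (X ω)| ≤ A) (y₀ : predictions X)
    {μ : Ω → ℝ} (hμ : μ ∈ stdSimplex ℝ Ω) (σ : ∀ i, Strategy E X P i) (k : ℕ) :
    |meanScore s y₀ μ σ k| ≤ A := by
  refine abs_sum_mul_le hμ fun ω => abs_integral_le_of_forall_abs_le fun h => ?_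
  rw [price_eq_lastPrice]
  exact hA _ _

lemma meanScore_succ_of_repeat (s : ℝ → ℝ → ℝ) (y₀ : predictions X) (μ : Ω → ℝ)
    {σ : ∀ i, Strategy E X P i} {k : ℕ}
    (h : ∀ ω g u τ, (resultingMove σ ω k (g, (u, τ))).2 = lastPrice y₀ k (announcements g)) :
    meanScore s y₀ μ σ (k + 1) = meanScore s y₀ μ σ k := by
  refine Finset.sum_congr rfl fun ω _ => ?_
  congr 1
  refine integral_congr_ae ?_
  filter_upwards [ae_price_succ_of_repeat y₀ (h ω)] with x hx
  rw [hx]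

variable [MetricSpace T] [SecondCountableTopology T] [BorelSpace T]

/-- The expected cost (per unit of `c`) of the signal bought at index `k`. -/
def meanCost (κ : CostStructure E) (μ : Ω → ℝ) (σ : ∀ i, Strategy E X P i) (k : ℕ) : ℝ≥0∞ :=
  ∑ ω, ENNReal.ofReal (μ ω) * ∫⁻ h, κ.K (h k).1.1 ∂(playLaw σ ω)

lemma payoffUpTo_eq [MeasurableSpace Ω] [MeasurableSingletonClass Ω] {κ : CostStructure E}
    {s : ℝ → ℝ → ℝ} (hs : IsScoringRule X s) (y₀ : predictions X) (β : ℝ)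
    {μ : Ω → ℝ} (hμ : μ ∈ stdSimplex ℝ Ω) (σ : ∀ i, Strategy E X P i) (i : Fin n) (m : ℕ) :
    payoffUpTo κ s y₀ β μ σ i m =
      ((∑ k ∈ Finset.range m with turn n k = i,
        β ^ (k + 1) * (meanScore s y₀ μ σ (k + 1) - meanScore s y₀ μ σ k) : ℝ) : EReal) -
      ((∑ k ∈ Finset.range m with turn n k = i,
        ENNReal.ofReal (β ^ (k + 1) * κ.c) * meanCost κ μ σ k : ℝ≥0∞) : EReal) := by
  have := isProbabilityMeasure_gameLaw hμ σ
  obtain ⟨A, -, hA⟩ := hs.exists_bound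
  have hA' : ∀ k (p : Ω × (ℕ → Move E X)), |s (price (y₀ : ℝ) k p.2) (X p.1)| ≤ A := fun k p => by
    rw [price_eq_lastPrice]
    exact hA _ _
  have hinteg : ∀ k, Integrable (fun p : Ω × (ℕ → Move E X) => s (price (y₀ : ℝ) k p.2) (X p.1))
      (gameLaw μ σ) := fun k =>
    Integrable.of_bound (measurable_score_price_prod hs y₀ k).aestronglyMeasurable A
      (.of_forall (hA' k))
  have hmean : ∀ k, ∫ p, s (price (y₀ : ℝ) k p.2) (X p.1) ∂(gameLaw μ σ) =
      meanScore s y₀ μ σ k := fun k =>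
    integral_gameLaw hμ σ (measurable_score_price_prod hs y₀ k) (hA' k)
  unfold payoffUpTo
  congr 2
  · rw [integral_finsetSum]
    swap
    · exact fun k _ => ((hinteg _).sub (hinteg _)).const_mul _
    refine Finset.sum_congr rfl fun k _ => ?_
    rw [integral_const_mul, integral_sub (hinteg _) (hinteg _), hmean, hmean]
  · rw [lintegral_finsetSum _ fun k _ => by fun_prop]
    refine Finset.sum_congr rfl fun k _ => ?_
    rw [lintegral_const_mul _ (by fun_prop), lintegral_gameLaw _ _ (by fun_prop), meanCost]

end Payoffs

section Plans

variable {Ω T : Type*} [MeasurableSpace T] [MetricSpace T] [BorelSpace T]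
  {E : Set (Ω → ProbabilityMeasure T)} {X : Ω → ℝ}

/-- A one-shot plan: a signal of finite cost and an announcement for each of its realizations. -/
structure Plan (κ : CostStructure E) (X : Ω → ℝ) where
  signal : E
  announce : T → predictions X
  measurable_announce : Measurable announce
  cost_ne_top : κ.K signal ≠ ∞

/-- The expected score of a plan in the state `ω`, net of the cost of its signal. -/
def Plan.value {κ : CostStructure E} (θ : Plan κ X) (s : ℝ → ℝ → ℝ) (ω : Ω) : ℝ :=
  ∫ τ, s (θ.announce τ) (X ω) ∂(law E θ.signal ω) - κ.c * (κ.K θ.signal).toReal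

/-- A free uninformative signal. -/
def CostStructure.free (κ : CostStructure E) : E := κ.exists_free.choose

lemma CostStructure.K_free (κ : CostStructure E) : κ.K κ.free = 0 :=
  κ.exists_free.choose_spec.2.1

instance (R : E) (ω : Ω) : IsProbabilityMeasure (law E R ω) := (R.1 ω).2

/-- The plan announcing `y` without acquiring information. -/
def Plan.const (κ : CostStructure E) (y : predictions X) : Plan κ X where
  signal := κ.free
  announce _ := y
  measurable_announce := measurable_const
  cost_ne_top := by simp [κ.K_free]

@[simp]
lemma Plan.value_const (κ : CostStructure E) (y : predictions X) (s : ℝ → ℝ → ℝ) (ω : Ω) :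
    (Plan.const κ y).value s ω = s y (X ω) := by
  simp [Plan.value, Plan.const, κ.K_free]

lemma Plan.abs_integral_le {κ : CostStructure E} {s : ℝ → ℝ → ℝ} {A : ℝ}
    (hA : ∀ (y : predictions X) (ω : Ω), |s y (X ω)| ≤ A) (θ : Plan κ X) (ω : Ω) :
    |∫ τ, s (θ.announce τ) (X ω) ∂(law E θ.signal ω)| ≤ A :=
  abs_integral_le_of_forall_abs_le fun _ => hA _ _

end Plans

section Deviation

variable {Ω T : Type*} [MeasurableSpace T] [MetricSpace T] [BorelSpace T]
  {E : Set (Ω → ProbabilityMeasure T)} {X : Ω → ℝ} {n : ℕ} [NeZero n] {P : InfoStructure Ω n}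
  {κ : CostStructure E}

/-- The strategy which follows `d` before index `m`, carries out the plan `θ` at index `m` if the
past announcements are in `W m`, and otherwise repeats the previous announcement without acquiring
information. -/
def deviate {i : Fin n} (d : Strategy E X P i) (y₀ : predictions X) (m : ℕ)
    (W : ∀ k, Set (Fin k → predictions X)) (hW : ∀ k, MeasurableSet (W k))
    (θ : Quotient (P.part i) → Plan κ X) : Strategy E X P i := by
  classical
  exact
  { signal := fun k q p =>
      if k < m then d.signal k q p else if k = m ∧ p.1.1 ∈ W k then (θ q).signal else κ.free
    announce := fun k q p =>
      if k < m then d.announce k q p else if k = m ∧ p.1.1.1 ∈ W k then (θ q).announce p.2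
      else lastPrice y₀ k p.1.1.1
    measurable_signal := fun k q => by
      have := d.measurable_signal k q
      refine Measurable.ite (.const _) this (.ite ?_ measurable_const measurable_const)
      exact (MeasurableSet.const _).inter (measurableSet_preimage (by fun_prop) (hW k))
    measurable_announce := fun k q => by
      have hd := d.measurable_announce k q
      have hθ := (θ q).measurable_announce
      refine Measurable.ite (.const _) hd (.ite ?_ (by fun_prop) (by fun_prop))
      exact (MeasurableSet.const _).inter (measurableSet_preimage (by fun_prop) (hW k)) }

variable (σ : ∀ i, Strategy E X P i) {i : Fin n} (y₀ : predictions X) (m : ℕ)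
    {W : ∀ k, Set (Fin k → predictions X)} (hW : ∀ k, MeasurableSet (W k))
    (θ : Quotient (P.part i) → Plan κ X)

/-- The profile in which trader `i` unilaterally switches from `σ i` to `deviate`. -/
abbrev deviateProfile : ∀ i, Strategy E X P i :=
  Function.update σ i (deviate (σ i) y₀ m W hW θ)

variable {m}

lemma stepKernel_deviateProfile_of_lt (ω : Ω) {k : ℕ} (hk : k < m) :
    stepKernel (deviateProfile σ y₀ m hW θ) ω k = stepKernel σ ω k := by
  by_cases h : turn n k = i
  · subst h
    refine stepKernel_congr (fun p => ?_) fun p => ?_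
    · simp [chosenSignal, deviate, hk]
    · simp [resultingMove, chosenSignal, deviate, hk]
  · refine stepKernel_congr (fun p => ?_) fun p => ?_
    · simp [chosenSignal, h]
    · simp [resultingMove, chosenSignal, h]

lemma chosenSignal_deviateProfile_of_not {ω : Ω} {k : ℕ} (hk : m ≤ k) (hi : turn n k = i)
    {g : Fin k → Move E X} (hg : ¬ (k = m ∧ announcements g ∈ W k)) (u : unitInterval) :
    chosenSignal (deviateProfile σ y₀ m hW θ) ω k (g, u) = κ.free := by
  subst hi
  unfold announcements at hg
  simp [chosenSignal, deviate, view, hk.not_gt, hg]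

lemma resultingMove_deviateProfile_of_not {ω : Ω} {k : ℕ} (hk : m ≤ k) (hi : turn n k = i)
    {g : Fin k → Move E X} (hg : ¬ (k = m ∧ announcements g ∈ W k)) (u : unitInterval) (τ : T) :
    resultingMove (deviateProfile σ y₀ m hW θ) ω k (g, (u, τ)) =
      ((κ.free, τ), lastPrice y₀ k (announcements g)) := by
  rw [resultingMove, chosenSignal_deviateProfile_of_not σ y₀ hW θ hk hi hg]
  subst hi
  unfold announcements at *
  simp [deviate, view, hk.not_gt, hg]

lemma chosenSignal_deviateProfile_of_mem {ω : Ω} (hi : turn n m = i)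
    {g : Fin m → Move E X} (hg : announcements g ∈ W m) (u : unitInterval) :
    chosenSignal (deviateProfile σ y₀ m hW θ) ω m (g, u) =
      (θ (Quotient.mk _ ω)).signal := by
  subst hi
  unfold announcements at hg
  simp [chosenSignal, deviate, view, hg]

lemma resultingMove_deviateProfile_of_mem {ω : Ω} (hi : turn n m = i)
    {g : Fin m → Move E X} (hg : announcements g ∈ W m) (u : unitInterval) (τ : T) :
    resultingMove (deviateProfile σ y₀ m hW θ) ω m (g, (u, τ)) =
      (((θ (Quotient.mk _ ω)).signal, τ), (θ (Quotient.mk _ ω)).announce τ) := by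
  rw [resultingMove, chosenSignal_deviateProfile_of_mem σ y₀ hW θ hi hg]
  subst hi
  unfold announcements at hg
  simp [deviate, view, hg]

lemma lintegral_cost_deviateProfile [Countable Ω] [SecondCountableTopology T]
    (hi : turn n m = i) (ω : Ω) :
    ∫⁻ h, κ.K (h m).1.1 ∂(playLaw (deviateProfile σ y₀ m hW θ) ω) =
      κ.K (θ (Quotient.mk _ ω)).signal *
        playLaw σ ω {h | announcements (hist m h) ∈ W m} := by
  set C := κ.K (θ (Quotient.mk _ ω)).signal
  have hstep : ∀ g : Fin m → Move E X,
      ∫⁻ x, κ.K x.1.1 ∂(stepKernel (deviateProfile σ y₀ m hW θ) ω m g) =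
        (W m).indicator (fun _ => C) (announcements g) := fun g => by
    rw [lintegral_stepKernel _ ω m _ (by fun_prop)]
    by_cases hg : announcements g ∈ W m
    · simp only [resultingMove_deviateProfile_of_mem σ y₀ hW θ hi hg, Set.indicator_of_mem hg]
      simp [C]
    · simp only [resultingMove_deviateProfile_of_not σ y₀ hW θ le_rfl hi (fun h => hg h.2),
        Set.indicator_of_notMem hg]
      simp [κ.K_free]
  rw [lintegral_playLaw_step _ ω m (F := fun p => κ.K p.2.1.1) (by fun_prop)]
  simp only [hstep]
  rw [lintegral_hist_congr (fun k hk => stepKernel_deviateProfile_of_lt σ y₀ hW θ ω hk)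
      (f := fun g => (W m).indicator (fun _ => C) (announcements g))
      ((measurable_const.indicator (hW m)).comp (by fun_prop))]
  exact lintegral_indicator_const (measurableSet_preimage
    ((measurable_announcements m).comp (measurable_hist m)) (hW m)) C

variable [Fintype Ω]

/-- The expected payoff at index `m` from carrying out the plan `θ` if the announcements so far
are in `W`, instead of repeating the previous announcement. -/
def gain (s : ℝ → ℝ → ℝ) (μ : Ω → ℝ) (m : ℕ) (W : Set (Fin m → predictions X)) : ℝ :=
  ∑ ω, μ ω * ∫ h, W.indicator
    (fun z => (θ (Quotient.mk _ ω)).value s ω - s (lastPrice y₀ m z) (X ω))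
    (announcements (hist m h)) ∂(playLaw σ ω)

lemma integral_score_deviateProfile {s : ℝ → ℝ → ℝ} (hs : IsScoringRule X s)
    (hi : turn n m = i) (ω : Ω) :
    ∫ h, s (price (y₀ : ℝ) (m + 1) h) (X ω) ∂(playLaw (deviateProfile σ y₀ m hW θ) ω) =
      ∫ h, (s (price (y₀ : ℝ) m h) (X ω) + (W m).indicator
        (fun z => ∫ τ, s ((θ (Quotient.mk _ ω)).announce τ) (X ω)
          ∂(law E (θ (Quotient.mk _ ω)).signal ω) - s (lastPrice y₀ m z) (X ω))
        (announcements (hist m h))) ∂(playLaw σ ω) := by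
  obtain ⟨A, -, hA⟩ := hs.exists_bound
  set q := ∫ τ, s ((θ (Quotient.mk _ ω)).announce τ) (X ω) ∂(law E (θ (Quotient.mk _ ω)).signal ω)
  have hstep : ∀ g : Fin m → Move E X,
      ∫ x, s x.2 (X ω) ∂(stepKernel (deviateProfile σ y₀ m hW θ) ω m g) =
        s (lastPrice y₀ m (announcements g)) (X ω) +
          (W m).indicator (fun z => q - s (lastPrice y₀ m z) (X ω)) (announcements g) := fun g => by
    rw [integral_stepKernel _ ω m _ (hs.measurable_score ω (by fun_prop)) fun p => hA _ _]
    by_cases hg : announcements g ∈ W m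
    · simp only [resultingMove_deviateProfile_of_mem σ y₀ hW θ hi hg, Set.indicator_of_mem hg,
        chosenSignal_deviateProfile_of_mem σ y₀ hW θ hi hg]
      simp [q]
    · simp only [resultingMove_deviateProfile_of_not σ y₀ hW θ le_rfl hi (fun h => hg h.2),
        Set.indicator_of_notMem hg]
      simp
  have hscore : Measurable fun z => s (lastPrice y₀ m z) (X ω) :=
    hs.measurable_score ω (by fun_prop)
  simp only [price_eq_lastPrice]
  rw [← integral_hist_congr (fun k hk => stepKernel_deviateProfile_of_lt σ y₀ hW θ ω hk)
    (f := fun g => s (lastPrice y₀ m (announcements g)) (X ω) +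
      (W m).indicator (fun z => q - s (lastPrice y₀ m z) (X ω)) (announcements g))
    ((hscore.add ((measurable_const.sub hscore).indicator (hW m))).comp
      (measurable_announcements m))]
  simp only [← hstep]
  exact integral_playLaw_step _ ω m (F := fun p => s p.2.2 (X ω))
    (hs.measurable_score ω (by fun_prop)) fun p => hA _ _

variable [SecondCountableTopology T]

lemma meanCost_congr (μ : Ω → ℝ) {σ σ' : ∀ i, Strategy E X P i} {m : ℕ}
    (h : ∀ ω, ∀ k ≤ m, stepKernel σ ω k = stepKernel σ' ω k) :
    meanCost κ μ σ m = meanCost κ μ σ' m := by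
  refine Finset.sum_congr rfl fun ω _ => ?_
  have hlast : ∀ g : ℕ → Move E X, κ.K (g m).1.1 = κ.K (hist (m + 1) g (Fin.last m)).1.1 :=
    fun g => rfl
  simp only [hlast]
  rw [lintegral_hist_congr (fun k hk => h ω k (Nat.lt_succ_iff.1 hk))
    (f := fun g => κ.K (g (Fin.last m)).1.1) (by fun_prop)]

lemma meanCost_eq_zero (μ : Ω → ℝ) {σ : ∀ i, Strategy E X P i} {k : ℕ}
    (h : ∀ ω p, κ.K (chosenSignal σ ω k p) = 0) : meanCost κ μ σ k = 0 := by
  refine Finset.sum_eq_zero fun ω _ => ?_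
  have hzero : ∀ᵐ x ∂(playLaw σ ω), κ.K (x k).1.1 = 0 :=
    ae_playLaw_of_resultingMove σ ω k (S := {p | κ.K p.2.1.1 = 0})
      (measurableSet_eq_fun (by fun_prop) (by fun_prop)) fun g u _ => h ω (g, u)
  rw [lintegral_congr_ae hzero, lintegral_zero, mul_zero]

lemma meanCost_deviateProfile_ne_top (μ : Ω → ℝ) (hi : turn n m = i) :
    meanCost κ μ (deviateProfile σ y₀ m hW θ) m ≠ ∞ := by
  refine (ENNReal.sum_lt_top.2 fun ω _ => ?_).ne
  rw [lintegral_cost_deviateProfile σ y₀ hW θ hi]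
  exact ENNReal.mul_lt_top ENNReal.ofReal_lt_top
    (ENNReal.mul_lt_top (θ _).cost_ne_top.lt_top (measure_lt_top _ _))

lemma toReal_meanCost_deviateProfile {μ : Ω → ℝ} (hμ : μ ∈ stdSimplex ℝ Ω) (hi : turn n m = i) :
    (meanCost κ μ (deviateProfile σ y₀ m hW θ) m).toReal =
      ∑ ω, μ ω * ((κ.K (θ (Quotient.mk _ ω)).signal).toReal *
        (playLaw σ ω).real {h | announcements (hist m h) ∈ W m}) := by
  have hne := meanCost_deviateProfile_ne_top σ y₀ hW θ μ hi
  rw [meanCost, ENNReal.toReal_sum (ENNReal.sum_ne_top.1 hne)]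
  refine Finset.sum_congr rfl fun ω _ => ?_
  rw [lintegral_cost_deviateProfile σ y₀ hW θ hi, ENNReal.toReal_mul, ENNReal.toReal_mul,
    ENNReal.toReal_ofReal (hμ.1 ω), measureReal_def]

lemma meanScore_sub_meanCost_deviateProfile {s : ℝ → ℝ → ℝ} (hs : IsScoringRule X s)
    {μ : Ω → ℝ} (hμ : μ ∈ stdSimplex ℝ Ω) (hi : turn n m = i) :
    meanScore s y₀ μ (deviateProfile σ y₀ m hW θ) (m + 1) -
      meanScore s y₀ μ (deviateProfile σ y₀ m hW θ) m -
      κ.c * (meanCost κ μ (deviateProfile σ y₀ m hW θ) m).toReal = gain σ y₀ θ s μ m (W m) := by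
  obtain ⟨A, -, hA⟩ := hs.exists_bound
  rw [meanScore_congr y₀ hs μ fun ω k hk => stepKernel_deviateProfile_of_lt σ y₀ hW θ ω hk,
    toReal_meanCost_deviateProfile σ y₀ hW θ hμ hi, meanScore, meanScore, gain,
    ← Finset.sum_sub_distrib, Finset.mul_sum, ← Finset.sum_sub_distrib]
  refine Finset.sum_congr rfl fun ω _ => ?_
  have hD : MeasurableSet {h : ℕ → Move E X | announcements (hist m h) ∈ W m} :=
    measurableSet_preimage (by fun_prop) (hW m)
  set D := {h : ℕ → Move E X | announcements (hist m h) ∈ W m}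
  have hindicator : ∀ (f : (Fin m → predictions X) → ℝ) (h : ℕ → Move E X),
      (W m).indicator f (announcements (hist m h)) =
        D.indicator (fun h => f (announcements (hist m h))) h := fun _ _ => rfl
  have hprice := measurable_score_price (E := E) hs y₀ m ω
  have hbound : ∀ h : ℕ → Move E X, |s (price (y₀ : ℝ) m h) (X ω)| ≤ A := fun h => by
    rw [price_eq_lastPrice]; exact hA _ _
  have hint : Integrable (fun h : ℕ → Move E X => s (price (y₀ : ℝ) m h) (X ω)) (playLaw σ ω) :=
    .of_bound hprice.aestronglyMeasurable A (.of_forall hbound)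
  have hintD : ∀ a : ℝ, Integrable
      (fun h => D.indicator (fun h => a - s (price (y₀ : ℝ) m h) (X ω)) h) (playLaw σ ω) :=
    fun a => ((integrable_const a).sub hint).indicator hD
  have hset : ∀ a : ℝ, ∫ h, D.indicator (fun h => a - s (price (y₀ : ℝ) m h) (X ω)) h
      ∂(playLaw σ ω) =
        (playLaw σ ω).real D * a - ∫ h in D, s (price (y₀ : ℝ) m h) (X ω) ∂(playLaw σ ω) :=
    fun a => by
      rw [integral_indicator hD, integral_sub (integrable_const a) hint.integrableOn,
        setIntegral_const, smul_eq_mul]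
  rw [integral_score_deviateProfile σ y₀ hW θ hs hi]
  simp only [hindicator, ← price_eq_lastPrice, Plan.value]
  rw [integral_add hint (hintD _), hset, hset]
  ring

end Deviation

lemma sum_range_filter_eq_add_ite {N : Type*} [AddCommMonoid N] {p : ℕ → Prop} [DecidablePred p]
    {f f' : ℕ → N} {m M : ℕ} (hm : m < M) (hlt : ∀ k < m, f' k = f k)
    (hgt : ∀ k, m < k → p k → f' k = 0) :
    ∑ k ∈ Finset.range M with p k, f' k =
      ∑ k ∈ Finset.range m with p k, f k + if p m then f' m else 0 := by
  obtain ⟨r, rfl⟩ := Nat.exists_eq_add_of_le (Nat.succ_le_of_lt hm)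
  have hlate : ∑ j ∈ Finset.range r, (if p (m + 1 + j) then f' (m + 1 + j) else 0) = 0 :=
    Finset.sum_eq_zero fun j _ => ite_eq_right_iff.2 (hgt _ (by lia))
  rw [Finset.sum_filter, Finset.sum_filter, Nat.succ_eq_add_one, Finset.sum_range_add, hlate,
    add_zero, Finset.sum_range_succ]
  congr 1
  exact Finset.sum_congr rfl fun k hk => by rw [hlt k (Finset.mem_range.1 hk)]

lemma coe_add_sub_coe_add {a b : ℝ} {C D : ℝ≥0∞} (hD : D ≠ ∞) :
    ((a + b : ℝ) : EReal) - ((C + D : ℝ≥0∞) : EReal) =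
      ((a : ℝ) : EReal) - ((C : ℝ≥0∞) : EReal) + ((b - D.toReal : ℝ) : EReal) := by
  lift D to NNReal using hD
  induction C with
  | top => simp
  | coe C =>
    simp only [ENNReal.coe_toReal, EReal.coe_ennreal_add, EReal.coe_nnreal_eq_coe_real]
    norm_cast
    push_cast
    ring

section DeviationPayoff

variable {Ω T : Type*} [Fintype Ω]
  [MeasurableSpace T] [MetricSpace T] [BorelSpace T]
  {E : Set (Ω → ProbabilityMeasure T)} {X : Ω → ℝ} {n : ℕ} [NeZero n] {P : InfoStructure Ω n}
  {κ : CostStructure E}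
  (σ : ∀ i, Strategy E X P i) {i : Fin n} (y₀ : predictions X) {m : ℕ}
  {W : ∀ k, Set (Fin k → predictions X)} (hW : ∀ k, MeasurableSet (W k))
  (θ : Quotient (P.part i) → Plan κ X)

lemma meanScore_succ_deviateProfile_of_gt (s : ℝ → ℝ → ℝ) (μ : Ω → ℝ) {k : ℕ} (hk : m < k)
    (hi : turn n k = i) :
    meanScore s y₀ μ (deviateProfile σ y₀ m hW θ) (k + 1) =
      meanScore s y₀ μ (deviateProfile σ y₀ m hW θ) k :=
  meanScore_succ_of_repeat s y₀ μ fun ω g u τ => by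
    rw [resultingMove_deviateProfile_of_not σ y₀ hW θ hk.le hi fun h => hk.ne' h.1]

variable [SecondCountableTopology T]

lemma meanCost_deviateProfile_of_gt (μ : Ω → ℝ) {k : ℕ} (hk : m < k) (hi : turn n k = i) :
    meanCost κ μ (deviateProfile σ y₀ m hW θ) k = 0 :=
  meanCost_eq_zero μ fun ω p => by
    rw [chosenSignal_deviateProfile_of_not σ y₀ hW θ hk.le hi fun h => hk.ne' h.1, κ.K_free]

variable [MeasurableSpace Ω] [MeasurableSingletonClass Ω]

lemma payoffUpTo_deviateProfile {s : ℝ → ℝ → ℝ} (hs : IsScoringRule X s) {β : ℝ} (hβ : 0 < β)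
    {μ : Ω → ℝ} (hμ : μ ∈ stdSimplex ℝ Ω) {M : ℕ} (hM : m < M) :
    payoffUpTo κ s y₀ β μ (deviateProfile σ y₀ m hW θ) i M =
      payoffUpTo κ s y₀ β μ σ i m +
        ((if turn n m = i then β ^ (m + 1) * gain σ y₀ θ s μ m (W m) else 0 : ℝ) : EReal) := by
  set σ' := deviateProfile σ y₀ m hW θ
  have hstep : ∀ ω, ∀ k < m, stepKernel σ' ω k = stepKernel σ ω k := fun ω k hk =>
    stepKernel_deviateProfile_of_lt σ y₀ hW θ ω hk
  have hscore : ∀ k ≤ m, meanScore s y₀ μ σ' k = meanScore s y₀ μ σ k := fun k hk =>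
    meanScore_congr y₀ hs μ fun ω j hj => hstep ω j (hj.trans_le hk)
  have hcost : ∀ k < m, meanCost κ μ σ' k = meanCost κ μ σ k := fun k hk =>
    meanCost_congr μ fun ω j hj => hstep ω j (hj.trans_lt hk)
  have hscores := sum_range_filter_eq_add_ite (p := fun k => turn n k = i) hM
    (f' := fun k => β ^ (k + 1) * (meanScore s y₀ μ σ' (k + 1) - meanScore s y₀ μ σ' k))
    (fun k hk => by rw [hscore k hk.le, hscore (k + 1) hk])
    (fun k hk hi => by
      rw [meanScore_succ_deviateProfile_of_gt σ y₀ hW θ s μ hk hi, sub_self, mul_zero])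
  have hcosts := sum_range_filter_eq_add_ite (p := fun k => turn n k = i) hM
    (f' := fun k => ENNReal.ofReal (β ^ (k + 1) * κ.c) * meanCost κ μ σ' k)
    (fun k hk => by rw [hcost k hk])
    (fun k hk hi => by rw [meanCost_deviateProfile_of_gt σ y₀ hW θ μ hk hi, mul_zero])
  rw [payoffUpTo_eq hs y₀ β hμ, payoffUpTo_eq hs y₀ β hμ, hscores, hcosts]
  split_ifs with hi
  · have hne := meanCost_deviateProfile_ne_top σ y₀ hW θ μ hi
    rw [coe_add_sub_coe_add (ENNReal.mul_ne_top ENNReal.ofReal_ne_top hne),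
      ← meanScore_sub_meanCost_deviateProfile σ y₀ hW θ hs hμ hi, ENNReal.toReal_mul,
      ENNReal.toReal_ofReal (mul_nonneg (by positivity) κ.c_pos.le)]
    congr 2
    ring
  · simp

end DeviationPayoff

section DiscountedSums

lemma sum_discounted_sub_le {a : ℕ → ℝ} {A β : ℝ} (ha : ∀ k, |a k| ≤ A) (hβ : 0 < β)
    (hβ1 : β ≤ 1) (m : ℕ) :
    ∑ k ∈ Finset.range m, β ^ (k + 1) * (a (k + 1) - a k) ≤ 2 * A := by
  have hsum : ∑ k ∈ Finset.range m, β ^ (k + 1) * (a (k + 1) - a k) ≤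
      β ^ m * a m - a 0 + (1 - β ^ m) * A := by
    induction m with
    | zero => simp
    | succ m ih =>
      rw [Finset.sum_range_succ]
      have ham : a m ≤ A := (abs_le.1 (ha m)).2
      have hpow : β ^ (m + 1) ≤ β ^ m := pow_le_pow_of_le_one hβ.le hβ1 (Nat.le_succ m)
      nlinarith
  have ham := abs_le.1 (ha m)
  have ha0 := abs_le.1 (ha 0)
  have hpow : 0 < β ^ m := pow_pos hβ m
  nlinarith

variable {a w : ℕ → ℝ} {A β : ℝ}

lemma sum_range_add_le_of_le_discounted_sub (ha : ∀ k, |a k| ≤ A) (hβ : 0 < β) (hβ1 : β ≤ 1)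
    (hw : ∀ k, w k ≤ β ^ (k + 1) * (a (k + 1) - a k)) (m r : ℕ) :
    ∑ j ∈ Finset.range r, w (m + j) ≤ β ^ m * (2 * A) := by
  calc ∑ j ∈ Finset.range r, w (m + j)
      ≤ ∑ j ∈ Finset.range r, β ^ m * (β ^ (j + 1) * (a (m + (j + 1)) - a (m + j))) := by
        refine Finset.sum_le_sum fun j _ => (hw _).trans (le_of_eq ?_)
        rw [← mul_assoc, ← pow_add, add_assoc m j 1]
    _ ≤ β ^ m * (2 * A) := by
        rw [← Finset.mul_sum]
        gcongr
        exact sum_discounted_sub_le (a := fun k => a (m + k)) (fun k => ha _) hβ hβ1 r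

lemma ne_top_of_tendsto_of_sum_le {ι : Type*} [Fintype ι] {p : ι → ℕ → ℝ} {B : ℝ}
    (hB : ∀ m, ∑ i, p i m ≤ B) {u : ι → EReal}
    (hu : ∀ i, Tendsto (fun m => (p i m : EReal)) atTop (𝓝 (u i))) (h0 : ∀ i, 0 ≤ u i) (i : ι) :
    u i ≠ ⊤ := by
  intro hi
  have hlower : ∀ j, ∀ᶠ m in atTop, (-1 : ℝ) < p j m := fun j => by
    have := (hu j).eventually (lt_mem_nhds (a := ((-1 : ℝ) : EReal))
      (lt_of_lt_of_le (by norm_cast) (h0 j)))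
    filter_upwards [this] with m hm using by exact_mod_cast hm
  have hlarge : ∀ᶠ m in atTop, B + Fintype.card ι < p i m := by
    have := (hu i).eventually (lt_mem_nhds (a := ((B + Fintype.card ι : ℝ) : EReal))
      (hi ▸ EReal.coe_lt_top _))
    filter_upwards [this] with m hm using by exact_mod_cast hm
  obtain ⟨m, hm, hmi⟩ := ((eventually_all.2 hlower).and hlarge).exists
  have hsum : ∑ j, (p j m + 1) ≤ B + Fintype.card ι := by
    simpa [Finset.sum_add_distrib] using hB m
  have hsingle : p i m + 1 ≤ ∑ j, (p j m + 1) :=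
    Finset.single_le_sum (f := fun j => p j m + 1) (fun j _ => by linarith [hm j])
      (Finset.mem_univ i)
  linarith

lemma tendsto_zero_of_le_sub_add_mul {ε : ℕ → ℝ} {B : ℝ} (hβ : 0 ≤ β) (hβ1 : β < 1)
    (ha : ∀ k, |a k| ≤ A) (hε : ∀ m, 0 ≤ ε m) (hεB : ∀ m, ε m ≤ B)
    (hrec : ∀ m, ε m ≤ a (m + 1) - a m + β * ε (m + 1)) : Tendsto ε atTop (𝓝 0) := by
  have hsum : ∀ M, (1 - β) * ∑ m ∈ Finset.range M, ε m ≤ a M - a 0 + β * ε M := fun M => by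
    induction M with
    | zero => simpa using mul_nonneg hβ (hε 0)
    | succ M ih =>
      rw [Finset.sum_range_succ]
      linarith [hrec M]
  refine (summable_of_sum_range_le (c := (2 * A + β * B) / (1 - β)) hε fun M => ?_)
    |>.tendsto_atTop_zero
  rw [le_div_iff₀ (by linarith)]
  have haM := abs_le.1 (ha M)
  have ha0 := abs_le.1 (ha 0)
  linarith [hsum M, mul_le_mul_of_nonneg_left (hεB M) hβ]

lemma tendsto_sub_sum_div_pow {U : ℝ} (ha : ∀ k, |a k| ≤ A) (hβ : 0 < β) (hβ1 : β ≤ 1)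
    (hw : ∀ k, w k ≤ β ^ (k + 1) * (a (k + 1) - a k))
    (hU : Tendsto (fun m => ∑ k ∈ Finset.range m, w k) atTop (𝓝 U))
    (hle : ∀ m, ∑ k ∈ Finset.range m, w k ≤ U) :
    Tendsto (fun m => (U - ∑ k ∈ Finset.range m, w k) / β ^ (m + 1)) atTop (𝓝 0) := by
  obtain hlt | rfl := hβ1.lt_or_eq
  swap
  · simpa using hU.const_sub U
  have hpow : ∀ m : ℕ, 0 < β ^ m := fun m => pow_pos hβ m
  refine tendsto_zero_of_le_sub_add_mul (B := 2 * A / β) hβ.le hlt ha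
    (fun m => div_nonneg (sub_nonneg.2 (hle m)) (hpow _).le) (fun m => ?_) fun m => ?_
  · have htail : U - ∑ k ∈ Finset.range m, w k ≤ β ^ m * (2 * A) := by
      refine le_of_tendsto (hU.sub_const _) ?_
      filter_upwards [eventually_ge_atTop m] with M hM
      obtain ⟨r, rfl⟩ := Nat.exists_eq_add_of_le hM
      have := sum_range_add_le_of_le_discounted_sub ha hβ hβ1 hw m r
      rw [Finset.sum_range_add]
      linarith
    rw [div_le_div_iff₀ (hpow _) hβ, pow_succ]
    nlinarith
  · have hsucc : β * ((U - ∑ k ∈ Finset.range (m + 1), w k) / β ^ (m + 1 + 1)) =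
        (U - ∑ k ∈ Finset.range m, w k) / β ^ (m + 1) - w m / β ^ (m + 1) := by
      rw [Finset.sum_range_succ]
      field_simp
      ring
    have hwm : w m / β ^ (m + 1) ≤ a (m + 1) - a m := by
      rw [div_le_iff₀ (hpow _)]
      linarith [hw m]
    linarith

/- The traders' payoffs `w` are at most discounted increments of one bounded sequence, so the total
remaining payoff, in date-`m` units, tends to `0`; it dominates what any single trader can still
gain because every trader's continuation payoff is nonnegative. -/
lemma exists_tendsto_zero_forall_gain_le {n : ℕ} [NeZero n] (ha : ∀ k, |a k| ≤ A) (hβ : 0 < β)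
    (hβ1 : β ≤ 1) (hw : ∀ k, w k ≤ β ^ (k + 1) * (a (k + 1) - a k)) {u : Fin n → EReal}
    (hu : ∀ i, Tendsto (fun m => ((∑ k ∈ Finset.range m with turn n k = i, w k : ℝ) : EReal))
      atTop (𝓝 (u i)))
    (hle : ∀ i m, ((∑ k ∈ Finset.range m with turn n k = i, w k : ℝ) : EReal) ≤ u i) :
    ∃ ε : ℕ → ℝ, Tendsto ε atTop (𝓝 0) ∧ ∀ m g,
      ((∑ k ∈ Finset.range m with turn n k = turn n m, w k : ℝ) : EReal) +
        ((β ^ (m + 1) * g : ℝ) : EReal) ≤ u (turn n m) → g ≤ ε m := by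
  set p : Fin n → ℕ → ℝ := fun i m => ∑ k ∈ Finset.range m with turn n k = i, w k
  have hsum : ∀ m, ∑ i, p i m = ∑ k ∈ Finset.range m, w k := fun m =>
    Finset.sum_fiberwise (Finset.range m) (turn n) w
  have hnonneg : ∀ i, 0 ≤ u i := fun i => by simpa using hle i 0
  have htop : ∀ i, u i ≠ ⊤ := ne_top_of_tendsto_of_sum_le (B := 2 * A) (p := p)
    (fun m => by
      rw [hsum]
      simpa using sum_range_add_le_of_le_discounted_sub ha hβ hβ1 hw 0 m) hu hnonneg
  lift u to Fin n → ℝ using fun i => ⟨htop i, (EReal.bot_lt_zero.trans_le (hnonneg i)).ne'⟩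
  simp only [EReal.tendsto_coe, EReal.coe_le_coe_iff] at hu hle
  have hlim : Tendsto (fun m => ∑ k ∈ Finset.range m, w k) atTop (𝓝 (∑ i, u i)) :=
    (tendsto_finsetSum Finset.univ fun i _ => hu i).congr hsum
  refine ⟨_, tendsto_sub_sum_div_pow ha hβ hβ1 hw hlim fun m => ?_, fun m g hg => ?_⟩
  · rw [← hsum]
    exact Finset.sum_le_sum fun i _ => hle i m
  · have hg : p (turn n m) m + β ^ (m + 1) * g ≤ u (turn n m) := by
      rw [← EReal.coe_add] at hg
      exact EReal.coe_le_coe_iff.1 hg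
    have hsingle : u (turn n m) - p (turn n m) m ≤ ∑ i, (u i - p i m) :=
      Finset.single_le_sum (f := fun i => u i - p i m) (fun i _ => sub_nonneg.2 (hle i m))
        (Finset.mem_univ _)
    rw [Finset.sum_sub_distrib, hsum] at hsingle
    rw [le_div_iff₀ (pow_pos hβ _)]
    linarith

end DiscountedSums

section Learning

/-- The conditional law of the random state `st`, given the information `m`. -/
def belief {Ω 𝓧 : Type*} {_ : MeasurableSpace 𝓧} (ρ : Measure 𝓧) (st : 𝓧 → Ω)
    (m : MeasurableSpace 𝓧) (p : 𝓧) (ω : Ω) : ℝ :=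
  (ρ[(st ⁻¹' {ω}).indicator (fun _ => (1 : ℝ)) | m]) p

variable {Ω 𝓧 : Type*} {m m₀ : MeasurableSpace 𝓧} {ρ : Measure 𝓧} {st : 𝓧 → Ω}

lemma measurable_belief (ω : Ω) : Measurable[m] fun p => belief ρ st m p ω :=
  stronglyMeasurable_condExp.measurable

lemma measurable_belief_pi (hm : m ≤ m₀) : Measurable (belief ρ st m) :=
  measurable_pi_lambda _ fun ω => (measurable_belief ω).mono hm le_rfl

lemma belief_nonneg [Countable Ω] : ∀ᵐ p ∂ρ, ∀ ω, 0 ≤ belief ρ st m p ω :=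
  ae_all_iff.2 fun _ =>
    condExp_nonneg (.of_forall fun p => Set.indicator_nonneg (fun _ _ => zero_le_one) p)

variable [IsProbabilityMeasure ρ]

lemma tendsto_belief [Countable Ω] (ℱ : Filtration ℕ m₀) :
    ∀ᵐ p ∂ρ, Tendsto (fun k => belief ρ st (ℱ k) p) atTop
      (𝓝 (belief ρ st (⨆ k, ℱ k) p)) := by
  filter_upwards [ae_all_iff.2 fun ω => tendsto_ae_condExp (μ := ρ) (ℱ := ℱ)
    ((st ⁻¹' {ω}).indicator (fun _ => (1 : ℝ)))] with p hp
  exact tendsto_pi_nhds.2 hp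

variable [MeasurableSpace Ω] [MeasurableSingletonClass Ω]

lemma integrable_indicator_state (hst : Measurable st) (ω : Ω) :
    Integrable ((st ⁻¹' {ω}).indicator (fun _ => (1 : ℝ))) ρ :=
  (integrable_const _).indicator (hst (measurableSet_singleton ω))

lemma belief_state_pos [Countable Ω] (hst : Measurable st) (hm : m ≤ m₀) :
    ∀ᵐ p ∂ρ, 0 < belief ρ st m p (st p) := by
  have hne : ∀ ω, ∀ᵐ p ∂ρ, st p = ω → belief ρ st m p ω ≠ 0 := fun ω => by
    have hS : MeasurableSet[m] {p | belief ρ st m p ω = 0} :=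
      measurable_belief ω (measurableSet_singleton 0)
    have hint := setIntegral_condExp hm (integrable_indicator_state (ρ := ρ) hst ω) hS
    change ∫ p in _, belief ρ st m p ω ∂ρ = _ at hint
    rw [setIntegral_congr_fun (g := fun _ => (0 : ℝ)) (hm _ hS) (fun p hp => hp), integral_zero,
      setIntegral_indicator (hst (measurableSet_singleton ω)), setIntegral_const, smul_eq_mul,
      mul_one] at hint
    have hnull := (measureReal_eq_zero_iff).1 hint.symm
    filter_upwards [measure_eq_zero_iff_ae_notMem.1 hnull] with p hp hpω h0
    exact hp ⟨h0, hpω⟩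
  filter_upwards [ae_all_iff.2 hne, belief_nonneg (ρ := ρ) (st := st) (m := m)] with p hp hnonneg
  exact lt_of_le_of_ne (hnonneg _) (hp _ rfl).symm

variable [Fintype Ω]

lemma belief_mem_stdSimplex (hst : Measurable st) (hm : m ≤ m₀) :
    ∀ᵐ p ∂ρ, belief ρ st m p ∈ stdSimplex ℝ Ω := by
  have hone : ∑ ω, (st ⁻¹' {ω}).indicator (fun _ => (1 : ℝ)) = fun _ => 1 := by
    classical
    funext p
    simp [Finset.sum_apply, Set.indicator_apply]
  have hsum : ρ[∑ ω, (st ⁻¹' {ω}).indicator (fun _ => (1 : ℝ)) | m] =ᵐ[ρ]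
      ∑ ω, ρ[(st ⁻¹' {ω}).indicator (fun _ => (1 : ℝ)) | m] :=
    condExp_finsetSum (fun ω _ => integrable_indicator_state hst ω) m
  rw [hone, condExp_const hm] at hsum
  filter_upwards [belief_nonneg (ρ := ρ) (st := st) (m := m), hsum] with p hp hp1
  refine ⟨hp, ?_⟩
  rw [hp1, Finset.sum_apply]
  rfl

lemma integral_belief (hst : Measurable st) (hm : m ≤ m₀) {g : Ω → 𝓧 → ℝ}
    (hg : ∀ ω, Measurable[m] (g ω)) {B : ℝ} (hB : ∀ ω p, |g ω p| ≤ B) :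
    ∫ p, g (st p) p ∂ρ = ∫ p, ∑ ω, belief ρ st m p ω * g ω p ∂ρ := by
  classical
  have hinteg : ∀ ω, Integrable ((st ⁻¹' {ω}).indicator (fun _ => (1 : ℝ)) * g ω) ρ := fun ω => by
    refine (integrable_indicator_state hst ω).mul_bdd (c := B) ?_ (.of_forall (hB ω))
    exact ((hg ω).mono hm le_rfl).aestronglyMeasurable
  have hpull : ∀ ω, ρ[(st ⁻¹' {ω}).indicator (fun _ => (1 : ℝ)) * g ω | m] =ᵐ[ρ]
      fun p => belief ρ st m p ω * g ω p := fun ω =>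
    condExp_mul_of_stronglyMeasurable_right (hg ω).stronglyMeasurable (hinteg ω)
      (integrable_indicator_state hst ω)
  have hsplit : ∀ p, g (st p) p =
      ∑ ω, ((st ⁻¹' {ω}).indicator (fun _ => (1 : ℝ)) * g ω) p := fun p => by
    simp [Set.indicator_apply]
  simp only [hsplit]
  rw [integral_finsetSum _ fun ω _ => hinteg ω, integral_finsetSum]
  · refine Finset.sum_congr rfl fun ω _ => ?_
    rw [← integral_condExp hm, integral_congr_ae (hpull ω)]
  · exact fun ω _ => integrable_condExp.congr (hpull ω)

end Learning

section PublicBelief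

variable {Ω T : Type*} [MeasurableSpace Ω] [MeasurableSpace T]
  {E : Set (Ω → ProbabilityMeasure T)} {X : Ω → ℝ} {n : ℕ} [NeZero n] {P : InfoStructure Ω n}

/-- The filtration generated by the announcements. -/
def publicFiltration (E : Set (Ω → ProbabilityMeasure T)) (X : Ω → ℝ) :
    Filtration ℕ (inferInstance : MeasurableSpace (Ω × (ℕ → Move E X))) where
  seq k := MeasurableSpace.comap (fun p => announcements (hist k p.2)) inferInstance
  mono' := by
    intro k l hkl
    have h : (fun p : Ω × (ℕ → Move E X) => announcements (hist k p.2)) =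
        (fun (z : Fin l → predictions X) (j : Fin k) => z (Fin.castLE hkl j)) ∘
          fun p => announcements (hist l p.2) := rfl
    beta_reduce
    rw [h, ← MeasurableSpace.comap_comp]
    exact MeasurableSpace.comap_mono (Measurable.comap_le (by fun_prop))
  le' k := Measurable.comap_le (by fun_prop)

end PublicBelief

section Equilibrium

variable {Ω T : Type*} [Fintype Ω]
  [MeasurableSpace T] [MetricSpace T] [BorelSpace T]
  {E : Set (Ω → ProbabilityMeasure T)} {X : Ω → ℝ} {n : ℕ} [NeZero n] {P : InfoStructure Ω n}
  {κ : CostStructure E} {s : ℝ → ℝ → ℝ} {y₀ : predictions X} {β : ℝ} {μ : Ω → ℝ}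
  {σ : ∀ i, Strategy E X P i}

/-- The mover's expected payoff at index `k`, when the expected cost is finite. -/
def stagePayoff (κ : CostStructure E) (s : ℝ → ℝ → ℝ) (y₀ : predictions X) (β : ℝ) (μ : Ω → ℝ)
    (σ : ∀ i, Strategy E X P i) (k : ℕ) : ℝ :=
  β ^ (k + 1) * (meanScore s y₀ μ σ (k + 1) - meanScore s y₀ μ σ k) -
    β ^ (k + 1) * κ.c * (meanCost κ μ σ k).toReal

/-- `ε m` bounds the gain from every one-shot deviation of the trader moving at index `m`. -/
def IsGainBound (κ : CostStructure E) (s : ℝ → ℝ → ℝ) (y₀ : predictions X) (μ : Ω → ℝ)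
    (σ : ∀ i, Strategy E X P i) (ε : ℕ → ℝ) : Prop :=
  ∀ (m : ℕ) (W : Set (Fin m → predictions X)), MeasurableSet W →
    ∀ θ : Quotient (P.part (turn n m)) → Plan κ X, gain σ y₀ θ s μ m W ≤ ε m

lemma stagePayoff_le (hβ : 0 < β) (k : ℕ) :
    stagePayoff κ s y₀ β μ σ k ≤
      β ^ (k + 1) * (meanScore s y₀ μ σ (k + 1) - meanScore s y₀ μ σ k) :=
  sub_le_self _ (mul_nonneg (mul_pos (pow_pos hβ _) κ.c_pos).le ENNReal.toReal_nonneg)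

variable [SecondCountableTopology T] [MeasurableSpace Ω] [MeasurableSingletonClass Ω]

lemma payoffUpTo_eq_sum_stagePayoff (hs : IsScoringRule X s) (hβ : 0 < β)
    (hμ : μ ∈ stdSimplex ℝ Ω) (hcost : ∀ k, meanCost κ μ σ k ≠ ∞) (i : Fin n) (m : ℕ) :
    payoffUpTo κ s y₀ β μ σ i m =
      ((∑ k ∈ Finset.range m with turn n k = i, stagePayoff κ s y₀ β μ σ k : ℝ) : EReal) := by
  have hterm : ∀ k, ENNReal.ofReal (β ^ (k + 1) * κ.c) * meanCost κ μ σ k ≠ ∞ := fun k =>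
    ENNReal.mul_ne_top ENNReal.ofReal_ne_top (hcost k)
  rw [payoffUpTo_eq hs y₀ β hμ,
    ← EReal.coe_ennreal_toReal (ENNReal.sum_ne_top.2 fun k _ => hterm k),
    ENNReal.toReal_sum fun k _ => hterm k, ← EReal.coe_sub, ← Finset.sum_sub_distrib]
  congr 1
  refine Finset.sum_congr rfl fun k _ => ?_
  rw [ENNReal.toReal_mul, ENNReal.toReal_ofReal (mul_pos (pow_pos hβ _) κ.c_pos).le, stagePayoff]

lemma payoffUpTo_add_gain_le (hs : IsScoringRule X s) (hβ : 0 < β) (hμ : μ ∈ stdSimplex ℝ Ω)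
    {i : Fin n} {u : EReal}
    (hu : ∀ (d : Strategy E X P i) (u' : EReal),
      HasPayoff κ s y₀ β μ (Function.update σ i d) i u' → u' ≤ u) {m : ℕ}
    {W : Set (Fin m → predictions X)} (hW : MeasurableSet W)
    (θ : Quotient (P.part i) → Plan κ X) :
    payoffUpTo κ s y₀ β μ σ i m +
      ((if turn n m = i then β ^ (m + 1) * gain σ y₀ θ s μ m W else 0 : ℝ) : EReal) ≤ u := by
  classical
  let W' : ∀ k, Set (Fin k → predictions X) := fun k => if h : k = m then h ▸ W else ∅
  have hW' : ∀ k, MeasurableSet (W' k) := fun k => by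
    obtain rfl | h := eq_or_ne k m
    · simpa [W'] using hW
    · simp [W', h]
  refine hu (deviate (σ i) y₀ m W' hW' θ) _ (tendsto_const_nhds.congr' ?_)
  filter_upwards [eventually_gt_atTop m] with M hM
  rw [payoffUpTo_deviateProfile σ y₀ hW' θ hs hβ hμ hM]
  simp [W']

lemma payoffUpTo_le (hs : IsScoringRule X s) (hβ : 0 < β) (hμ : μ ∈ stdSimplex ℝ Ω)
    {i : Fin n} {u : EReal}
    (hu : ∀ (d : Strategy E X P i) (u' : EReal),
      HasPayoff κ s y₀ β μ (Function.update σ i d) i u' → u' ≤ u) (m : ℕ) :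
    payoffUpTo κ s y₀ β μ σ i m ≤ u := by
  simpa [gain] using
    payoffUpTo_add_gain_le (m := m) hs hβ hμ hu .empty fun _ => Plan.const κ y₀

lemma IsNash.meanCost_ne_top (hN : IsNash κ s y₀ β μ σ) (hs : IsScoringRule X s) (hβ : 0 < β)
    (hμ : μ ∈ stdSimplex ℝ Ω) (k : ℕ) : meanCost κ μ σ k ≠ ∞ := by
  intro hk
  obtain ⟨u, hu, hdev⟩ := hN (turn n k)
  have hnonneg : 0 ≤ u := by
    simpa [payoffUpTo_eq hs y₀ β hμ] using payoffUpTo_le hs hβ hμ hdev 0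
  have hpay : Tendsto (payoffUpTo κ s y₀ β μ σ (turn n k)) atTop (𝓝 ⊥) := by
    refine tendsto_const_nhds.congr' ?_
    filter_upwards [eventually_gt_atTop k] with M hM
    have hsum : ∑ j ∈ Finset.range M with turn n j = turn n k,
        ENNReal.ofReal (β ^ (j + 1) * κ.c) * meanCost κ μ σ j = ∞ := by
      refine ENNReal.sum_eq_top.2 ⟨k, by simp [hM], ?_⟩
      rw [hk, ENNReal.mul_top]
      simpa using mul_pos (pow_pos hβ (k + 1)) κ.c_pos
    rw [payoffUpTo_eq hs y₀ β hμ, hsum, EReal.coe_ennreal_top, EReal.sub_top]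
  rw [tendsto_nhds_unique hu hpay] at hnonneg
  exact absurd hnonneg (by simp)

lemma IsNash.exists_isGainBound (hN : IsNash κ s y₀ β μ σ) (hs : IsScoringRule X s)
    (hβ : 0 < β) (hβ1 : β ≤ 1) (hμ : μ ∈ stdSimplex ℝ Ω) :
    ∃ ε : ℕ → ℝ, Tendsto ε atTop (𝓝 0) ∧ IsGainBound κ s y₀ μ σ ε := by
  have hpay := payoffUpTo_eq_sum_stagePayoff (y₀ := y₀) hs hβ hμ
    (hN.meanCost_ne_top hs hβ hμ)
  choose u hu hdev using hN
  obtain ⟨A, -, hA⟩ := hs.exists_bound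
  obtain ⟨ε, hε, hgain⟩ := exists_tendsto_zero_forall_gain_le
    (abs_meanScore_le hA y₀ hμ σ) hβ hβ1 (stagePayoff_le (κ := κ) hβ)
    (fun i => (hu i).congr (hpay i)) (fun i m => hpay i m ▸ payoffUpTo_le hs hβ hμ (hdev i) m)
  refine ⟨ε, hε, fun m W hW θ => hgain m _ ?_⟩
  simpa only [hpay, if_true] using payoffUpTo_add_gain_le hs hβ hμ (hdev (turn n m)) hW θ

end Equilibrium

section Edge

variable {Ω : Type*} [Fintype Ω] {X : Ω → ℝ}

/-- The expected gain, at the belief `γ`, of the state-dependent payoff `a` over the score of the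
price `y`. -/
def edge (s : ℝ → ℝ → ℝ) (X a γ : Ω → ℝ) (y : predictions X) : ℝ :=
  ∑ ω, γ ω * (a ω - s y (X ω))

lemma exists_open_edge_ge {s : ℝ → ℝ → ℝ} (hs : IsScoringRule X s) (a : Ω → ℝ)
    {C : Set (Ω → ℝ)} (hC : IsCompact C) {Y : Set (predictions X)} (hY : IsCompact Y)
    (hpos : ∀ γ ∈ C, ∀ y ∈ Y, 0 < edge s X a γ y) :
    ∃ η > 0, ∃ U, IsOpen U ∧ C ⊆ U ∧ ∀ γ ∈ U, ∀ y ∈ Y, η ≤ edge s X a γ y := by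
  have hcont : Continuous fun p : (Ω → ℝ) × predictions X => edge s X a p.1 p.2 :=
    continuous_finsetSum _ fun ω _ => ((continuous_apply ω).comp continuous_fst).mul
      (continuous_const.sub ((hs.continuous ω).comp continuous_snd))
  obtain ⟨η, hη, hη'⟩ : ∃ η > 0, ∀ p ∈ C ×ˢ Y, η < edge s X a p.1 p.2 := by
    obtain h | h := (C ×ˢ Y).eq_empty_or_nonempty
    · exact ⟨1, one_pos, by simp [h]⟩
    · obtain ⟨p, hp, hmin⟩ := (hC.prod hY).exists_isMinOn h hcont.continuousOn
      have hp0 := hpos p.1 hp.1 p.2 hp.2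
      exact ⟨_, half_pos hp0, fun q hq => (half_lt_self hp0).trans_le (hmin hq)⟩
  obtain ⟨U, V, hU, -, hCU, hYV, hUV⟩ := generalized_tube_lemma hC hY
    (isOpen_lt continuous_const hcont) hη'
  exact ⟨η, hη, U, hU, hCU, fun γ hγ y hy => (hUV (Set.mk_mem_prod hγ (hYV hy))).le⟩

lemma IsScoringRule.edge_pos {s : ℝ → ℝ → ℝ} (hs : IsScoringRule X s) {γ : Ω → ℝ}
    (hγ : γ ∈ stdSimplex ℝ Ω) {y : predictions X} (hy : (y : ℝ) ≠ expect γ X) :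
    0 < edge s X (fun ω => s (expect γ X) (X ω)) γ y := by
  simp only [edge, mul_sub, Finset.sum_sub_distrib]
  exact sub_pos.2 (hs.strictlyProper γ hγ X (mem_predictions X) y y.2 hy)

lemma IsScoringRule.edge_nonneg {s : ℝ → ℝ → ℝ} (hs : IsScoringRule X s) {γ : Ω → ℝ}
    (hγ : γ ∈ stdSimplex ℝ Ω) (y : predictions X) :
    0 ≤ edge s X (fun ω => s (expect γ X) (X ω)) γ y := by
  by_cases hy : (y : ℝ) = expect γ X
  · simp [edge, hy]
  · exact (hs.edge_pos hγ hy).le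

/-- The beliefs under which `X` equals `x`. -/
def knownValue (X : Ω → ℝ) (x : ℝ) : Set (Ω → ℝ) :=
  stdSimplex ℝ Ω ∩ {γ | ∀ ω, X ω ≠ x → γ ω = 0}

lemma isCompact_knownValue (X : Ω → ℝ) (x : ℝ) : IsCompact (knownValue X x) := by
  refine (isCompact_stdSimplex ℝ Ω).inter_right ?_
  simp only [Set.ofPred_forall]
  exact isClosed_iInter fun ω => isClosed_iInter fun _ =>
    isClosed_eq (continuous_apply ω) continuous_const

lemma expect_of_mem_knownValue {x : ℝ} {γ : Ω → ℝ} (hγ : γ ∈ knownValue X x) :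
    expect γ X = x := by
  have hmul : ∀ ω, γ ω * X ω = γ ω * x := fun ω => by
    by_cases h : X ω = x
    · rw [h]
    · rw [hγ.2 ω h, zero_mul, zero_mul]
  simp only [expect, hmul]
  rw [← Finset.sum_mul, hγ.1.2, one_mul]

end Edge

section PublicBelief

variable {Ω T : Type*} [Fintype Ω] [MeasurableSpace Ω] [MeasurableSpace T]
  {E : Set (Ω → ProbabilityMeasure T)} {X : Ω → ℝ} {n : ℕ} [NeZero n] {P : InfoStructure Ω n}
  {s : ℝ → ℝ → ℝ} {y₀ : predictions X} {μ : Ω → ℝ} {σ : ∀ i, Strategy E X P i}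

/-- The belief of an outside observer who has seen the announcements before index `k`. -/
def publicBelief (μ : Ω → ℝ) (σ : ∀ i, Strategy E X P i) (k : ℕ) :
    Ω × (ℕ → Move E X) → Ω → ℝ :=
  belief (gameLaw μ σ) Prod.fst (publicFiltration E X k)

/-- The belief of an outside observer who has seen all announcements. -/
def limitBelief (μ : Ω → ℝ) (σ : ∀ i, Strategy E X P i) : Ω × (ℕ → Move E X) → Ω → ℝ :=
  belief (gameLaw μ σ) Prod.fst (⨆ k, publicFiltration E X k)

lemma measurable_limitBelief : Measurable (limitBelief μ σ) :=
  measurable_belief_pi (iSup_le (publicFiltration E X).le)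

lemma tendsto_publicBelief (hμ : μ ∈ stdSimplex ℝ Ω) : ∀ᵐ p ∂(gameLaw μ σ),
    Tendsto (fun k => publicBelief μ σ k p) atTop (𝓝 (limitBelief μ σ p)) :=
  have := isProbabilityMeasure_gameLaw hμ σ
  tendsto_belief _

/-- The event that before index `m` the public belief is in `U` and the price is in `Y`. -/
def publicEvent (y₀ : predictions X) (μ : Ω → ℝ) (σ : ∀ i, Strategy E X P i) (U : Set (Ω → ℝ))
    (Y : Set (predictions X)) (m : ℕ) : Set (Ω × (ℕ → Move E X)) :=
  {p | publicBelief μ σ m p ∈ U ∧ lastPrice y₀ m (announcements (hist m p.2)) ∈ Y}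

lemma measurableSet_publicEvent {U : Set (Ω → ℝ)} (hU : MeasurableSet U)
    {Y : Set (predictions X)} (hY : MeasurableSet Y) (m : ℕ) :
    MeasurableSet[publicFiltration E X m] (publicEvent y₀ μ σ U Y m) := by
  have hbelief : Measurable[publicFiltration E X m] (publicBelief μ σ m) :=
    @measurable_pi_lambda _ _ _ (publicFiltration E X m) _ _ fun ω => measurable_belief ω
  have hprice : Measurable[publicFiltration E X m] fun p : Ω × (ℕ → Move E X) =>
      lastPrice y₀ m (announcements (hist m p.2)) :=
    (measurable_lastPrice y₀ m).comp (comap_measurable _)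
  exact (hbelief hU).inter (hprice hY)

lemma integrable_edge_publicBelief (hs : IsScoringRule X s) (hμ : μ ∈ stdSimplex ℝ Ω)
    (a : Ω → ℝ) (m : ℕ) :
    Integrable (fun p => edge s X a (publicBelief μ σ m p)
      (lastPrice y₀ m (announcements (hist m p.2)))) (gameLaw μ σ) := by
  have := isProbabilityMeasure_gameLaw hμ σ
  obtain ⟨A, -, hA⟩ := hs.exists_bound
  refine integrable_finsetSum _ fun ω _ => ?_
  have hmeas : Measurable fun p : Ω × (ℕ → Move E X) =>
      a ω - s (lastPrice y₀ m (announcements (hist m p.2))) (X ω) :=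
    measurable_const.sub (hs.measurable_score ω (by fun_prop))
  exact integrable_condExp.mul_bdd (c := |a ω| + A) hmeas.aestronglyMeasurable
    (.of_forall fun p => (abs_sub _ _).trans (by gcongr; exact hA _ _))

variable [MeasurableSingletonClass Ω] [MetricSpace T] [BorelSpace T] {κ : CostStructure E}

/- Conditionally on the announcements the state is distributed according to the public belief. -/
lemma gain_eq_setIntegral_edge (hs : IsScoringRule X s) (hμ : μ ∈ stdSimplex ℝ Ω) {m : ℕ}
    {W : Set (Fin m → predictions X)} (hW : MeasurableSet W) {i : Fin n}
    (θ : Quotient (P.part i) → Plan κ X) :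
    gain σ y₀ θ s μ m W = ∫ p in (fun p : Ω × (ℕ → Move E X) => announcements (hist m p.2)) ⁻¹' W,
      edge s X (fun ω => (θ (Quotient.mk _ ω)).value s ω) (publicBelief μ σ m p)
        (lastPrice y₀ m (announcements (hist m p.2))) ∂(gameLaw μ σ) := by
  have := isProbabilityMeasure_gameLaw hμ σ
  obtain ⟨A, -, hA⟩ := hs.exists_bound
  have hm := (publicFiltration E X).le m
  set a : Ω → ℝ := fun ω => (θ (Quotient.mk _ ω)).value s ω
  let g : Ω → Ω × (ℕ → Move E X) → ℝ := fun ω p => W.indicator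
    (fun z => a ω - s (lastPrice y₀ m z) (X ω)) (announcements (hist m p.2))
  have hg : ∀ ω, Measurable[publicFiltration E X m] (g ω) := fun ω =>
    ((measurable_const.sub (hs.measurable_score ω (measurable_lastPrice y₀ m))).indicator
      hW).comp (comap_measurable _)
  have hB : ∀ ω p, |g ω p| ≤ ∑ ω, |a ω| + A := fun ω p => by
    refine (norm_indicator_le_norm_self (E := ℝ) _ _).trans ?_
    refine (abs_sub _ _).trans (add_le_add ?_ (hA _ _))
    exact Finset.single_le_sum (f := fun ω => |a ω|) (fun _ _ => abs_nonneg _) (Finset.mem_univ ω)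
  calc gain σ y₀ θ s μ m W = ∫ p, g p.1 p ∂(gameLaw μ σ) :=
        (integral_gameLaw hμ σ (measurable_from_prod_countable_right fun ω =>
          ((hg ω).mono hm le_rfl).comp measurable_prodMk_left) fun p => hB p.1 p).symm
    _ = ∫ p, ∑ ω, publicBelief μ σ m p ω * g ω p ∂(gameLaw μ σ) :=
        integral_belief measurable_fst hm hg hB
    _ = _ := by
        rw [← integral_indicator (measurableSet_preimage (by fun_prop) hW)]
        refine integral_congr_ae (.of_forall fun p => ?_)
        by_cases hp : announcements (hist m p.2) ∈ W <;> simp [g, edge, hp]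

lemma IsGainBound.mul_measureReal_publicEvent_le {ε : ℕ → ℝ} (hε : IsGainBound κ s y₀ μ σ ε)
    (hs : IsScoringRule X s) (hμ : μ ∈ stdSimplex ℝ Ω) {m : ℕ} {i : Fin n} (hi : turn n m = i)
    (θ : Quotient (P.part i) → Plan κ X) {U : Set (Ω → ℝ)} (hU : MeasurableSet U)
    {Y : Set (predictions X)} (hY : MeasurableSet Y) {η : ℝ}
    (hη : ∀ γ ∈ U, ∀ y ∈ Y, η ≤ edge s X (fun ω => (θ (Quotient.mk _ ω)).value s ω) γ y) :
    η * (gameLaw μ σ).real (publicEvent y₀ μ σ U Y m) ≤ ε m := by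
  subst hi
  have := isProbabilityMeasure_gameLaw hμ σ
  obtain ⟨W, hW, hWeq⟩ := measurableSet_publicEvent (y₀ := y₀) (μ := μ) (σ := σ) hU hY m
  refine le_trans ?_ (hε m W hW θ)
  rw [gain_eq_setIntegral_edge hs hμ hW, hWeq]
  exact setIntegral_ge_of_const_le_real
    ((publicFiltration E X).le m _ (measurableSet_publicEvent hU hY m)) (measure_ne_top _ _)
    (fun p hp => hη _ hp.1 _ hp.2) (integrable_edge_publicBelief hs hμ _ m).integrableOn

end PublicBelief

section Aggregation

lemma exists_turn_eq {n : ℕ} [NeZero n] (i : Fin n) (J : ℕ) : ∃ m ≥ J, turn n m = i := by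
  refine ⟨i + n * J, ?_, ?_⟩
  · nlinarith [NeZero.one_le (n := n)]
  · ext
    simp [turn, Nat.mod_eq_of_lt i.2]

variable {Ω T : Type*} [Fintype Ω] [MeasurableSpace Ω] [MeasurableSingletonClass Ω]
  [MeasurableSpace T] {E : Set (Ω → ProbabilityMeasure T)} {X : Ω → ℝ} {n : ℕ} [NeZero n]
  {P : InfoStructure Ω n} {μ : Ω → ℝ} {σ : ∀ i, Strategy E X P i}

lemma ae_limitBelief_mem_knownValue (hμ : μ ∈ stdSimplex ℝ Ω)
    (hnull : ∀ γ ∈ stdSimplex ℝ Ω, (¬ ∃ x, ∀ ω, 0 < γ ω → X ω = x) →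
      ∃ U, IsOpen U ∧ γ ∈ U ∧ gameLaw μ σ (limitBelief μ σ ⁻¹' U) = 0) :
    ∀ᵐ p ∂(gameLaw μ σ), limitBelief μ σ p ∈ knownValue X (X p.1) := by
  have := isProbabilityMeasure_gameLaw hμ σ
  have hle := iSup_le (publicFiltration (Ω := Ω) E X).le
  have hunknown : gameLaw μ σ (limitBelief μ σ ⁻¹'
      {γ | γ ∈ stdSimplex ℝ Ω ∧ ¬ ∃ x, ∀ ω, 0 < γ ω → X ω = x}) = 0 := by
    refine Measure.preimage_null_of_map_null measurable_limitBelief.aemeasurable ?_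
    refine measure_null_of_locally_null _ fun γ hγ => ?_
    obtain ⟨U, hU, hγU, hU0⟩ := hnull γ hγ.1 hγ.2
    refine ⟨U, mem_nhdsWithin_of_mem_nhds (hU.mem_nhds hγU), ?_⟩
    rw [Measure.map_apply measurable_limitBelief hU.measurableSet, hU0]
  filter_upwards [measure_eq_zero_iff_ae_notMem.1 hunknown,
    belief_mem_stdSimplex (ρ := gameLaw μ σ) measurable_fst hle,
    belief_state_pos (ρ := gameLaw μ σ) measurable_fst hle] with p hp hps hpos
  obtain ⟨x, hx⟩ : ∃ x, ∀ ω, 0 < limitBelief μ σ p ω → X ω = x :=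
    not_not.1 fun h => hp ⟨hps, h⟩
  refine ⟨hps, fun ω hω => ?_⟩
  by_contra h0
  exact hω ((hx ω (lt_of_le_of_ne (hps.1 ω) (Ne.symm h0))).trans (hx _ hpos).symm)

lemma tendsto_measure_publicBelief_notMem (hμ : μ ∈ stdSimplex ℝ Ω)
    (hknown : ∀ᵐ p ∂(gameLaw μ σ), limitBelief μ σ p ∈ knownValue X (X p.1)) (ω : Ω)
    {U : Set (Ω → ℝ)} (hU : IsOpen U) (hsub : knownValue X (X ω) ⊆ U) :
    Tendsto (fun k => gameLaw μ σ {p | p.1 = ω ∧ publicBelief μ σ k p ∉ U}) atTop (𝓝 0) := by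
  have := isProbabilityMeasure_gameLaw hμ σ
  rw [← measure_empty (μ := gameLaw μ σ)]
  refine tendsto_measure_of_ae_tendsto_indicator_of_isFiniteMeasure atTop .empty (fun k => ?_) ?_
  · exact (measurable_fst (measurableSet_singleton ω)).inter
      (measurable_belief_pi ((publicFiltration E X).le k) hU.measurableSet.compl)
  · filter_upwards [tendsto_publicBelief hμ, hknown] with p hp hpk
    by_cases hpω : p.1 = ω
    · rw [hpω] at hpk
      filter_upwards [hp.eventually (hU.mem_nhds (hsub hpk))] with k (hk : publicBelief μ σ k p ∈ U)
      simp [hk]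
    · simp [hpω]

variable [MetricSpace T] [BorelSpace T] {κ : CostStructure E} {s : ℝ → ℝ → ℝ}
  {y₀ : predictions X} {ε : ℕ → ℝ}

lemma IsGainBound.exists_open_measure_limitBelief_eq_zero (hgain : IsGainBound κ s y₀ μ σ ε)
    (hε : Tendsto ε atTop (𝓝 0)) (hs : IsScoringRule X s) (hμ : μ ∈ stdSimplex ℝ Ω) {γ : Ω → ℝ}
    {i : Fin n} (θ : Quotient (P.part i) → Plan κ X)
    (hθ : ∀ y : predictions X, 0 < edge s X (fun ω => (θ (Quotient.mk _ ω)).value s ω) γ y) :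
    ∃ U, IsOpen U ∧ γ ∈ U ∧ gameLaw μ σ (limitBelief μ σ ⁻¹' U) = 0 := by
  have := isProbabilityMeasure_gameLaw hμ σ
  obtain ⟨η, hη, U, hU, hγU, hedge⟩ := exists_open_edge_ge hs
    (fun ω => (θ (Quotient.mk _ ω)).value s ω) (isCompact_singleton (x := γ)) isCompact_univ
    (by rintro _ rfl y -; exact hθ y)
  refine ⟨U, hU, hγU rfl, ?_⟩
  have hstay : ∀ J, gameLaw μ σ {p | ∀ m ≥ J, publicBelief μ σ m p ∈ U} = 0 := fun J => by
    by_contra hpos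
    have hreal : 0 < (gameLaw μ σ).real {p | ∀ m ≥ J, publicBelief μ σ m p ∈ U} :=
      ENNReal.toReal_pos hpos (measure_ne_top _ _)
    obtain ⟨M, hM⟩ := eventually_atTop.1 (hε.eventually (gt_mem_nhds (mul_pos hη hreal)))
    obtain ⟨m, hm, hmi⟩ := exists_turn_eq i (max J M)
    have hbound := hgain.mul_measureReal_publicEvent_le hs hμ hmi θ hU.measurableSet .univ hedge
    have hsmall := hM m (le_of_max_le_right hm)
    have hmono : (gameLaw μ σ).real {p | ∀ m ≥ J, publicBelief μ σ m p ∈ U} ≤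
        (gameLaw μ σ).real (publicEvent y₀ μ σ U Set.univ m) :=
      measureReal_mono fun p hp => ⟨hp m (le_of_max_le_left hm), trivial⟩
    nlinarith
  refine measure_mono_null_ae ?_ (measure_iUnion_null hstay)
  filter_upwards [tendsto_publicBelief hμ] with p hp hpU
  obtain ⟨J, hJ⟩ := eventually_atTop.1 (hp.eventually (hU.mem_nhds hpU))
  exact Set.mem_iUnion.2 ⟨J, hJ⟩

lemma IsGainBound.tendsto_measure_publicEvent (hgain : IsGainBound κ s y₀ μ σ ε)
    (hε : Tendsto ε atTop (𝓝 0)) (hs : IsScoringRule X s) (hμ : μ ∈ stdSimplex ℝ Ω)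
    (x : predictions X) {U : Set (Ω → ℝ)} (hU : MeasurableSet U)
    {Y : Set (predictions X)} (hY : MeasurableSet Y) {η : ℝ} (hη : 0 < η)
    (hedge : ∀ γ ∈ U, ∀ y ∈ Y, η ≤ edge s X (fun ω => s x (X ω)) γ y) :
    Tendsto (fun k => gameLaw μ σ (publicEvent y₀ μ σ U Y k)) atTop (𝓝 0) := by
  have := isProbabilityMeasure_gameLaw hμ σ
  have hzero : Tendsto (fun k => ENNReal.ofReal (ε k / η)) atTop (𝓝 0) := by
    simpa [Function.comp_def] using
      (ENNReal.continuous_ofReal.tendsto _).comp (hε.div_const η)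
  refine tendsto_of_tendsto_of_tendsto_of_le_of_le tendsto_const_nhds hzero
    (fun _ => zero_le) fun k => ?_
  have hbound := hgain.mul_measureReal_publicEvent_le hs hμ (m := k) rfl
    (fun _ => Plan.const κ x) hU hY (η := η) (by simpa using hedge)
  refine (ENNReal.le_ofReal_iff_toReal_le (measure_ne_top _ _) ?_).2 ?_
  · exact div_nonneg ((mul_nonneg hη.le measureReal_nonneg).trans hbound) hη.le
  · rwa [le_div_iff₀ hη, mul_comm]

lemma IsGainBound.tendsto_measure_price_far (hgain : IsGainBound κ s y₀ μ σ ε)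
    (hε : Tendsto ε atTop (𝓝 0)) (hs : IsScoringRule X s) (hμ : μ ∈ stdSimplex ℝ Ω)
    (hknown : ∀ᵐ p ∂(gameLaw μ σ), limitBelief μ σ p ∈ knownValue X (X p.1)) (ω : Ω)
    {δ : ℝ} (hδ : 0 < δ) :
    Tendsto (fun k => gameLaw μ σ {p | p.1 = ω ∧ δ ≤ dist (price (y₀ : ℝ) k p.2) (X ω)}) atTop
      (𝓝 0) := by
  let x : predictions X := ⟨X ω, mem_predictions X ω⟩
  let Y : Set (predictions X) := {y | δ ≤ dist (y : ℝ) (X ω)}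
  have hY : IsClosed Y := isClosed_le continuous_const (by fun_prop)
  obtain ⟨η, hη, U, hU, hsub, hedge⟩ := exists_open_edge_ge hs (fun ω => s x (X ω))
    (isCompact_knownValue X (X ω)) hY.isCompact fun γ hγ y (hy : δ ≤ dist (y : ℝ) (X ω)) => by
      have hne : (y : ℝ) ≠ expect γ X := by
        rw [expect_of_mem_knownValue hγ]
        exact dist_pos.1 (hδ.trans_le hy)
      simpa only [expect_of_mem_knownValue hγ] using hs.edge_pos hγ.1 hne
  have hsum := (tendsto_measure_publicBelief_notMem hμ hknown ω hU hsub).add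
    (hgain.tendsto_measure_publicEvent hε hs hμ x hU.measurableSet hY.measurableSet hη hedge)
  rw [add_zero] at hsum
  refine tendsto_of_tendsto_of_tendsto_of_le_of_le tendsto_const_nhds hsum
    (fun _ => zero_le) fun k => ?_
  refine (measure_mono fun p hp => ?_).trans (measure_union_le _ _)
  by_cases hpU : publicBelief μ σ k p ∈ U
  · have hprice := hp.2
    rw [price_eq_lastPrice] at hprice
    exact Or.inr ⟨hpU, hprice⟩
  · exact Or.inl ⟨hp.1, hpU⟩

lemma IsGainBound.aggregates (hgain : IsGainBound κ s y₀ μ σ ε) (hε : Tendsto ε atTop (𝓝 0))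
    (hs : IsScoringRule X s) (hμ : μ ∈ stdSimplex ℝ Ω)
    (hsep : ∀ γ ∈ stdSimplex ℝ Ω, (¬ ∃ x, ∀ ω, 0 < γ ω → X ω = x) →
      ∃ (i : Fin n) (θ : Quotient (P.part i) → Plan κ X), ∀ y : predictions X,
        0 < edge s X (fun ω => (θ (Quotient.mk _ ω)).value s ω) γ y) :
    Aggregates (y₀ : ℝ) μ σ := by
  have hknown := ae_limitBelief_mem_knownValue (σ := σ) hμ fun γ hγ hne => by
    obtain ⟨i, θ, hθ⟩ := hsep γ hγ hne
    exact hgain.exists_open_measure_limitBelief_eq_zero hε hs hμ θ hθ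
  rw [Aggregates, tendstoInMeasure_iff_dist]
  intro δ hδ
  have hsum := tendsto_finsetSum Finset.univ fun ω (_ : ω ∈ Finset.univ) =>
    hgain.tendsto_measure_price_far hε hs hμ hknown ω hδ
  rw [Finset.sum_const_zero] at hsum
  refine tendsto_of_tendsto_of_tendsto_of_le_of_le tendsto_const_nhds hsum
    (fun _ => zero_le) fun k => ?_
  refine (measure_mono fun p hp => ?_).trans (measure_biUnion_finset_le _ _)
  exact Set.mem_biUnion (Finset.mem_coe.2 (Finset.mem_univ p.1)) ⟨rfl, hp⟩

end Aggregation

section Posteriors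

variable {Ω : Type*} [Fintype Ω]

@[fun_prop]
lemma continuous_expect (Z : Ω → ℝ) : Continuous fun γ : Ω → ℝ => expect γ Z := by
  unfold expect
  fun_prop

section Projection

variable [Nonempty Ω] {X : Ω → ℝ}

/-- The admissible prediction closest to `y`. It makes an announcement out of a posterior mean,
which is admissible only almost surely. -/
def project (X : Ω → ℝ) (y : ℝ) : predictions X :=
  Set.projIcc _ _ ((mem_predictions X (Classical.arbitrary Ω)).1.trans
    (mem_predictions X (Classical.arbitrary Ω)).2) y

@[fun_prop]
lemma continuous_project : Continuous (project X) := by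
  unfold project
  exact continuous_projIcc

lemma project_of_mem {y : ℝ} (hy : y ∈ predictions X) : (project X y : ℝ) = y := by
  rw [project, Set.projIcc_of_mem _ hy]

end Projection

variable {S : Type*} [MeasurableSpace S] {γ : Ω → ℝ} {R : Ω → Measure S} {X : Ω → ℝ}

@[fun_prop]
lemma measurable_posterior : Measurable (posterior γ R) :=
  measurable_pi_lambda _ fun _ =>
    measurable_const.mul (Measure.measurable_rnDeriv _ _).ennreal_toReal

lemma absolutelyContinuous_marginal {ω : Ω} (h : 0 < γ ω) : R ω ≪ marginal γ R := by
  intro B hB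
  simp only [marginal, Measure.coe_finsetSum, Finset.sum_apply, Measure.smul_apply, smul_eq_mul,
    Finset.sum_eq_zero_iff, Finset.mem_univ, true_imp_iff, mul_eq_zero] at hB
  exact (hB ω).resolve_left (by simpa using h)

/-- The posterior mean of `X`, as an admissible prediction. -/
def posteriorMean [Nonempty Ω] (X : Ω → ℝ) (γ : Ω → ℝ) (R : Ω → Measure S) (τ : S) :
    predictions X :=
  project X (expect (posterior γ R τ) X)

lemma measurable_posteriorMean [Nonempty Ω] : Measurable (posteriorMean X γ R) :=
  (continuous_project.comp (continuous_expect X)).measurable.comp measurable_posterior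

variable [∀ ω, IsProbabilityMeasure (R ω)]

lemma measureReal_marginal (hγ : γ ∈ stdSimplex ℝ Ω) (B : Set S) :
    (marginal γ R).real B = ∑ ω, γ ω * (R ω).real B := by
  simp only [measureReal_def, marginal, Measure.coe_finsetSum, Finset.sum_apply,
    Measure.smul_apply, smul_eq_mul]
  rw [ENNReal.toReal_sum fun ω _ => ENNReal.mul_ne_top ENNReal.ofReal_ne_top (measure_ne_top _ _)]
  exact Finset.sum_congr rfl fun ω _ => by rw [ENNReal.toReal_mul, ENNReal.toReal_ofReal (hγ.1 ω)]

lemma isProbabilityMeasure_marginal (hγ : γ ∈ stdSimplex ℝ Ω) :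
    IsProbabilityMeasure (marginal γ R) := by
  rw [isProbabilityMeasure_iff_real, measureReal_marginal hγ]
  simpa using hγ.2

lemma integral_posterior_mul (hγ : γ ∈ stdSimplex ℝ Ω) (ω : Ω) (g : S → ℝ) :
    ∫ τ, posterior γ R τ ω * g τ ∂(marginal γ R) = γ ω * ∫ τ, g τ ∂(R ω) := by
  have := isProbabilityMeasure_marginal (R := R) hγ
  rcases (hγ.1 ω).eq_or_lt with h | h
  · simp [posterior, ← h]
  · have hdensity := integral_rnDeriv_smul (absolutelyContinuous_marginal (R := R) h) (f := g)
    simp only [posterior, mul_assoc, smul_eq_mul] at hdensity ⊢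
    rw [integral_const_mul, hdensity]

lemma setIntegral_posterior (hγ : γ ∈ stdSimplex ℝ Ω) (ω : Ω) {B : Set S}
    (hB : MeasurableSet B) :
    ∫ τ in B, posterior γ R τ ω ∂(marginal γ R) = γ ω * (R ω).real B := by
  have hind : B.indicator (fun τ => posterior γ R τ ω) =
      fun τ => posterior γ R τ ω * B.indicator 1 τ := by
    ext τ
    by_cases hτ : τ ∈ B <;> simp [hτ]
  rw [← integral_indicator hB, hind, integral_posterior_mul hγ, integral_indicator_one hB]

lemma integrable_posterior (hγ : γ ∈ stdSimplex ℝ Ω) (ω : Ω) :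
    Integrable (fun τ => posterior γ R τ ω) (marginal γ R) := by
  have := isProbabilityMeasure_marginal (R := R) hγ
  exact Measure.integrable_toReal_rnDeriv.const_mul _

lemma ae_posterior_mem_stdSimplex (hγ : γ ∈ stdSimplex ℝ Ω) :
    ∀ᵐ τ ∂(marginal γ R), posterior γ R τ ∈ stdSimplex ℝ Ω := by
  have := isProbabilityMeasure_marginal (R := R) hγ
  have hsum : (fun τ => ∑ ω, posterior γ R τ ω) =ᵐ[marginal γ R] fun _ => (1 : ℝ) := by
    refine Integrable.ae_eq_of_forall_setIntegral_eq _ _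
      (integrable_finsetSum _ fun ω _ => integrable_posterior hγ ω) (integrable_const _)
      fun B hB _ => ?_
    rw [integral_finsetSum _ fun ω _ => (integrable_posterior hγ ω).integrableOn]
    simp only [setIntegral_posterior hγ _ hB, setIntegral_const, smul_eq_mul, mul_one,
      measureReal_marginal hγ]
  filter_upwards [hsum] with τ hτ
  exact ⟨fun ω => mul_nonneg (hγ.1 ω) ENNReal.toReal_nonneg, hτ⟩

lemma ae_randomPosterior_mem_stdSimplex (hγ : γ ∈ stdSimplex ℝ Ω) :
    ∀ᵐ γ' ∂(randomPosterior γ R), γ' ∈ stdSimplex ℝ Ω :=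
  (ae_map_iff measurable_posterior.aemeasurable (isClosed_stdSimplex ℝ Ω).measurableSet).2
    (ae_posterior_mem_stdSimplex hγ)

variable {A : ℝ} {g : Ω → S → ℝ}

lemma integrable_sum_posterior_mul (hγ : γ ∈ stdSimplex ℝ Ω) (hg : ∀ ω, Measurable (g ω))
    (hA : ∀ ω τ, |g ω τ| ≤ A) :
    Integrable (fun τ => ∑ ω, posterior γ R τ ω * g ω τ) (marginal γ R) :=
  integrable_finsetSum _ fun ω _ => (integrable_posterior hγ ω).mul_bdd (c := A)
    (hg ω).aestronglyMeasurable (.of_forall (hA ω))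

lemma sum_integral_eq_integral_posterior (hγ : γ ∈ stdSimplex ℝ Ω) (hg : ∀ ω, Measurable (g ω))
    (hA : ∀ ω τ, |g ω τ| ≤ A) :
    ∑ ω, γ ω * ∫ τ, g ω τ ∂(R ω) = ∫ τ, ∑ ω, posterior γ R τ ω * g ω τ ∂(marginal γ R) := by
  rw [integral_finsetSum _ fun ω _ => (integrable_posterior hγ ω).mul_bdd (c := A)
    (hg ω).aestronglyMeasurable (.of_forall (hA ω))]
  exact Finset.sum_congr rfl fun ω _ => (integral_posterior_mul hγ ω _).symm

variable [Nonempty Ω] {s : ℝ → ℝ → ℝ}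

lemma integral_randomPosterior_score_sub (hs : IsScoringRule X s) (hγ : γ ∈ stdSimplex ℝ Ω)
    (b : Ω → ℝ) :
    ∫ γ', ∑ ω, γ' ω * (s (expect γ' X) (X ω) - b ω) ∂(randomPosterior γ R) =
      ∑ ω, γ ω * (∫ τ, s (posteriorMean X γ R τ) (X ω) ∂(R ω) - b ω) := by
  obtain ⟨A, -, hA⟩ := hs.exists_bound
  have hmean := fun ω =>
    hs.measurable_score ω (measurable_posteriorMean (X := X) (γ := γ) (R := R))
  have hmeas : Measurable fun γ' : Ω → ℝ =>
      ∑ ω, γ' ω * (s (project X (expect γ' X)) (X ω) - b ω) :=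
    Finset.measurable_sum _ fun ω _ => (measurable_pi_apply ω).mul <|
      (hs.measurable_score ω (continuous_project.comp (continuous_expect X)).measurable).sub_const _
  have hproj : (fun γ' : Ω → ℝ => ∑ ω, γ' ω * (s (expect γ' X) (X ω) - b ω))
      =ᵐ[randomPosterior γ R]
      fun γ' => ∑ ω, γ' ω * (s (project X (expect γ' X)) (X ω) - b ω) := by
    filter_upwards [ae_randomPosterior_mem_stdSimplex (R := R) hγ] with γ' hγ'
    rw [project_of_mem (expect_mem_predictions hγ')]
  have hbound : ∀ ω τ, |s (posteriorMean X γ R τ) (X ω) - b ω| ≤ A + ∑ ω, |b ω| := fun ω τ =>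
    (abs_sub _ _).trans <| add_le_add (hA _ _) <|
      Finset.single_le_sum (fun ω _ => abs_nonneg (b ω)) (Finset.mem_univ ω)
  rw [integral_congr_ae hproj, randomPosterior,
    integral_map measurable_posterior.aemeasurable hmeas.aestronglyMeasurable]
  refine (sum_integral_eq_integral_posterior hγ (fun ω => (hmean ω).sub_const _) hbound).symm.trans
    (Finset.sum_congr rfl fun ω _ => ?_)
  rw [integral_sub (.of_bound (hmean ω).aestronglyMeasurable A (.of_forall fun τ => hA _ _))
    (integrable_const _)]
  simp

lemma sum_integral_score_le_posteriorMean (hs : IsScoringRule X s) (hγ : γ ∈ stdSimplex ℝ Ω)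
    {a : S → predictions X} (ha : Measurable a) :
    ∑ ω, γ ω * ∫ τ, s (a τ) (X ω) ∂(R ω) ≤
      ∑ ω, γ ω * ∫ τ, s (posteriorMean X γ R τ) (X ω) ∂(R ω) := by
  obtain ⟨A, -, hA⟩ := hs.exists_bound
  have ha' := fun ω => hs.measurable_score ω ha
  have hmean := fun ω =>
    hs.measurable_score ω (measurable_posteriorMean (X := X) (γ := γ) (R := R))
  rw [sum_integral_eq_integral_posterior hγ ha' fun ω τ => hA _ _,
    sum_integral_eq_integral_posterior hγ hmean fun ω τ => hA _ _]
  refine integral_mono_ae (integrable_sum_posterior_mul hγ ha' fun ω τ => hA _ _)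
    (integrable_sum_posterior_mul hγ hmean fun ω τ => hA _ _) ?_
  filter_upwards [ae_posterior_mem_stdSimplex (R := R) hγ] with τ hτ
  have hedge := hs.edge_nonneg hτ (a τ)
  simp only [edge, mul_sub, Finset.sum_sub_distrib, sub_nonneg] at hedge
  simpa only [posteriorMean, project_of_mem (expect_mem_predictions hτ)] using hedge

end Posteriors

section Cells

variable {Ω : Type*} [Fintype Ω] {μ : Ω → ℝ} {r : Setoid Ω}

lemma condCell_congr {ω ω' : Ω} (h : r ω ω') : condCell μ r ω = condCell μ r ω' := by
  have hcell : {ω'' | r ω ω''} = {ω'' | r ω' ω''} := Set.ext fun ω'' =>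
    ⟨fun h' => r.trans (r.symm h) h', fun h' => r.trans h h'⟩
  unfold condCell
  rw [hcell]

lemma condCell_out (μ : Ω → ℝ) (r : Setoid Ω) (ω : Ω) :
    condCell μ r (Quotient.mk r ω).out = condCell μ r ω :=
  condCell_congr (Quotient.mk_out ω)

lemma condCell_mem_stdSimplex (hμ : μ ∈ stdSimplex ℝ Ω) {ω : Ω} (hω : 0 < μ ω) :
    condCell μ r ω ∈ stdSimplex ℝ Ω := by
  have hnonneg : ∀ ω', 0 ≤ {ω'' | r ω ω''}.indicator μ ω' :=
    Set.indicator_nonneg fun ω'' _ => hμ.1 ω''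
  have hpos : 0 < ∑ ω', {ω'' | r ω ω''}.indicator μ ω' := by
    refine Finset.sum_pos' (fun ω' _ => hnonneg ω') ⟨ω, Finset.mem_univ _, ?_⟩
    rwa [Set.indicator_of_mem (show ω ∈ {ω'' | r ω ω''} from r.refl ω)]
  refine ⟨fun ω' => div_nonneg (hnonneg ω') hpos.le, ?_⟩
  simp only [condCell]
  rw [← Finset.sum_div, div_self hpos.ne']

lemma mul_condCell_comm (μ : Ω → ℝ) (r : Setoid Ω) (ω ω' : Ω) :
    μ ω * condCell μ r ω ω' = μ ω' * condCell μ r ω' ω := by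
  by_cases h : r ω ω'
  · rw [condCell_congr (r.symm h)]
    simp only [condCell, Set.indicator_of_mem (show ω' ∈ {ω'' | r ω ω''} from h),
      Set.indicator_of_mem (show ω ∈ {ω'' | r ω ω''} from r.refl ω)]
    ring
  · have h' : ¬ r ω' ω := fun h' => h (r.symm h')
    simp [condCell, h, h']

lemma sum_mul_condCell (hμ : μ ∈ stdSimplex ℝ Ω) {G : Ω → Ω → ℝ}
    (hG : ∀ ω ω', r ω ω' → G ω = G ω') :
    ∑ ω, μ ω * ∑ ω', condCell μ r ω ω' * G ω ω' = ∑ ω, μ ω * G ω ω := by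
  have hswap : ∀ ω ω', μ ω * (condCell μ r ω ω' * G ω ω') =
      μ ω' * G ω' ω' * condCell μ r ω' ω := fun ω ω' => by
    by_cases h : r ω ω'
    · rw [← mul_assoc, mul_condCell_comm, hG ω ω' h]
      ring
    · have h' : ¬ r ω' ω := fun h' => h (r.symm h')
      simp [condCell, h, h']
  simp only [Finset.mul_sum, hswap]
  rw [Finset.sum_comm]
  refine Finset.sum_congr rfl fun ω _ => ?_
  rw [← Finset.mul_sum]
  rcases (hμ.1 ω).eq_or_lt with h | h
  · simp [← h]
  · rw [(condCell_mem_stdSimplex hμ h).2, mul_one]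

end Cells

section NetInfoValue

variable {Ω T : Type*} [Fintype Ω] [MeasurableSpace T] [MetricSpace T] [BorelSpace T]
  {E : Set (Ω → ProbabilityMeasure T)} {X : Ω → ℝ} {κ : CostStructure E} {s : ℝ → ℝ → ℝ}
  {γ : Ω → ℝ}

lemma Plan.sum_mul_value (θ : Plan κ X) (hγ : γ ∈ stdSimplex ℝ Ω) :
    ∑ ω, γ ω * θ.value s ω =
      ∑ ω, γ ω * ∫ τ, s (θ.announce τ) (X ω) ∂(law E θ.signal ω) -
        κ.c * (κ.K θ.signal).toReal := by
  simp only [Plan.value, mul_sub, Finset.sum_sub_distrib, ← Finset.sum_mul, hγ.2, one_mul]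

variable [Nonempty Ω]

/-- The plan of a Bayesian with belief `γ` who acquires the signal `R`: to announce the posterior
mean. -/
def Plan.bayes (X : Ω → ℝ) (γ : Ω → ℝ) (R : E) (hR : κ.K R ≠ ∞) : Plan κ X where
  signal := R
  announce := posteriorMean X γ (law E R)
  measurable_announce := measurable_posteriorMean
  cost_ne_top := hR

lemma netInfoValue_nonpos_iff (hs : IsScoringRule X s) (hγ : γ ∈ stdSimplex ℝ Ω) (R : E) :
    ((∫ γ', ∑ ω, γ' ω * (s (expect γ' X) (X ω) - s (expect γ X) (X ω))
        ∂(randomPosterior γ (law E R)) : ℝ) : EReal)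
      - ((ENNReal.ofReal κ.c * κ.K R : ℝ≥0∞) : EReal) ≤ 0 ↔
    ∀ hR : κ.K R ≠ ∞, ∑ ω, γ ω * (Plan.bayes X γ R hR).value s ω ≤
      ∑ ω, γ ω * s (expect γ X) (X ω) := by
  rw [integral_randomPosterior_score_sub hs hγ]
  by_cases hR : κ.K R = ∞
  · have hc : ENNReal.ofReal κ.c ≠ 0 := by simpa using κ.c_pos
    simp [hR, ENNReal.mul_top hc]
  · have hcost : ENNReal.ofReal κ.c * κ.K R ≠ ∞ := ENNReal.mul_ne_top ENNReal.ofReal_ne_top hR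
    rw [← EReal.coe_ennreal_toReal hcost, ← EReal.coe_sub, ENNReal.toReal_mul,
      ENNReal.toReal_ofReal κ.c_pos.le, EReal.coe_nonpos]
    simp only [ne_eq, hR, not_false_eq_true, forall_true_left]
    rw [Plan.sum_mul_value _ hγ]
    simp only [Plan.bayes, mul_sub, Finset.sum_sub_distrib]
    constructor <;> intro h <;> linarith

end NetInfoValue

section CellPlans

variable {Ω : Type*} [Fintype Ω] {X : Ω → ℝ} {γ : Ω → ℝ} {r : Setoid Ω}

lemma eq_expect_of_expect_condCell_eq (hγ : γ ∈ stdSimplex ℝ Ω) {y : ℝ}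
    (h : ∀ ω, 0 < γ ω → expect (condCell γ r ω) X = y) : y = expect γ X := by
  have hmul : ∀ ω, γ ω * ∑ ω', condCell γ r ω ω' * X ω' = γ ω * y := fun ω => by
    rcases (hγ.1 ω).eq_or_lt with hω | hω
    · simp [← hω]
    · rw [← h ω hω, expect]
  calc y = ∑ ω, γ ω * y := by rw [← Finset.sum_mul, hγ.2, one_mul]
    _ = expect γ X := by
      rw [expect, ← sum_mul_condCell hγ (r := r) (G := fun _ => X) fun _ _ _ => rfl]
      exact Finset.sum_congr rfl fun ω _ => (hmul ω).symm

variable {s : ℝ → ℝ → ℝ} {V : Quotient r → Ω → ℝ} {y : predictions X}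

lemma edge_eq_sum_edge_condCell (hγ : γ ∈ stdSimplex ℝ Ω) (V : Quotient r → Ω → ℝ)
    (y : predictions X) :
    edge s X (fun ω => V (Quotient.mk r ω) ω) γ y =
      ∑ ω, γ ω * edge s X (V (Quotient.mk r ω)) (condCell γ r ω) y :=
  (sum_mul_condCell hγ (G := fun ω ω' => V (Quotient.mk r ω) ω' - s y (X ω'))
    fun ω ω' h => by rw [Quotient.sound h]).symm

lemma edge_pos_of_condCell (hγ : γ ∈ stdSimplex ℝ Ω)
    (hnonneg : ∀ ω, 0 < γ ω → 0 ≤ edge s X (V (Quotient.mk r ω)) (condCell γ r ω) y)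
    (hpos : ∃ ω, 0 < γ ω ∧ 0 < edge s X (V (Quotient.mk r ω)) (condCell γ r ω) y) :
    0 < edge s X (fun ω => V (Quotient.mk r ω) ω) γ y := by
  obtain ⟨ω, hω, hlt⟩ := hpos
  rw [edge_eq_sum_edge_condCell hγ]
  refine Finset.sum_pos' (fun ω' _ => ?_) ⟨ω, Finset.mem_univ _, mul_pos hω hlt⟩
  rcases (hγ.1 ω').eq_or_lt with h | h
  · simp [← h]
  · exact mul_nonneg h.le (hnonneg ω' h)

variable {T : Type*} [Nonempty Ω] [MeasurableSpace T] [MetricSpace T] [BorelSpace T]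
  {E : Set (Ω → ProbabilityMeasure T)} {κ : CostStructure E}

/-- For each cell of `r`, the plan to acquire nothing and announce the conditional mean of `X`. -/
def cellMeanPlan (κ : CostStructure E) (X γ : Ω → ℝ) (r : Setoid Ω) (q : Quotient r) : Plan κ X :=
  Plan.const κ (project X (expect (condCell γ r q.out) X))

lemma edge_cellMeanPlan (hγ : γ ∈ stdSimplex ℝ Ω) (y : predictions X) {ω : Ω} (hω : 0 < γ ω) :
    edge s X ((cellMeanPlan κ X γ r (Quotient.mk r ω)).value s) (condCell γ r ω) y =
      edge s X (fun ω' => s (expect (condCell γ r ω) X) (X ω')) (condCell γ r ω) y := by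
  simp only [cellMeanPlan, edge, Plan.value_const, condCell_out,
    project_of_mem (expect_mem_predictions (condCell_mem_stdSimplex hγ hω))]

lemma edge_cellMeanPlan_nonneg (hs : IsScoringRule X s) (hγ : γ ∈ stdSimplex ℝ Ω)
    (y : predictions X) {ω : Ω} (hω : 0 < γ ω) :
    0 ≤ edge s X ((cellMeanPlan κ X γ r (Quotient.mk r ω)).value s) (condCell γ r ω) y := by
  rw [edge_cellMeanPlan hγ y hω]
  exact hs.edge_nonneg (condCell_mem_stdSimplex hγ hω) y

lemma edge_cellMeanPlan_pos (hs : IsScoringRule X s) (hγ : γ ∈ stdSimplex ℝ Ω)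
    {ω₀ : Ω} (hω₀ : 0 < γ ω₀) (hne : expect (condCell γ r ω₀) X ≠ expect γ X)
    (y : predictions X) :
    0 < edge s X (fun ω => (cellMeanPlan κ X γ r (Quotient.mk r ω)).value s ω) γ y := by
  obtain ⟨ω, hω, hy⟩ : ∃ ω, 0 < γ ω ∧ (y : ℝ) ≠ expect (condCell γ r ω) X := by
    by_contra! h
    exact hne ((h ω₀ hω₀).symm.trans (eq_expect_of_expect_condCell_eq hγ fun ω hω => (h ω hω).symm))
  refine edge_pos_of_condCell (V := fun q => (cellMeanPlan κ X γ r q).value s) hγ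
    (fun ω' => edge_cellMeanPlan_nonneg hs hγ y) ⟨ω, hω, ?_⟩
  rw [edge_cellMeanPlan hγ y hω]
  exact hs.edge_pos (condCell_mem_stdSimplex hγ hω) hy

open scoped Classical in
lemma edge_update_cellMeanPlan_pos (hs : IsScoringRule X s) (hγ : γ ∈ stdSimplex ℝ Ω)
    {ω₀ : Ω} (hω₀ : 0 < γ ω₀) {θ : Plan κ X}
    (hθ : ∑ ω, condCell γ r ω₀ ω * s (expect (condCell γ r ω₀) X) (X ω) <
      ∑ ω, condCell γ r ω₀ ω * θ.value s ω) (y : predictions X) :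
    0 < edge s X (fun ω => (Function.update (cellMeanPlan κ X γ r) (Quotient.mk r ω₀) θ
      (Quotient.mk r ω)).value s ω) γ y := by
  have hcell : 0 < edge s X (θ.value s) (condCell γ r ω₀) y := by
    have hedge := hs.edge_nonneg (condCell_mem_stdSimplex (r := r) hγ hω₀) y
    simp only [edge, mul_sub, Finset.sum_sub_distrib] at hedge ⊢
    linarith
  refine edge_pos_of_condCell (V := fun q =>
    (Function.update (cellMeanPlan κ X γ r) (Quotient.mk r ω₀) θ q).value s) hγ (fun ω hω => ?_)
    ⟨ω₀, hω₀, by rwa [Function.update_self]⟩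
  by_cases h : Quotient.mk r ω = Quotient.mk r ω₀
  · rw [h, Function.update_self, condCell_congr (Quotient.exact h)]
    exact hcell.le
  · rw [Function.update_of_ne h]
    exact edge_cellMeanPlan_nonneg hs hγ y hω

lemma KappaSeparable.exists_plan {n : ℕ} {P : InfoStructure Ω n} (hs : IsScoringRule X s)
    (hsep : KappaSeparable κ P X s) (hγ : γ ∈ stdSimplex ℝ Ω)
    (hne : ¬ ∃ x, ∀ ω, 0 < γ ω → X ω = x) :
    ∃ (i : Fin n) (θ : Quotient (P.part i) → Plan κ X), ∀ y : predictions X,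
      0 < edge s X (fun ω => (θ (Quotient.mk _ ω)).value s ω) γ y := by
  classical
  by_cases hns : NonSeparableAt P X γ
  · have hinfo : ¬ NoInfoAcquisition κ P X s γ := fun h =>
      hsep ⟨γ, hγ, hns, fun s' hs' => by rwa [Set.mem_singleton_iff.1 hs']⟩
    simp only [NoInfoAcquisition, not_forall] at hinfo
    obtain ⟨ω₀, hω₀, i, R, hR⟩ := hinfo
    rw [netInfoValue_nonpos_iff hs (condCell_mem_stdSimplex hγ hω₀)] at hR
    push Not at hR
    obtain ⟨hRK, hR⟩ := hR
    exact ⟨i, _, edge_update_cellMeanPlan_pos hs hγ hω₀ hR⟩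
  · have hmean : ∃ ω, 0 < γ ω ∧ X ω ≠ expect γ X := by
      by_contra! h
      exact hne ⟨_, h⟩
    obtain ⟨i, ω₀, hω₀, hcell⟩ :
        ∃ i ω, 0 < γ ω ∧ expect (condCell γ (P.part i) ω) X ≠ expect γ X := by
      by_contra! h
      exact hns ⟨_, hmean, h⟩
    exact ⟨i, _, edge_cellMeanPlan_pos hs hγ hω₀ hcell⟩

end CellPlans

lemma exists_measurable_nat_forall_mem {α : Type*} [MeasurableSpace α] {S : Set α}
    (hS : MeasurableSet S) {p : α → ℕ → Prop} (hp : ∀ k, MeasurableSet {x | p x k})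
    (hex : ∀ x ∈ S, ∃ k, p x k) : ∃ N : α → ℕ, Measurable N ∧ ∀ x ∈ S, p x (N x) := by
  classical
  have hex' : ∀ x, ∃ k, x ∈ S → p x k := fun x => by
    by_cases hx : x ∈ S
    · exact (hex x hx).imp fun k hk _ => hk
    · exact ⟨0, fun h => absurd h hx⟩
  refine ⟨fun x => Nat.find (hex' x), measurable_find hex' fun k => ?_,
    fun x => Nat.find_spec (hex' x)⟩
  have hset : {x | x ∈ S → p x k} = Sᶜ ∪ {x | p x k} := Set.ext fun x => imp_iff_not_or
  rw [hset]
  exact hS.compl.union (hp k)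

section OptimalValue

variable {Ω T : Type*} [MeasurableSpace T] [MetricSpace T] [BorelSpace T]
  {E : Set (Ω → ProbabilityMeasure T)} {X : Ω → ℝ} {κ : CostStructure E} {s : ℝ → ℝ → ℝ}

lemma Plan.cost_nonneg (θ : Plan κ X) : 0 ≤ κ.c * (κ.K θ.signal).toReal :=
  mul_nonneg κ.c_pos.le ENNReal.toReal_nonneg

instance [Finite Ω] [Nonempty Ω] : Nonempty (Plan κ X) :=
  ⟨Plan.const κ ⟨X (Classical.arbitrary Ω), mem_predictions X _⟩⟩

variable [Fintype Ω]

/-- The maximal expected score, net of costs, that a plan gives at the belief `γ`. -/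
def optimalValue (κ : CostStructure E) (X : Ω → ℝ) (s : ℝ → ℝ → ℝ) (γ : Ω → ℝ) : ℝ :=
  ⨆ θ : Plan κ X, ∑ ω, γ ω * θ.value s ω

variable {A : ℝ} {γ γ' : Ω → ℝ}

lemma Plan.sum_mul_value_add_cost_le (hA : ∀ (y : predictions X) (ω : Ω), |s y (X ω)| ≤ A)
    (θ : Plan κ X) (hγ : γ ∈ stdSimplex ℝ Ω) :
    ∑ ω, γ ω * θ.value s ω + κ.c * (κ.K θ.signal).toReal ≤ A := by
  rw [θ.sum_mul_value hγ, sub_add_cancel]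
  exact (abs_le.1 (abs_sum_mul_le hγ fun ω => θ.abs_integral_le hA ω)).2

lemma Plan.sum_mul_value_le (hA : ∀ (y : predictions X) (ω : Ω), |s y (X ω)| ≤ A)
    (θ : Plan κ X) (hγ : γ ∈ stdSimplex ℝ Ω) : ∑ ω, γ ω * θ.value s ω ≤ A :=
  (le_add_of_nonneg_right θ.cost_nonneg).trans (θ.sum_mul_value_add_cost_le hA hγ)

lemma Plan.sum_mul_value_le_optimalValue (hs : IsScoringRule X s) (θ : Plan κ X)
    (hγ : γ ∈ stdSimplex ℝ Ω) : ∑ ω, γ ω * θ.value s ω ≤ optimalValue κ X s γ := by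
  obtain ⟨A, -, hA⟩ := hs.exists_bound
  refine le_ciSup (f := fun θ : Plan κ X => ∑ ω, γ ω * θ.value s ω) ⟨A, ?_⟩ θ
  rintro _ ⟨θ, rfl⟩
  exact θ.sum_mul_value_le hA hγ

lemma Plan.sum_mul_value_le_add (hA : ∀ (y : predictions X) (ω : Ω), |s y (X ω)| ≤ A)
    (θ : Plan κ X) (hγ : γ ∈ stdSimplex ℝ Ω) (hγ' : γ' ∈ stdSimplex ℝ Ω) :
    ∑ ω, γ ω * θ.value s ω ≤ ∑ ω, γ' ω * θ.value s ω + A * ∑ ω, |γ ω - γ' ω| := by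
  rw [θ.sum_mul_value hγ, θ.sum_mul_value hγ', sub_add_eq_add_sub]
  refine sub_le_sub_right ?_ _
  rw [Finset.mul_sum, ← Finset.sum_add_distrib]
  refine Finset.sum_le_sum fun ω _ => ?_
  rw [← sub_le_iff_le_add', ← sub_mul]
  refine (le_abs_self _).trans ?_
  rw [abs_mul, mul_comm]
  exact mul_le_mul_of_nonneg_right (θ.abs_integral_le hA ω) (abs_nonneg _)

variable [Nonempty Ω]

lemma optimalValue_le (hA : ∀ (y : predictions X) (ω : Ω), |s y (X ω)| ≤ A)
    (hγ : γ ∈ stdSimplex ℝ Ω) : optimalValue κ X s γ ≤ A :=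
  ciSup_le fun θ => θ.sum_mul_value_le hA hγ

lemma neg_le_optimalValue (hs : IsScoringRule X s)
    (hA : ∀ (y : predictions X) (ω : Ω), |s y (X ω)| ≤ A) (hγ : γ ∈ stdSimplex ℝ Ω) :
    -A ≤ optimalValue κ X s γ := by
  refine le_trans ?_ ((Plan.const κ (project X 0)).sum_mul_value_le_optimalValue hs hγ)
  simp only [Plan.value_const]
  exact (abs_le.1 (abs_sum_mul_le hγ fun ω => hA _ ω)).1

lemma optimalValue_le_add (hs : IsScoringRule X s)
    (hA : ∀ (y : predictions X) (ω : Ω), |s y (X ω)| ≤ A) (hγ : γ ∈ stdSimplex ℝ Ω)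
    (hγ' : γ' ∈ stdSimplex ℝ Ω) :
    optimalValue κ X s γ ≤ optimalValue κ X s γ' + A * ∑ ω, |γ ω - γ' ω| :=
  ciSup_le fun θ => (θ.sum_mul_value_le_add hA hγ hγ').trans
    (add_le_add_left (θ.sum_mul_value_le_optimalValue hs hγ') _)

lemma exists_measurable_selection (hs : IsScoringRule X s)
    (hA : ∀ (y : predictions X) (ω : Ω), |s y (X ω)| ≤ A) {ε : ℝ} (hε : 0 < ε) :
    ∃ (θ : ℕ → Plan κ X) (N : (Ω → ℝ) → ℕ), Measurable N ∧
      (∀ k, κ.c * (κ.K (θ k).signal).toReal ≤ 2 * A + ε) ∧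
      ∀ γ ∈ stdSimplex ℝ Ω, optimalValue κ X s γ ≤ ∑ ω, γ ω * (θ (N γ)).value s ω + ε := by
  classical
  have : Nonempty (stdSimplex ℝ Ω) := ⟨_, single_mem_stdSimplex ℝ (Classical.arbitrary Ω)⟩
  let d : ℕ → stdSimplex ℝ Ω := TopologicalSpace.denseSeq _
  choose θ hθ using fun k => exists_lt_of_lt_ciSup (show optimalValue κ X s (d k).1 - ε / 2 <
    ⨆ θ : Plan κ X, ∑ ω, (d k).1 ω * θ.value s ω from sub_lt_self _ (half_pos hε))
  have hdense : ∀ γ ∈ stdSimplex ℝ Ω, ∃ k, 2 * A * ∑ ω, |γ ω - (d k).1 ω| < ε / 2 := fun γ hγ => by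
    have hopen : IsOpen {x : stdSimplex ℝ Ω | 2 * A * ∑ ω, |γ ω - x.1 ω| < ε / 2} :=
      (isOpen_lt (f := fun f : Ω → ℝ => 2 * A * ∑ ω, |γ ω - f ω|) (by fun_prop)
        continuous_const).preimage continuous_subtype_val
    exact (TopologicalSpace.denseRange_denseSeq _).exists_mem_open hopen
      ⟨⟨γ, hγ⟩, by simpa using hε⟩
  obtain ⟨N, hN, hNd⟩ := exists_measurable_nat_forall_mem (isClosed_stdSimplex ℝ Ω).measurableSet
    (fun k => (isOpen_lt (by fun_prop) continuous_const).measurableSet) hdense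
  refine ⟨θ, N, hN, fun k => ?_, fun γ hγ => ?_⟩
  · have hupper := (θ k).sum_mul_value_add_cost_le hA (d k).2
    have hlower := neg_le_optimalValue (κ := κ) hs hA (d k).2
    linarith [hθ k]
  · have hvalue := optimalValue_le_add (κ := κ) hs hA hγ (d (N γ)).2
    have hplan := (θ (N γ)).sum_mul_value_le_add hA (d (N γ)).2 hγ
    simp only [abs_sub_comm ((d (N γ)).1 _)] at hplan
    linarith [hθ (N γ), hNd γ hγ]

lemma NoInfoAcquisition.optimalValue_le {n : ℕ} {P : InfoStructure Ω n} (hs : IsScoringRule X s)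
    {μ : Ω → ℝ} (hμ : μ ∈ stdSimplex ℝ Ω) (hno : NoInfoAcquisition κ P X s μ) {ω : Ω}
    (hω : 0 < μ ω) (i : Fin n) :
    optimalValue κ X s (condCell μ (P.part i) ω) ≤
      ∑ ω', condCell μ (P.part i) ω ω' *
        s (expect (condCell μ (P.part i) ω) X) (X ω') := by
  have hν := condCell_mem_stdSimplex (r := P.part i) hμ hω
  refine ciSup_le fun θ => le_trans ?_
    ((netInfoValue_nonpos_iff hs hν θ.signal).1 (hno ω hω i θ.signal) θ.cost_ne_top)
  rw [Plan.sum_mul_value _ hν, Plan.sum_mul_value _ hν]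
  exact sub_le_sub_right (sum_integral_score_le_posteriorMean hs hν θ.measurable_announce) _

end OptimalValue

section SequentialPlans

lemma integral_marginal {Ω S : Type*} [Fintype Ω] [MeasurableSpace S] {γ : Ω → ℝ}
    {R : Ω → Measure S} (hγ : ∀ ω, 0 ≤ γ ω) {g : S → ℝ} (hg : ∀ ω, Integrable g (R ω)) :
    ∫ τ, g τ ∂(marginal γ R) = ∑ ω, γ ω * ∫ τ, g τ ∂(R ω) := by
  rw [marginal, integral_finsetSum_measure fun ω _ => (hg ω).smul_measure ENNReal.ofReal_ne_top]
  exact Finset.sum_congr rfl fun ω _ => by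
    rw [integral_smul_measure, ENNReal.toReal_ofReal (hγ ω), smul_eq_mul]

lemma sum_integral_posteriorMean_congr {Ω S S' : Type*} [Fintype Ω] [Nonempty Ω]
    [MeasurableSpace S] [MeasurableSpace S'] {X γ : Ω → ℝ} {s : ℝ → ℝ → ℝ} {R : Ω → Measure S}
    {R' : Ω → Measure S'} [∀ ω, IsProbabilityMeasure (R ω)] [∀ ω, IsProbabilityMeasure (R' ω)]
    (hs : IsScoringRule X s) (hγ : γ ∈ stdSimplex ℝ Ω)
    (h : randomPosterior γ R = randomPosterior γ R') :
    ∑ ω, γ ω * ∫ τ, s (posteriorMean X γ R τ) (X ω) ∂(R ω) =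
      ∑ ω, γ ω * ∫ τ, s (posteriorMean X γ R' τ) (X ω) ∂(R' ω) := by
  have hR := integral_randomPosterior_score_sub (R := R) hs hγ fun _ => 0
  have hR' := integral_randomPosterior_score_sub (R := R') hs hγ fun _ => 0
  rw [h, hR'] at hR
  simpa only [sub_zero] using hR.symm

variable {Ω T : Type*} [MeasurableSpace T] [MetricSpace T] [BorelSpace T]
  {E : Set (Ω → ProbabilityMeasure T)} {X : Ω → ℝ} {κ : CostStructure E} {s : ℝ → ℝ → ℝ}

instance (R : E) (F : T → E) (hF : Measurable F) (ω : Ω) :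
    IsProbabilityMeasure (sequential R F hF ω) := by
  unfold sequential
  infer_instance

variable {θ : ℕ → Plan κ X} {N : T → ℕ} {D : ℝ}

lemma measurable_signal_comp (θ : ℕ → Plan κ X) (hN : Measurable N) :
    Measurable fun τ => (θ (N τ)).signal :=
  (measurable_from_nat (f := fun k => (θ k).signal)).comp hN

lemma measurable_announce_comp (hN : Measurable N) :
    Measurable fun z : T × T => (θ (N z.1)).announce z.2 :=
  (measurable_from_prod_countable_right (f := fun q : ℕ × T => (θ q.1).announce q.2)
    fun k => (θ k).measurable_announce).comp ((hN.comp measurable_fst).prodMk measurable_snd)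

lemma integrable_cost_comp (hN : Measurable N)
    (hD : ∀ k, κ.c * (κ.K (θ k).signal).toReal ≤ D) (R : E) (ω : Ω) :
    Integrable (fun τ => κ.c * (κ.K (θ (N τ)).signal).toReal) (law E R ω) :=
  .of_bound ((measurable_from_nat (f := fun k => κ.c * (κ.K (θ k).signal).toReal)).comp
    hN).aestronglyMeasurable D
    (.of_forall fun τ => by rw [Real.norm_of_nonneg (θ _).cost_nonneg]; exact hD _)

variable [Fintype Ω] {γ : Ω → ℝ}

lemma integral_value_comp (hs : IsScoringRule X s) (hN : Measurable N)
    (hD : ∀ k, κ.c * (κ.K (θ k).signal).toReal ≤ D) (R : E) (ω : Ω) :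
    ∫ τ, (θ (N τ)).value s ω ∂(law E R ω) =
      ∫ z, s ((θ (N z.1)).announce z.2) (X ω)
        ∂(sequential R _ (measurable_signal_comp θ hN) ω) -
        ∫ τ, κ.c * (κ.K (θ (N τ)).signal).toReal ∂(law E R ω) := by
  obtain ⟨A, -, hA⟩ := hs.exists_bound
  have hint : Integrable (fun z : T × T => s ((θ (N z.1)).announce z.2) (X ω))
      (law E R ω ⊗ₘ (realize E ω).comap _ (measurable_signal_comp θ hN)) :=
    .of_bound (hs.measurable_score ω (measurable_announce_comp hN)).aestronglyMeasurable A
      (.of_forall fun z => hA _ _)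
  rw [sequential, Measure.integral_compProd hint, ← integral_sub _ (integrable_cost_comp hN hD R ω)]
  · rfl
  · exact Integrable.integral_compProd (κ := Kernel.const Unit (law E R ω))
      (η := Kernel.prodMkLeft Unit ((realize E ω).comap _ (measurable_signal_comp θ hN)))
      (a := ()) hint

lemma lintegral_cost_comp_ne_top (hγ : γ ∈ stdSimplex ℝ Ω)
    (hD : ∀ k, κ.c * (κ.K (θ k).signal).toReal ≤ D) (R : E) :
    ∫⁻ τ, κ.K (θ (N τ)).signal ∂(marginal γ (law E R)) ≠ ∞ := by
  have := isProbabilityMeasure_marginal (R := law E R) hγ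
  have hbound : ∀ τ, κ.K (θ (N τ)).signal ≤ ENNReal.ofReal (D / κ.c) := fun τ => by
    rw [← ENNReal.ofReal_toReal (θ _).cost_ne_top]
    exact ENNReal.ofReal_le_ofReal ((le_div_iff₀' κ.c_pos).2 (hD _))
  exact ((lintegral_mono hbound).trans_lt (by simp)).ne

lemma toReal_lintegral_cost_comp (hγ : γ ∈ stdSimplex ℝ Ω) (hN : Measurable N)
    (hD : ∀ k, κ.c * (κ.K (θ k).signal).toReal ≤ D) (R : E) :
    κ.c * (∫⁻ τ, κ.K (θ (N τ)).signal ∂(marginal γ (law E R))).toReal =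
      ∑ ω, γ ω * ∫ τ, κ.c * (κ.K (θ (N τ)).signal).toReal ∂(law E R ω) := by
  have hcost : Measurable fun τ => κ.K (θ (N τ)).signal :=
    (measurable_from_nat (f := fun k => κ.K (θ k).signal)).comp hN
  rw [← integral_marginal hγ.1 fun ω => integrable_cost_comp hN hD R ω, integral_const_mul,
    integral_toReal hcost.aemeasurable (.of_forall fun τ => (θ _).cost_ne_top.lt_top)]

variable [Nonempty Ω]

lemma OneSignalSuffices.sum_integral_value_comp_le (hOne : OneSignalSuffices κ)
    (hs : IsScoringRule X s) (hγ : γ ∈ stdSimplex ℝ Ω) (hN : Measurable N)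
    (hD : ∀ k, κ.c * (κ.K (θ k).signal).toReal ≤ D) {R : E} (hR : κ.K R ≠ ∞) :
    ∑ ω, γ ω * ∫ τ, (θ (N τ)).value s ω ∂(law E R ω) ≤
      optimalValue κ X s γ + κ.c * (κ.K R).toReal := by
  have hint := lintegral_cost_comp_ne_top (N := N) hγ hD R
  obtain ⟨R', hpost, hK⟩ := hOne γ hγ R _ (measurable_signal_comp θ hN)
  have hR' : κ.K R' ≠ ∞ := ne_top_of_le_ne_top (ENNReal.add_ne_top.2 ⟨hR, hint⟩) hK
  have hcost : κ.c * (κ.K R').toReal ≤ κ.c * (κ.K R).toReal +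
      ∑ ω, γ ω * ∫ τ, κ.c * (κ.K (θ (N τ)).signal).toReal ∂(law E R ω) := by
    rw [← toReal_lintegral_cost_comp hγ hN hD, ← mul_add, ← ENNReal.toReal_add hR hint]
    exact mul_le_mul_of_nonneg_left
      (ENNReal.toReal_mono (ENNReal.add_ne_top.2 ⟨hR, hint⟩) hK) κ.c_pos.le
  have hbest := sum_integral_score_le_posteriorMean hs hγ
    (R := sequential R _ (measurable_signal_comp θ hN)) (measurable_announce_comp (θ := θ) hN)
  rw [sum_integral_posteriorMean_congr hs hγ hpost] at hbest
  have hopt := (Plan.bayes X γ R' hR').sum_mul_value_le_optimalValue hs hγ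
  rw [Plan.sum_mul_value _ hγ] at hopt
  simp only [Plan.bayes] at hopt
  simp only [integral_value_comp hs hN hD, mul_sub, Finset.sum_sub_distrib]
  linarith

end SequentialPlans

section Domination

section Comparison

variable {Ω S : Type*} [Fintype Ω] [MeasurableSpace S] {γ : Ω → ℝ} {R : Ω → Measure S}
  [∀ ω, IsProbabilityMeasure (R ω)] {A B ε : ℝ} {g h : Ω → S → ℝ}

lemma sum_integral_le_add (hγ : γ ∈ stdSimplex ℝ Ω) (hg : ∀ ω, Measurable (g ω))
    (hA : ∀ ω τ, |g ω τ| ≤ A) (hh : ∀ ω, Measurable (h ω)) (hB : ∀ ω τ, |h ω τ| ≤ B)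
    (hle : ∀ᵐ τ ∂(marginal γ R),
      ∑ ω, posterior γ R τ ω * g ω τ ≤ ∑ ω, posterior γ R τ ω * h ω τ + ε) :
    ∑ ω, γ ω * ∫ τ, g ω τ ∂(R ω) ≤ ∑ ω, γ ω * ∫ τ, h ω τ ∂(R ω) + ε := by
  have := isProbabilityMeasure_marginal (R := R) hγ
  have hint := integrable_sum_posterior_mul (R := R) hγ hh hB
  calc ∑ ω, γ ω * ∫ τ, g ω τ ∂(R ω) = ∫ τ, ∑ ω, posterior γ R τ ω * g ω τ ∂(marginal γ R) :=
        sum_integral_eq_integral_posterior hγ hg hA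
    _ ≤ ∫ τ, (∑ ω, posterior γ R τ ω * h ω τ + ε) ∂(marginal γ R) :=
        integral_mono_ae (integrable_sum_posterior_mul hγ hg hA)
          (hint.add (integrable_const ε)) hle
    _ = ∑ ω, γ ω * ∫ τ, h ω τ ∂(R ω) + ε := by
        rw [integral_add hint (integrable_const ε), sum_integral_eq_integral_posterior hγ hh hB]
        simp

end Comparison

section TruncatedCost

variable {Ω T : Type*} [MeasurableSpace T] [MetricSpace T] [BorelSpace T]
  {E : Set (Ω → ProbabilityMeasure T)} {κ : CostStructure E} {L : ℝ}

/-- The cost of a signal, truncated at `L`. Unlike the cost it is a bounded real, and beyond the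
possible variation of the score the truncation does not matter for optimal plans. -/
def truncCost (κ : CostStructure E) (L : ℝ) (R : E) : ℝ := (min (κ.K R) (ENNReal.ofReal L)).toReal

lemma truncCost_nonneg (R : E) : 0 ≤ truncCost κ L R := ENNReal.toReal_nonneg

lemma abs_truncCost_le (hL : 0 ≤ L) (R : E) : |truncCost κ L R| ≤ L := by
  rw [abs_of_nonneg (truncCost_nonneg R)]
  exact (ENNReal.toReal_mono ENNReal.ofReal_ne_top (min_le_right _ _)).trans
    (ENNReal.toReal_ofReal hL).le

lemma ofReal_truncCost_le (R : E) : ENNReal.ofReal (truncCost κ L R) ≤ κ.K R := by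
  rw [truncCost, ENNReal.ofReal_toReal (min_lt_of_right_lt ENNReal.ofReal_lt_top).ne]
  exact min_le_left _ _

variable [SecondCountableTopology T] [Countable Ω]

@[fun_prop]
lemma measurable_truncCost : Measurable (truncCost κ L) :=
  (κ.measurable_K.min measurable_const).ennreal_toReal

end TruncatedCost

variable {Ω T : Type*} [Fintype Ω] [MeasurableSpace T] [MetricSpace T] [BorelSpace T]
  {E : Set (Ω → ProbabilityMeasure T)} {X : Ω → ℝ} {κ : CostStructure E} {s : ℝ → ℝ → ℝ}

/-- The beliefs concentrated on `C`. -/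
def face (C : Set Ω) : Set (Ω → ℝ) := stdSimplex ℝ Ω ∩ {γ | ∀ ω ∉ C, γ ω = 0}

/-- No belief concentrated on `C` expects more from the payoff `f` than from the best plan. This is
the invariant of the backward induction along the play: `f` is the continuation payoff, as a
function of the state, of a trader whose cell is `C`. -/
def IsDominatedOn (κ : CostStructure E) (X : Ω → ℝ) (s : ℝ → ℝ → ℝ) (C : Set Ω) (f : Ω → ℝ) :
    Prop :=
  ∀ γ ∈ face C, ∑ ω, γ ω * f ω ≤ optimalValue κ X s γ

variable {C : Set Ω} {f g : Ω → ℝ} {γ : Ω → ℝ} {A B L : ℝ}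

lemma ae_posterior_mem_face {S : Type*} [MeasurableSpace S] {R : Ω → Measure S}
    [∀ ω, IsProbabilityMeasure (R ω)] (hγ : γ ∈ face C) :
    ∀ᵐ τ ∂(marginal γ R), posterior γ R τ ∈ face C := by
  filter_upwards [ae_posterior_mem_stdSimplex (R := R) hγ.1] with τ hτ
  exact ⟨hτ, fun ω hω => by rw [posterior, hγ.2 ω hω, zero_mul]⟩

lemma IsScoringRule.isDominatedOn (hs : IsScoringRule X s) (y : predictions X) :
    IsDominatedOn κ X s C fun ω => s y (X ω) := fun γ hγ => by
  simpa only [Plan.value_const] using (Plan.const κ y).sum_mul_value_le_optimalValue hs hγ.1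

namespace IsDominatedOn

lemma congr (h : IsDominatedOn κ X s C f) (hfg : ∀ ω ∈ C, g ω = f ω) :
    IsDominatedOn κ X s C g := fun γ hγ => by
  refine (Finset.sum_congr rfl fun ω _ => ?_).trans_le (h γ hγ)
  by_cases hω : ω ∈ C
  · rw [hfg ω hω]
  · rw [hγ.2 ω hω, zero_mul, zero_mul]

lemma integral {α : Type*} [MeasurableSpace α] {ν : Measure α} [IsProbabilityMeasure ν]
    {F : Ω → α → ℝ} (hF : ∀ ω, Integrable (F ω) ν)
    (h : ∀ a, IsDominatedOn κ X s C fun ω => F ω a) :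
    IsDominatedOn κ X s C fun ω => ∫ a, F ω a ∂ν := fun γ hγ => by
  simp only [← integral_const_mul]
  rw [← integral_finsetSum _ fun ω _ => (hF ω).const_mul (γ ω)]
  refine (integral_mono (integrable_finsetSum _ fun ω _ => (hF ω).const_mul (γ ω))
    (integrable_const (optimalValue κ X s γ)) fun a => h a γ hγ).trans_eq ?_
  simp

variable [Nonempty Ω]

lemma le (h : IsDominatedOn κ X s C f) (hA : ∀ (y : predictions X) (ω : Ω), |s y (X ω)| ≤ A)
    {ω : Ω} (hω : ω ∈ C) : f ω ≤ A := by
  classical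
  have hmem : Pi.single ω 1 ∈ face C := ⟨single_mem_stdSimplex ℝ ω, fun ω' hω' =>
    Pi.single_eq_of_ne (ne_of_mem_of_not_mem hω hω').symm _⟩
  simpa [Pi.single_apply] using (h _ hmem).trans (optimalValue_le hA hmem.1)

variable {G : Ω → T → ℝ} (hOne : OneSignalSuffices κ) (hs : IsScoringRule X s)
  (hG : ∀ ω, Measurable (G ω)) (hB : ∀ ω τ, |G ω τ| ≤ B)
  (hdom : ∀ τ, IsDominatedOn κ X s C fun ω => G ω τ)
include hOne hs hG hB hdom

lemma sum_integral_le_optimalValue_add (hγ : γ ∈ face C) {R : E} (hR : κ.K R ≠ ∞) :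
    ∑ ω, γ ω * ∫ τ, G ω τ ∂(law E R ω) ≤ optimalValue κ X s γ + κ.c * (κ.K R).toReal := by
  obtain ⟨A, -, hA⟩ := hs.exists_bound
  refine le_of_forall_pos_le_add fun ε hε => ?_
  obtain ⟨θ, N, hN, hcost, hselect⟩ := exists_measurable_selection (κ := κ) hs hA hε
  have hN' : Measurable fun τ => N (posterior γ (law E R) τ) := hN.comp measurable_posterior
  have hvalue : ∀ k ω, |(θ k).value s ω| ≤ A + (2 * A + ε) := fun k ω =>
    (abs_sub _ _).trans <| add_le_add ((θ k).abs_integral_le hA ω) <|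
      (abs_of_nonneg (θ k).cost_nonneg).trans_le (hcost k)
  calc ∑ ω, γ ω * ∫ τ, G ω τ ∂(law E R ω)
      ≤ ∑ ω, γ ω * ∫ τ, (θ (N (posterior γ (law E R) τ))).value s ω ∂(law E R ω) + ε := by
        refine sum_integral_le_add hγ.1 hG hB
          (fun ω => (measurable_from_nat (f := fun k => (θ k).value s ω)).comp hN')
          (fun ω τ => hvalue _ ω) ?_
        filter_upwards [ae_posterior_mem_face hγ] with τ hτ
        exact (hdom τ _ hτ).trans (hselect _ hτ.1)
    _ ≤ optimalValue κ X s γ + κ.c * (κ.K R).toReal + ε := by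
        gcongr
        exact hOne.sum_integral_value_comp_le hs hγ.1 hN' hcost hR

/- If the cost exceeds the truncation level then `κ.c * L ≥ 2 * A` outweighs whatever can be gained,
because dominated payoffs are at most `A` and the optimal value is at least `-A`. -/
lemma integral_law_sub_truncCost (hA : ∀ (y : predictions X) (ω : Ω), |s y (X ω)| ≤ A)
    (hL : 0 ≤ L) (hAL : 2 * A ≤ κ.c * L) (R : E) :
    IsDominatedOn κ X s C fun ω => ∫ τ, G ω τ ∂(law E R ω) - κ.c * truncCost κ L R := fun γ hγ => by
  simp only [mul_sub, Finset.sum_sub_distrib, ← Finset.sum_mul, hγ.1.2, one_mul]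
  rcases le_or_gt (κ.K R) (ENNReal.ofReal L) with h | h
  · rw [truncCost, min_eq_left h, sub_le_iff_le_add]
    exact sum_integral_le_optimalValue_add hOne hs hG hB hdom hγ
      (ne_top_of_le_ne_top ENNReal.ofReal_ne_top h)
  · rw [truncCost, min_eq_right h.le, ENNReal.toReal_ofReal hL]
    have hupper : ∑ ω, γ ω * ∫ τ, G ω τ ∂(law E R ω) ≤ ∑ ω, γ ω * A := by
      refine Finset.sum_le_sum fun ω _ => ?_
      by_cases hω : ω ∈ C
      · refine mul_le_mul_of_nonneg_left ?_ (hγ.1.1 ω)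
        simpa using integral_mono (μ := law E R ω)
          (.of_bound (hG ω).aestronglyMeasurable B (.of_forall (hB ω))) (integrable_const A)
          fun τ => (hdom τ).le hA hω
      · rw [hγ.2 ω hω, zero_mul, zero_mul]
    rw [← Finset.sum_mul, hγ.1.2, one_mul] at hupper
    linarith [neg_le_optimalValue (κ := κ) hs hA hγ.1]

end IsDominatedOn

end Domination

section DynamicProgramming

variable {Ω T : Type*} [MeasurableSpace T] [MetricSpace T] [BorelSpace T]
  {E : Set (Ω → ProbabilityMeasure T)} {X : Ω → ℝ} {n : ℕ} [NeZero n]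
  {P : InfoStructure Ω n} {κ : CostStructure E} {s : ℝ → ℝ → ℝ} {σ : ∀ i, Strategy E X P i}
  {C : Set Ω} {A B L : ℝ} {k : ℕ}

lemma abs_sub_truncCost_le (hL : 0 ≤ L) {a : ℝ} (ha : |a| ≤ B) (R : E) :
    |a - κ.c * truncCost κ L R| ≤ B + κ.c * L := by
  refine (abs_sub _ _).trans (add_le_add ha ?_)
  rw [abs_mul, abs_of_pos κ.c_pos]
  exact mul_le_mul_of_nonneg_left (abs_truncCost_le hL R) κ.c_pos.le

variable [SecondCountableTopology T]

lemma integral_stepKernel_sub_truncCost [Countable Ω] (hL : 0 ≤ L) (ω : Ω)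
    (g : Fin k → Move E X) {F : Move E X → ℝ} (hF : Measurable F) (hB : ∀ x, |F x| ≤ B) :
    ∫ x, F x - κ.c * truncCost κ L x.1.1 ∂(stepKernel σ ω k g) =
      ∫ u : unitInterval, (∫ τ, F (resultingMove σ ω k (g, (u, τ)))
        ∂(law E (chosenSignal σ ω k (g, u)) ω) -
          κ.c * truncCost κ L (chosenSignal σ ω k (g, u))) := by
  rw [integral_stepKernel σ ω k g (by fun_prop) fun x => abs_sub_truncCost_le hL (hB x) _]
  refine integral_congr_ae (.of_forall fun u => ?_)
  have hmove : Measurable fun τ => resultingMove σ ω k (g, (u, τ)) :=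
    (measurable_resultingMove σ ω k).comp (by fun_prop)
  have hint : Integrable (fun τ => F (resultingMove σ ω k (g, (u, τ))))
      (law E (chosenSignal σ ω k (g, u)) ω) :=
    .of_bound (hF.comp hmove).aestronglyMeasurable B (.of_forall fun τ => hB _)
  simp only [resultingMove] at hint ⊢
  rw [integral_sub hint (integrable_const _), integral_const]
  simp

lemma integral_integral_stepKernel_sub_truncCost [Countable Ω] (hL : 0 ≤ L) (ω : Ω)
    {G : (Fin (k + 1) → Move E X) → ℝ} (hG : Measurable G) (hB : ∀ g, |G g| ≤ B) :
    ∫ h, ∫ x, G (Fin.snoc (α := fun _ => Move E X) (hist k h) x) - κ.c * truncCost κ L x.1.1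
        ∂(stepKernel σ ω k (hist k h)) ∂(playLaw σ ω) =
      ∫ h, G (hist (k + 1) h) ∂(playLaw σ ω) -
        κ.c * ∫ h, truncCost κ L (h k).1.1 ∂(playLaw σ ω) := by
  rw [← integral_playLaw_step σ ω k (F := fun p : (Fin k → Move E X) × Move E X =>
      G (Fin.snoc (α := fun _ => Move E X) p.1 p.2) - κ.c * truncCost κ L p.2.1.1)
    (by fun_prop) fun p => abs_sub_truncCost_le hL (hB _) _]
  simp only [← hist_succ]
  rw [integral_sub, integral_const_mul]
  · exact .of_bound (hG.comp (measurable_hist _)).aestronglyMeasurable B (.of_forall fun h => hB _)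
  · exact (Integrable.of_bound (Measurable.aestronglyMeasurable (by fun_prop)) L
      (.of_forall fun h => abs_truncCost_le hL _)).const_mul _

variable [Fintype Ω] [Nonempty Ω] (hOne : OneSignalSuffices κ) (hs : IsScoringRule X s)
  (hA : ∀ (y : predictions X) (ω : Ω), |s y (X ω)| ≤ A) (hL : 0 ≤ L) (hAL : 2 * A ≤ κ.c * L)
include hOne hs hA hL hAL

lemma IsDominatedOn.integral_stepKernel {ω₀ : Ω}
    (hsignal : ∀ ω ∈ C, chosenSignal σ ω k = chosenSignal σ ω₀ k)
    (hmove : ∀ ω ∈ C, resultingMove σ ω k = resultingMove σ ω₀ k) {F : Ω → Move E X → ℝ}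
    (hF : ∀ ω, Measurable (F ω)) (hB : ∀ ω x, |F ω x| ≤ B)
    (hdom : ∀ x, IsDominatedOn κ X s C fun ω => F ω x) (g : Fin k → Move E X) :
    IsDominatedOn κ X s C fun ω =>
      ∫ x, F ω x - κ.c * truncCost κ L x.1.1 ∂(stepKernel σ ω k g) := by
  let R : unitInterval → E := fun u => chosenSignal σ ω₀ k (g, u)
  have hR : Measurable R := (measurable_chosenSignal σ ω₀ k).comp measurable_prodMk_left
  let H : Ω → unitInterval × T → ℝ := fun ω p => F ω (resultingMove σ ω₀ k (g, p))
  have hH : ∀ ω, Measurable (H ω) := fun ω =>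
    (hF ω).comp ((measurable_resultingMove σ ω₀ k).comp measurable_prodMk_left)
  have hint : ∀ ω, Integrable (fun u => ∫ τ, H ω (u, τ) ∂(law E (R u) ω) -
      κ.c * truncCost κ L (R u)) (volume : Measure unitInterval) := fun ω =>
    (Integrable.of_bound (StronglyMeasurable.integral_kernel_prod_right
        (κ := (realize E ω).comap R hR) (f := fun u τ => H ω (u, τ))
        (hH ω).stronglyMeasurable).aestronglyMeasurable B
      (.of_forall fun u => abs_integral_le_of_forall_abs_le fun τ => hB ω _)).sub
    ((Integrable.of_bound (measurable_truncCost.comp hR).aestronglyMeasurable L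
      (.of_forall fun u => abs_truncCost_le hL _)).const_mul _)
  refine (IsDominatedOn.integral hint fun u => IsDominatedOn.integral_law_sub_truncCost hOne hs
    (fun ω => (hH ω).comp measurable_prodMk_left) (fun ω τ => hB ω _) (fun τ => hdom _)
    hA hL hAL (R u)).congr fun ω hω => ?_
  rw [integral_stepKernel_sub_truncCost hL ω g (hF ω) (hB ω), hsignal ω hω, hmove ω hω]

lemma IsDominatedOn.integral_playLaw {ω₀ : Ω}
    (hsignal : ∀ ω ∈ C, ∀ k, chosenSignal σ ω k = chosenSignal σ ω₀ k)
    (hmove : ∀ ω ∈ C, ∀ k, resultingMove σ ω k = resultingMove σ ω₀ k)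
    {G : Ω → (Fin k → Move E X) → ℝ} (hG : ∀ ω, Measurable (G ω)) (hB : ∀ ω g, |G ω g| ≤ B)
    (hdom : ∀ g, IsDominatedOn κ X s C fun ω => G ω g) :
    IsDominatedOn κ X s C fun ω => ∫ h, G ω (hist k h) ∂(playLaw σ ω) -
      κ.c * ∑ j ∈ Finset.range k, ∫ h, truncCost κ L (h j).1.1 ∂(playLaw σ ω) := by
  induction k generalizing B with
  | zero =>
    have hhist : ∀ h : ℕ → Move E X, hist 0 h = Fin.elim0 := fun h => Subsingleton.elim _ _
    simpa [hhist] using hdom Fin.elim0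
  | succ k ih =>
    let G' : Ω → (Fin k → Move E X) → ℝ := fun ω g =>
      ∫ x, G ω (Fin.snoc (α := fun _ => Move E X) g x) - κ.c * truncCost κ L x.1.1
        ∂(stepKernel σ ω k g)
    have hG' : ∀ ω, Measurable (G' ω) := fun ω =>
      (StronglyMeasurable.integral_kernel_prod_right (κ := stepKernel σ ω k)
        (f := fun g x => G ω (Fin.snoc (α := fun _ => Move E X) g x) - κ.c * truncCost κ L x.1.1)
        (Measurable.stronglyMeasurable (by have := hG ω; fun_prop))).measurable
    have hB' : ∀ ω g, |G' ω g| ≤ B + κ.c * L := fun ω g =>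
      abs_integral_le_of_forall_abs_le fun x => abs_sub_truncCost_le hL (hB ω _) _
    refine (ih hG' hB' fun g => IsDominatedOn.integral_stepKernel hOne hs hA hL hAL
      (F := fun ω x => G ω (Fin.snoc (α := fun _ => Move E X) g x))
      (fun ω hω => hsignal ω hω k) (fun ω hω => hmove ω hω k)
      (fun ω => (hG ω).comp ((measurable_snoc k).comp measurable_prodMk_left))
      (fun ω x => hB ω _) (fun x => hdom _) g).congr fun ω _ => ?_
    rw [integral_integral_stepKernel_sub_truncCost hL ω (hG ω) (hB ω), Finset.sum_range_succ]
    ring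

end DynamicProgramming

section Follow

variable {Ω T : Type*} [MeasurableSpace T]

section NotAggregates

variable {E : Set (Ω → ProbabilityMeasure T)} {X : Ω → ℝ} {n : ℕ} [NeZero n]
  {P : InfoStructure Ω n} [Fintype Ω] [MeasurableSpace Ω] {μ : Ω → ℝ} {σ : ∀ i, Strategy E X P i}

lemma ofReal_mul_playLaw_le_gameLaw (ω : Ω) (S : Set (Ω × (ℕ → Move E X))) :
    ENNReal.ofReal (μ ω) * playLaw σ ω (Prod.mk ω ⁻¹' S) ≤ gameLaw μ σ S := by
  rw [gameLaw, Measure.coe_finsetSum, Finset.sum_apply]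
  refine le_trans ?_ (Finset.single_le_sum (f := fun ω => (ENNReal.ofReal (μ ω) •
    (Measure.dirac ω).prod (playLaw σ ω)) S) (fun _ _ => zero_le) (Finset.mem_univ ω))
  rw [Measure.smul_apply, smul_eq_mul, Measure.dirac_prod]
  gcongr
  exact Measure.le_map_apply (by fun_prop) S

lemma not_aggregates_of_ae_price_eq {y₀ v : ℝ} {ω : Ω} (hω : 0 < μ ω) (hne : X ω ≠ v)
    (hprice : ∀ k, ∀ᵐ h ∂(playLaw σ ω), price y₀ (k + 1) h = v) : ¬ Aggregates y₀ μ σ := by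
  intro hagg
  have hlim := (tendsto_add_atTop_iff_nat 1).2 (hagg (edist v (X ω)) (edist_pos.2 hne.symm))
  refine (ge_of_tendsto' (b := ENNReal.ofReal (μ ω)) hlim fun k => ?_).not_gt
    (ENNReal.ofReal_pos.2 hω)
  refine le_trans ?_ (ofReal_mul_playLaw_le_gameLaw ω _)
  refine (mul_one _).symm.trans_le (mul_le_mul_right ?_ _)
  rw [← measure_univ (μ := playLaw σ ω)]
  refine measure_mono_ae ?_
  filter_upwards [hprice k] with h hh _
  change edist v (X ω) ≤ edist (price y₀ (k + 1) h) (X ω)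
  rw [hh]

end NotAggregates

variable [MetricSpace T] [BorelSpace T] {E : Set (Ω → ProbabilityMeasure T)} {X : Ω → ℝ} {n : ℕ}
  [NeZero n] {P : InfoStructure Ω n}

/-- The strategy of never acquiring information, announcing `v` at the start of the game and
repeating the previous announcement afterwards. -/
def follow (κ : CostStructure E) (v : predictions X) (i : Fin n) : Strategy E X P i where
  signal _ _ _ := κ.free
  announce k _ p := lastPrice v k p.1.1.1
  measurable_signal _ _ := measurable_const
  measurable_announce _ _ := by fun_prop

variable (κ : CostStructure E) (v : predictions X)

lemma chosenSignal_follow (ω : Ω) (k : ℕ) (p : (Fin k → Move E X) × unitInterval) :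
    chosenSignal (P := P) (follow κ v) ω k p = κ.free := rfl

lemma resultingMove_follow (ω : Ω) (k : ℕ) (g : Fin k → Move E X) (u : unitInterval) (τ : T) :
    resultingMove (P := P) (follow κ v) ω k (g, (u, τ)) =
      ((κ.free, τ), lastPrice v k (announcements g)) := rfl

lemma ae_price_succ_follow (y₀ : ℝ) (ω : Ω) (k : ℕ) :
    ∀ᵐ h ∂(playLaw (P := P) (follow κ v) ω), price y₀ (k + 1) h = v := by
  -- From index `1` on the price does not depend on `y₀`, so the game may be started at `v`.
  suffices hstart : ∀ k, ∀ᵐ h ∂(playLaw (P := P) (follow κ v) ω), price (v : ℝ) k h = v from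
    hstart (k + 1)
  intro k
  induction k with
  | zero => exact .of_forall fun _ => rfl
  | succ k ih =>
    filter_upwards [ih, ae_price_succ_of_repeat (σ := follow (P := P) κ v) v fun g u τ =>
      congrArg Prod.snd (resultingMove_follow κ v ω k g u τ)] with h hk hrepeat
    exact hrepeat.trans hk

variable {i : Fin n} (d : Strategy E X P i)

lemma chosenSignal_update_follow (ω : Ω) {k : ℕ} (hk : turn n k ≠ i)
    (p : (Fin k → Move E X) × unitInterval) :
    chosenSignal (Function.update (follow κ v) i d) ω k p = κ.free := by
  simp [chosenSignal, hk, follow]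

lemma resultingMove_update_follow (ω : Ω) {k : ℕ} (hk : turn n k ≠ i) (g : Fin k → Move E X)
    (u : unitInterval) (τ : T) :
    resultingMove (Function.update (follow κ v) i d) ω k (g, (u, τ)) =
      ((κ.free, τ), lastPrice v k (announcements g)) := by
  rw [resultingMove, chosenSignal_update_follow κ v d ω hk]
  simp only [Function.update_of_ne hk]
  rfl

lemma chosenSignal_update_follow_congr {ω ω' : Ω} (h : P.part i ω ω') (k : ℕ) :
    chosenSignal (Function.update (follow κ v) i d) ω k =
      chosenSignal (Function.update (follow κ v) i d) ω' k := by
  funext p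
  by_cases hk : turn n k = i
  · subst hk
    rw [chosenSignal, chosenSignal, Quotient.sound h]
  · simp only [chosenSignal_update_follow κ v d _ hk]

lemma resultingMove_update_follow_congr {ω ω' : Ω} (h : P.part i ω ω') (k : ℕ) :
    resultingMove (Function.update (follow κ v) i d) ω k =
      resultingMove (Function.update (follow κ v) i d) ω' k := by
  funext ⟨g, u, τ⟩
  by_cases hk : turn n k = i
  · rw [resultingMove, resultingMove, chosenSignal_update_follow_congr κ v d h]
    subst hk
    rw [Quotient.sound h]
  · simp only [resultingMove_update_follow κ v d _ hk]

end Follow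

lemma sum_discounted_sub_nonpos {d : ℕ → ℝ} {β : ℝ} (hd : ∀ k, d k ≤ d 0) (hβ : 0 < β)
    (hβ1 : β ≤ 1) (m : ℕ) : ∑ k ∈ Finset.range m, β ^ (k + 1) * (d (k + 1) - d k) ≤ 0 := by
  have hsum : ∑ k ∈ Finset.range m, β ^ (k + 1) * (d (k + 1) - d k) ≤ β ^ m * (d m - d 0) := by
    induction m with
    | zero => simp
    | succ m ih =>
      rw [Finset.sum_range_succ]
      have hpow : β ^ (m + 1) ≤ β ^ m := pow_le_pow_of_le_one hβ.le hβ1 (Nat.le_succ m)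
      nlinarith [hd m]
  exact hsum.trans (mul_nonpos_of_nonneg_of_nonpos (by positivity) (sub_nonpos.2 (hd m)))

section NetScore

variable {Ω T : Type*} [Fintype Ω] [MeasurableSpace T] [MetricSpace T] [BorelSpace T]
  {E : Set (Ω → ProbabilityMeasure T)} {X : Ω → ℝ} {n : ℕ} [NeZero n] {P : InfoStructure Ω n}
  {κ : CostStructure E} {s : ℝ → ℝ → ℝ} {L : ℝ} {μ : Ω → ℝ} {σ : ∀ i, Strategy E X P i}

/-- The expected truncated cost of the signal bought at index `k`. -/
def meanTruncCost (κ : CostStructure E) (L : ℝ) (μ : Ω → ℝ) (σ : ∀ i, Strategy E X P i) (k : ℕ) :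
    ℝ :=
  ∑ ω, μ ω * ∫ h, truncCost κ L (h k).1.1 ∂(playLaw σ ω)

lemma meanTruncCost_nonneg (hμ : ∀ ω, 0 ≤ μ ω) (k : ℕ) : 0 ≤ meanTruncCost κ L μ σ k :=
  Finset.sum_nonneg fun ω _ => mul_nonneg (hμ ω) (integral_nonneg fun _ => truncCost_nonneg _)

/-- The expected score of the price at time `k`, net of the expected truncated costs of all signals
bought before. -/
def meanNetScore (κ : CostStructure E) (s : ℝ → ℝ → ℝ) (L y₀ : ℝ) (μ : Ω → ℝ)
    (σ : ∀ i, Strategy E X P i) (k : ℕ) : ℝ :=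
  meanScore s y₀ μ σ k - κ.c * ∑ j ∈ Finset.range k, meanTruncCost κ L μ σ j

lemma meanNetScore_zero (y₀ : ℝ) : meanNetScore κ s L y₀ μ σ 0 = ∑ ω, μ ω * s y₀ (X ω) := by
  rw [meanNetScore, meanScore_zero, Finset.sum_range_zero, mul_zero, sub_zero]

lemma meanNetScore_succ_sub (y₀ : ℝ) (k : ℕ) :
    meanNetScore κ s L y₀ μ σ (k + 1) - meanNetScore κ s L y₀ μ σ k =
      meanScore s y₀ μ σ (k + 1) - meanScore s y₀ μ σ k - κ.c * meanTruncCost κ L μ σ k := by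
  rw [meanNetScore, meanNetScore, Finset.sum_range_succ]
  ring

lemma meanNetScore_eq_sum_mul (y₀ : ℝ) (k : ℕ) :
    meanNetScore κ s L y₀ μ σ k = ∑ ω, μ ω * (∫ h, s (price y₀ k h) (X ω) ∂(playLaw σ ω) -
      κ.c * ∑ j ∈ Finset.range k, ∫ h, truncCost κ L (h j).1.1 ∂(playLaw σ ω)) := by
  simp only [meanNetScore, meanScore, meanTruncCost, mul_sub, Finset.sum_sub_distrib]
  rw [Finset.sum_comm, Finset.mul_sum]
  simp only [Finset.mul_sum, mul_left_comm]

variable [SecondCountableTopology T]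

lemma ofReal_meanTruncCost_le (hL : 0 ≤ L) (hμ : ∀ ω, 0 ≤ μ ω) (k : ℕ) :
    ENNReal.ofReal (meanTruncCost κ L μ σ k) ≤ meanCost κ μ σ k := by
  have hint : ∀ ω, Integrable (fun h : ℕ → Move E X => truncCost κ L (h k).1.1) (playLaw σ ω) :=
    fun ω => .of_bound (Measurable.aestronglyMeasurable (by fun_prop)) L
      (.of_forall fun h => abs_truncCost_le hL _)
  rw [meanTruncCost, ENNReal.ofReal_sum_of_nonneg fun ω _ =>
    mul_nonneg (hμ ω) (integral_nonneg fun _ => truncCost_nonneg _)]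
  refine Finset.sum_le_sum fun ω _ => ?_
  rw [ENNReal.ofReal_mul (hμ ω), ofReal_integral_eq_lintegral_ofReal (hint ω)
    (.of_forall fun _ => truncCost_nonneg _)]
  gcongr
  exact ofReal_truncCost_le _

lemma meanTruncCost_eq_zero (hL : 0 ≤ L) (hμ : ∀ ω, 0 ≤ μ ω) {k : ℕ}
    (h : ∀ ω p, κ.K (chosenSignal σ ω k p) = 0) : meanTruncCost κ L μ σ k = 0 := by
  have hle := ofReal_meanTruncCost_le (κ := κ) (σ := σ) hL hμ k
  rw [meanCost_eq_zero μ h, nonpos_iff_eq_zero, ENNReal.ofReal_eq_zero] at hle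
  exact hle.antisymm (meanTruncCost_nonneg hμ k)

variable [MeasurableSpace Ω] [MeasurableSingletonClass Ω]

lemma payoffUpTo_le_sum_meanNetScore (hs : IsScoringRule X s) (hL : 0 ≤ L) (y₀ : predictions X)
    {β : ℝ} (hβ : 0 < β) (hμ : μ ∈ stdSimplex ℝ Ω) (i : Fin n) (m : ℕ) :
    payoffUpTo κ s y₀ β μ σ i m ≤ ((∑ k ∈ Finset.range m with turn n k = i, β ^ (k + 1) *
      (meanNetScore κ s L y₀ μ σ (k + 1) - meanNetScore κ s L y₀ μ σ k) : ℝ) : EReal) := by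
  have hc := κ.c_pos
  have hcost : ENNReal.ofReal (∑ k ∈ Finset.range m with turn n k = i,
      β ^ (k + 1) * κ.c * meanTruncCost κ L μ σ k) ≤
      ∑ k ∈ Finset.range m with turn n k = i,
        ENNReal.ofReal (β ^ (k + 1) * κ.c) * meanCost κ μ σ k := by
    rw [ENNReal.ofReal_sum_of_nonneg fun k _ =>
      mul_nonneg (by positivity) (meanTruncCost_nonneg hμ.1 k)]
    refine Finset.sum_le_sum fun k _ => ?_
    rw [ENNReal.ofReal_mul (by positivity)]
    gcongr
    exact ofReal_meanTruncCost_le hL hμ.1 k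
  rw [payoffUpTo_eq hs y₀ β hμ]
  simp only [meanNetScore_succ_sub, mul_sub _ _ (κ.c * _), Finset.sum_sub_distrib, ← mul_assoc]
  rw [EReal.coe_sub]
  refine EReal.sub_le_sub le_rfl (le_trans ?_ (EReal.coe_ennreal_le_coe_ennreal_iff.2 hcost))
  rw [EReal.coe_ennreal_ofReal]
  exact_mod_cast le_max_left _ _

end NetScore

section Equilibrium

variable {Ω T : Type*} [Fintype Ω] [MeasurableSpace T] [MetricSpace T] [BorelSpace T]
  {E : Set (Ω → ProbabilityMeasure T)} {X : Ω → ℝ} {n : ℕ} {P : InfoStructure Ω n}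
  {κ : CostStructure E} {s : ℝ → ℝ → ℝ} {μ : Ω → ℝ} {v : predictions X} {i : Fin n}

lemma condCell_mem_face (r : Setoid Ω) (hμ : μ ∈ stdSimplex ℝ Ω) {ω : Ω} (hω : 0 < μ ω) :
    condCell μ r ω ∈ face {ω' | r ω ω'} :=
  ⟨condCell_mem_stdSimplex hμ hω, fun ω' hω' => by simp [condCell, Set.indicator_of_notMem hω']⟩

lemma NoInfoAcquisition.sum_mul_le (hno : NoInfoAcquisition κ P X s μ) (hs : IsScoringRule X s)
    (hμ : μ ∈ stdSimplex ℝ Ω) (hv : ∀ ω, 0 < μ ω → expect (condCell μ (P.part i) ω) X = v)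
    {f : Ω → ℝ} (hf : ∀ ω, IsDominatedOn κ X s {ω' | P.part i ω ω'} f) :
    ∑ ω, μ ω * f ω ≤ ∑ ω, μ ω * s v (X ω) := by
  rw [← sum_mul_condCell (r := P.part i) hμ (G := fun _ => f) fun _ _ _ => rfl,
    ← sum_mul_condCell (r := P.part i) hμ (G := fun _ ω => s v (X ω)) fun _ _ _ => rfl]
  refine Finset.sum_le_sum fun ω _ => ?_
  rcases (hμ.1 ω).eq_or_lt with hω | hω
  · simp [← hω]
  · have : Nonempty Ω := ⟨ω⟩
    have hcell := (hf ω _ (condCell_mem_face _ hμ hω)).trans (hno.optimalValue_le hs hμ hω i)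
    rw [hv ω hω] at hcell
    exact mul_le_mul_of_nonneg_left hcell hω.le

variable [NeZero n] [SecondCountableTopology T] {A L : ℝ}

section Deviation

variable (hOne : OneSignalSuffices κ) (hs : IsScoringRule X s)
  (hA : ∀ (y : predictions X) (ω : Ω), |s y (X ω)| ≤ A) (hL : 0 ≤ L) (hAL : 2 * A ≤ κ.c * L)
  (d : Strategy E X P i) (k : ℕ)
include hOne hs hA hL hAL

lemma isDominatedOn_update_follow (ω₀ : Ω) :
    IsDominatedOn κ X s {ω | P.part i ω₀ ω} fun ω =>
      ∫ h, s (price (v : ℝ) k h) (X ω) ∂(playLaw (Function.update (follow κ v) i d) ω) -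
        κ.c * ∑ j ∈ Finset.range k, ∫ h, truncCost κ L (h j).1.1
          ∂(playLaw (Function.update (follow κ v) i d) ω) := by
  have : Nonempty Ω := ⟨ω₀⟩
  simp only [price_eq_lastPrice]
  exact IsDominatedOn.integral_playLaw hOne hs hA hL hAL
    (fun ω hω => chosenSignal_update_follow_congr κ v d ((P.part i).symm hω))
    (fun ω hω => resultingMove_update_follow_congr κ v d ((P.part i).symm hω))
    (G := fun ω g => s (lastPrice v k (announcements g)) (X ω))
    (fun ω => hs.measurable_score ω (by fun_prop)) (fun ω g => hA _ _)
    fun g => hs.isDominatedOn _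

lemma meanNetScore_update_follow_le (hμ : μ ∈ stdSimplex ℝ Ω)
    (hno : NoInfoAcquisition κ P X s μ)
    (hv : ∀ ω, 0 < μ ω → expect (condCell μ (P.part i) ω) X = v) :
    meanNetScore κ s L v μ (Function.update (follow κ v) i d) k ≤
      meanNetScore κ s L v μ (Function.update (follow κ v) i d) 0 := by
  rw [meanNetScore_eq_sum_mul, meanNetScore_zero]
  exact hno.sum_mul_le hs hμ hv (isDominatedOn_update_follow hOne hs hA hL hAL d k)

end Deviation

lemma meanNetScore_update_follow_succ_sub (hL : 0 ≤ L) (hμ : ∀ ω, 0 ≤ μ ω)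
    (d : Strategy E X P i) {k : ℕ} (hk : turn n k ≠ i) :
    meanNetScore κ s L v μ (Function.update (follow κ v) i d) (k + 1) -
      meanNetScore κ s L v μ (Function.update (follow κ v) i d) k = 0 := by
  rw [meanNetScore_succ_sub,
    meanScore_succ_of_repeat s v μ fun ω g u τ =>
      congrArg Prod.snd (resultingMove_update_follow κ v d ω hk g u τ),
    meanTruncCost_eq_zero hL hμ fun ω p => by
      rw [chosenSignal_update_follow κ v d ω hk, κ.K_free]]
  simp

variable [MeasurableSpace Ω] [MeasurableSingletonClass Ω] {β : ℝ}

lemma payoffUpTo_succ_eq_add (hs : IsScoringRule X s) (y₀ v : predictions X) (β : ℝ)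
    (hμ : μ ∈ stdSimplex ℝ Ω) (σ : ∀ i, Strategy E X P i) (i : Fin n) (m : ℕ) :
    payoffUpTo κ s y₀ β μ σ i (m + 1) = payoffUpTo κ s v β μ σ i (m + 1) +
      ((if turn n 0 = i then β * (∑ ω, μ ω * s v (X ω) - ∑ ω, μ ω * s y₀ (X ω)) else 0 : ℝ) :
        EReal) := by
  have hsucc : ∀ k, meanScore s y₀ μ σ (k + 1) = meanScore s v μ σ (k + 1) := fun k => rfl
  have hadd : ∀ (a b : ℝ) (C : ℝ≥0∞), (a : EReal) - (C : EReal) + (b : EReal) =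
      ((a + b : ℝ) : EReal) - (C : EReal) := fun a b C => by
    simpa using (coe_add_sub_coe_add (a := a) (b := b) (C := C) ENNReal.zero_ne_top).symm
  rw [payoffUpTo_eq hs y₀ β hμ, payoffUpTo_eq hs v β hμ, hadd]
  congr 2
  rw [Finset.sum_filter, Finset.sum_filter, Finset.sum_range_succ', Finset.sum_range_succ']
  simp only [hsucc, meanScore_zero]
  split_ifs <;> ring

lemma payoffUpTo_follow (hs : IsScoringRule X s) (v : predictions X) (β : ℝ)
    (hμ : μ ∈ stdSimplex ℝ Ω) (i : Fin n) (m : ℕ) :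
    payoffUpTo (P := P) κ s v β μ (follow κ v) i m = 0 := by
  have hscore : ∀ k, meanScore s v μ (follow (P := P) κ v) (k + 1) =
      meanScore s v μ (follow (P := P) κ v) k := fun k =>
    meanScore_succ_of_repeat s v μ fun ω g u τ =>
      congrArg Prod.snd (resultingMove_follow κ v ω k g u τ)
  have hcost : ∀ k, meanCost κ μ (follow (P := P) κ v) k = 0 := fun k =>
    meanCost_eq_zero μ fun ω p => by rw [chosenSignal_follow, κ.K_free]
  rw [payoffUpTo_eq hs v β hμ]
  simp [hscore, hcost]

lemma payoffUpTo_update_follow_le (hOne : OneSignalSuffices κ) (hs : IsScoringRule X s)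
    (hβ : 0 < β) (hβ1 : β ≤ 1) (hμ : μ ∈ stdSimplex ℝ Ω) (hno : NoInfoAcquisition κ P X s μ)
    (hv : ∀ ω, 0 < μ ω → expect (condCell μ (P.part i) ω) X = v) (d : Strategy E X P i) (m : ℕ) :
    payoffUpTo κ s v β μ (Function.update (follow κ v) i d) i m ≤ 0 := by
  obtain ⟨A, hA0, hA⟩ := hs.exists_bound
  have hL : 0 ≤ 2 * A / κ.c := div_nonneg (by positivity) κ.c_pos.le
  have hAL : 2 * A ≤ κ.c * (2 * A / κ.c) := (mul_div_cancel₀ _ κ.c_pos.ne').ge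
  refine (payoffUpTo_le_sum_meanNetScore hs hL v hβ hμ i m).trans (EReal.coe_nonpos.2 ?_)
  rw [Finset.sum_filter_of_ne fun k _ hne => ?_]
  · exact sum_discounted_sub_nonpos (fun k =>
      meanNetScore_update_follow_le hOne hs hA hL hAL d k hμ hno hv) hβ hβ1 m
  · by_contra hk
    exact hne (by rw [meanNetScore_update_follow_succ_sub hL hμ.1 d hk, mul_zero])

lemma isNash_follow (hOne : OneSignalSuffices κ) (hs : IsScoringRule X s) (hβ : 0 < β)
    (hβ1 : β ≤ 1) (hμ : μ ∈ stdSimplex ℝ Ω) (hno : NoInfoAcquisition κ P X s μ)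
    (y₀ : predictions X) (hv : ∀ i ω, 0 < μ ω → expect (condCell μ (P.part i) ω) X = v) :
    IsNash (P := P) κ s y₀ β μ (follow κ v) := by
  intro i
  refine ⟨((if turn n 0 = i then β * (∑ ω, μ ω * s v (X ω) - ∑ ω, μ ω * s y₀ (X ω)) else 0 : ℝ) :
    EReal), (tendsto_add_atTop_iff_nat 1).1 (tendsto_const_nhds.congr fun m => ?_),
    fun d u' hu' => le_of_tendsto' ((tendsto_add_atTop_iff_nat 1).2 hu') fun m => ?_⟩
  · rw [payoffUpTo_succ_eq_add hs y₀ v β hμ, payoffUpTo_follow hs v β hμ, zero_add]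
  · rw [payoffUpTo_succ_eq_add hs y₀ v β hμ]
    exact add_le_of_nonpos_left (payoffUpTo_update_follow_le hOne hs hβ hβ1 hμ hno (hv i) d (m + 1))

end Equilibrium

end InfoMarket

end

open InfoMarket in
theorem theorem1_general {Ω T : Type*} [Fintype Ω] [MeasurableSpace Ω] [MeasurableSingletonClass Ω]
    [MetricSpace T] [SecondCountableTopology T] [MeasurableSpace T] [BorelSpace T]
    {n : ℕ} [NeZero n] (P : InfoStructure Ω n) (X : Ω → ℝ)
    (E : Set (Ω → ProbabilityMeasure T)) (κ : CostStructure E) :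
    (∀ s, IsScoringRule X s → KappaSeparable κ P X s →
      ∀ μ ∈ stdSimplex ℝ Ω, ∀ y₀ ∈ predictions X, ∀ β : ℝ, 0 < β → β ≤ 1 →
        ∀ σ : ∀ i, Strategy E X P i, IsNash κ s y₀ β μ σ → Aggregates y₀ μ σ) ∧
    (OneSignalSuffices κ →
      ∀ S : Set (ℝ → ℝ → ℝ), (∀ s ∈ S, IsScoringRule X s) → KappaNonSeparable κ P X S →
        ∃ μ ∈ stdSimplex ℝ Ω, ∀ s ∈ S, ∀ y₀ ∈ predictions X, ∀ β : ℝ, 0 < β → β ≤ 1 →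
          ∃ σ : ∀ i, Strategy E X P i, IsNash κ s y₀ β μ σ ∧ ¬ Aggregates y₀ μ σ) := by
  constructor
  · intro s hs hsep μ hμ y₀ hy₀ β hβ hβ1 σ hN
    have : Nonempty Ω := not_isEmpty_iff.1 fun _ => by simpa using hμ.2
    obtain ⟨ε, hε, hgain⟩ := hN.exists_isGainBound (y₀ := ⟨y₀, hy₀⟩) hs hβ hβ1 hμ
    exact hgain.aggregates hε hs hμ fun γ hγ hne => hsep.exists_plan hs hγ hne
  · rintro hOne S hS ⟨μ, hμ, ⟨v, ⟨ω, hω, hne⟩, hv⟩, hno⟩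
    have hmem : v ∈ predictions X :=
      hv 0 ω hω ▸ expect_mem_predictions (condCell_mem_stdSimplex hμ hω)
    exact ⟨μ, hμ, fun s hs y₀ hy₀ β hβ hβ1 => ⟨follow κ ⟨v, hmem⟩,
      isNash_follow hOne (hS s hs) hβ hβ1 hμ (hno s hs) ⟨y₀, hy₀⟩ hv,
      not_aggregates_of_ae_price_eq hω hne (ae_price_succ_follow κ ⟨v, hmem⟩ y₀ ω)⟩⟩

open InfoMarket in
theorem theorem1 {Ω T : Type*} [Fintype Ω] [MeasurableSpace Ω] [MeasurableSingletonClass Ω]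
    [MetricSpace T] [CompleteSpace T] [SecondCountableTopology T] [MeasurableSpace T] [BorelSpace T]
    {n : ℕ} [NeZero n] (P : InfoStructure Ω n) (X : Ω → ℝ)
    (E : Set (Ω → ProbabilityMeasure T)) (hE : IsCompact E) (κ : CostStructure E) :
    (∀ s, IsScoringRule X s → KappaSeparable κ P X s →
      ∀ μ ∈ stdSimplex ℝ Ω, ∀ y₀ ∈ predictions X, ∀ β : ℝ, 0 < β → β ≤ 1 →
        ∀ σ : ∀ i, Strategy E X P i, IsNash κ s y₀ β μ σ → Aggregates y₀ μ σ) ∧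
    (OneSignalSuffices κ →
      ∀ S : Set (ℝ → ℝ → ℝ), (∀ s ∈ S, IsScoringRule X s) → KappaNonSeparable κ P X S →
        ∃ μ ∈ stdSimplex ℝ Ω, ∀ s ∈ S, ∀ y₀ ∈ predictions X, ∀ β : ℝ, 0 < β → β ≤ 1 →
          ∃ σ : ∀ i, Strategy E X P i, IsNash κ s y₀ β μ σ ∧ ¬ Aggregates y₀ μ σ) :=
  theorem1_general P X E κ
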